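/- All graphs are finite and simple. For vertex sets $A,B$ of a graph $G$ (possibly $A=B$), $A$ \emph{dominates} $B$ if every vertex of $B$ is adjacent to a vertex of $A$, and $A$ \emph{m-totally dominates} $B$ if every vertex of $A\cup B$ is adjacent to a vertex of $A$. A \emph{total transitive partition} of size $k$ is an ordered partition of $V(G)$ into nonempty sets $V_1,\dots,V_k$ such that $V_i$ dominates $V_j$ for all $1\le i\le j\le k$; it is a \emph{modified-total transitive partition} if instead $V_i$ m-totally dominates $V_j$ for all $1\le i<j\le k$. The \emph{total transitivity} $Tr_t(G)$ is the maximum size of a total transitive partition. For a vertex $v$, $ttr(v,G)$ (respectively $mttr(v,G)$) is the maximum $p$ such that $v\in V_p$ for some total transitive (respectively modified-total transitive) partition $V_1,\dots,V_k$ of $G$ (and $0$ if there is none). For a tree $T$ rooted at a vertex $c$, let $T^c_v$ be the subtree hanging from $v$, i.e. induced by the vertices $w$ such that $v$ lies on the path from $c$ to $w$; put $ttr^r(v)=ttr(v,T^c_v)$ and $mttr^r(v)=mttr(v,T^c_v)$. \textbf{Theorem.} \textbf{(1) Algorithm.} There are a single program for a unit-cost random access machine and a constant $C$ such that, for every tree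 $T$ with vertex set $\{0,\dots,n-1\}$, $n\ge 2$, given by $n$, the number of edges and a list of its edges (in any order and orientation), the program halts after at most $Cn^2$ steps and outputs $Tr_t(T)$, a total transitive partition of $T$ of maximum size $Tr_t(T)$, and the numbers $ttr(v,T)$ for all vertices $v$. The machine has registers and arrays of natural numbers; one step is the assignment of a constant, a copy, an increment, a (truncated) decrement, an array read or write at an index held in a register, or a test $x<y$ or $x=y$ between two registers, and programs are built from these by sequencing, if--then--else and while. \textbf{(2) Reduction to rooted trees.} For every tree $T$ with at least two vertices, total transitive partitions exist, $Tr_t(T)=\max_{v\in V(T)} ttr(v,T)$, and $ttr(c,T)=ttr^r(c)$ for $T$ rooted at $c$, for every vertex $c$. \textbf{(3) Recursion.} Let $T$ be a tree with at least two vertices, rooted at a vertex $c$, and let $x$ be a vertex. \begin{itemize} \item If $x$ has no child, then $mttr^r(x)=1$. \item If some child of $x$ has no child, then $ttr^r(x)=mttr^r(x)=1$. \item Otherwise (that is, $x$ has at least one child and every child of $x$ has a child), let $v_1,\dots,v_k$ be the children of $x$, and let $l_j'=mttr^r(v_j)$ if $ttr^r(v_j)=mttr^r(v_j)$ and $l_j'=mttr^r(v_j)-1$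 otherwise, the children being numbered so that $l_1'\le\dots\le l_k'$. Let $z$ be the largest integer for which there are indices $i_1<\dots<i_z$ with $l'_{i_p}\ge p$ for $1\le p\le z$. \begin{itemize} \item[(a)] If there are such indices $i_1<\dots<i_z$ and an index $q\notin\{i_1,\dots,i_z\}$ with $ttr^r(v_q)\ne mttr^r(v_q)$ and $mttr^r(v_q)\ge z+1$, then $ttr^r(x)=mttr^r(x)=z+1$. \item[(b)] If there are no such indices, then $mttr^r(x)=z+1$ and $ttr^r(x)=z$. \end{itemize} \end{itemize} -/

import Mathlib

/-! ### Total transitive and modified-total transitive partitions -/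

universe u

namespace TotTrans

/-- `A` dominates `B`: every vertex of `B` is adjacent to a vertex of `A`.
With `A = B` this says that every vertex of `A` is adjacent to another vertex of `A`. -/
def Dominates {V : Type u} (G : SimpleGraph V) (A B : Set V) : Prop :=
  ∀ b ∈ B, ∃ a ∈ A, G.Adj b a

/-- `A` m-totally dominates `B`: every vertex of `A ∪ B` is adjacent to a vertex of `A`. -/
def MDominates {V : Type u} (G : SimpleGraph V) (A B : Set V) : Prop :=
  ∀ b ∈ A ∪ B, ∃ a ∈ A, G.Adj b a

/-- `P 0, …, P (k - 1)` are the (ordered) parts of a partition of the vertex set into `k`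
nonempty parts; the part called `V_{i+1}` in mathematical notation is `P i`. -/
structure IsOrderedPartition {V : Type u} {k : ℕ} (P : Fin k → Set V) : Prop where
  nonempty : ∀ i, (P i).Nonempty
  disjoint : ∀ i j, i ≠ j → Disjoint (P i) (P j)
  cover : ⋃ i, P i = Set.univ

/-- Total transitive partition of size `k`. -/
def IsTotalTransitivePartition {V : Type u} (G : SimpleGraph V) {k : ℕ}
    (P : Fin k → Set V) : Prop :=
  IsOrderedPartition P ∧ ∀ i j, i ≤ j → Dominates G (P i) (P j)

/-- Modified-total transitive partition of size `k`. -/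
def IsModifiedTotalTransitivePartition {V : Type u} (G : SimpleGraph V) {k : ℕ}
    (P : Fin k → Set V) : Prop :=
  IsOrderedPartition P ∧ ∀ i j, i < j → MDominates G (P i) (P j)

/-- The total transitivity of a graph: the maximum size of a total transitive partition. -/
noncomputable def totalTransitivity {V : Type u} (G : SimpleGraph V) : ℕ :=
  sSup {k : ℕ | ∃ P : Fin k → Set V, IsTotalTransitivePartition G P}

/-- The total transitive number of `v`: the maximum `p` such that `v` lies in the `p`-th part
(counted from one) of a total transitive partition. -/
noncomputable def ttr {V : Type u} (G : SimpleGraph V) (v : V) : ℕ :=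
  sSup {p : ℕ | ∃ (k : ℕ) (P : Fin k → Set V) (i : Fin k),
    IsTotalTransitivePartition G P ∧ v ∈ P i ∧ p = (i : ℕ) + 1}

/-- The modified-total transitive number of `v`. -/
noncomputable def mttr {V : Type u} (G : SimpleGraph V) (v : V) : ℕ :=
  sSup {p : ℕ | ∃ (k : ℕ) (P : Fin k → Set V) (i : Fin k),
    IsModifiedTotalTransitivePartition G P ∧ v ∈ P i ∧ p = (i : ℕ) + 1}

/-! ### Rooted trees -/

/-- Vertex set of the subtree hanging from `v` in the tree `T` rooted at `c`: the vertices `w`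
such that `v` lies on the path from `c` to `w`. -/
def subtreeSet {V : Type u} (T : SimpleGraph V) (c v : V) : Set V :=
  {w | ∀ p : T.Walk c w, p.IsPath → v ∈ p.support}

theorem self_mem_subtreeSet {V : Type u} (T : SimpleGraph V) (c v : V) :
    v ∈ subtreeSet T c v := fun p _ => p.end_mem_support

/-- The children of `x` in the tree `T` rooted at `c`. -/
def childSet {V : Type u} (T : SimpleGraph V) (c x : V) : Set V :=
  {w | T.Adj x w ∧ w ∈ subtreeSet T c x}

/-- The rooted total transitive number of `v` in the tree `T` rooted at `c`. -/
noncomputable def rttr {V : Type u} (T : SimpleGraph V) (c v : V) : ℕ :=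
  ttr (T.induce (subtreeSet T c v)) ⟨v, self_mem_subtreeSet T c v⟩

/-- The rooted modified-total transitive number of `v` in the tree `T` rooted at `c`. -/
noncomputable def rmttr {V : Type u} (T : SimpleGraph V) (c v : V) : ℕ :=
  mttr (T.induce (subtreeSet T c v)) ⟨v, self_mem_subtreeSet T c v⟩

/-- The number passed from a vertex `v` to its parent by the dynamic programme: the label of `v`
is `rmttr T c v`; it is kept if it is also the rooted total transitive number of `v`, and is
lowered by one otherwise. -/
noncomputable def passedLabel {V : Type u} (T : SimpleGraph V) (c v : V) : ℕ :=
  if rttr T c v = rmttr T c v then rmttr T c v else rmttr T c v - 1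

/-- The sequence `l` of length `k` has a subsequence of length `z` whose `p`-th term is at least
`p`, for `p = 1, …, z`; `i` selects the subsequence. -/
def IsAdmissibleSubsequence {k : ℕ} (l : Fin k → ℕ) {z : ℕ} (i : Fin z → Fin k) : Prop :=
  StrictMono i ∧ ∀ p : Fin z, (p : ℕ) + 1 ≤ l (i p)

/-! ### A unit-cost random access machine, as a structured programming language -/

/-- Memory: registers and arrays of natural numbers. A program, being a finite object, refers to
finitely many registers and arrays only. -/
structure Mem where
  reg : ℕ → ℕ
  arr : ℕ → ℕ → ℕ

def Mem.setReg (s : Mem) (x a : ℕ) : Mem :=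
  { s with reg := Function.update s.reg x a }

def Mem.setArr (s : Mem) (A j a : ℕ) : Mem :=
  { s with arr := Function.update s.arr A (Function.update (s.arr A) j a) }

/-- Comparisons of two registers. -/
inductive Test where
  | lt (x y : ℕ)
  | eq (x y : ℕ)

def Test.Holds : Test → Mem → Prop
  | .lt x y, s => s.reg x < s.reg y
  | .eq x y, s => s.reg x = s.reg y

/-- Programs. The only arithmetic is adding and subtracting one, so that after `t` steps every
stored number exceeds the largest number in the input and the program text by at most `t`. -/
inductive Prog where
  /-- `x := m` -/
  | const (x m : ℕ)
  /-- `x := y` -/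
  | copy (x y : ℕ)
  /-- `x := y + 1` -/
  | succ (x y : ℕ)
  /-- `x := y - 1` (and zero if `y` is zero) -/
  | pred (x y : ℕ)
  /-- `x := A[y]` -/
  | load (x A y : ℕ)
  /-- `A[x] := y` -/
  | store (A x y : ℕ)
  /-- `c; d` -/
  | seq (c d : Prog)
  /-- `if b then c else d` -/
  | cond (b : Test) (c d : Prog)
  /-- `while b do c` -/
  | loop (b : Test) (c : Prog)

/-- `Exec c s t s'`: started in memory `s`, the program `c` halts after exactly `t` steps with
memory `s'`. Every elementary operation and every evaluation of a test is one step. -/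
inductive Exec : Prog → Mem → ℕ → Mem → Prop where
  | const (x m : ℕ) (s : Mem) : Exec (.const x m) s 1 (s.setReg x m)
  | copy (x y : ℕ) (s : Mem) : Exec (.copy x y) s 1 (s.setReg x (s.reg y))
  | succ (x y : ℕ) (s : Mem) : Exec (.succ x y) s 1 (s.setReg x (s.reg y + 1))
  | pred (x y : ℕ) (s : Mem) : Exec (.pred x y) s 1 (s.setReg x (s.reg y - 1))
  | load (x A y : ℕ) (s : Mem) : Exec (.load x A y) s 1 (s.setReg x (s.arr A (s.reg y)))
  | store (A x y : ℕ) (s : Mem) : Exec (.store A x y) s 1 (s.setArr A (s.reg x) (s.reg y))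
  | seq {c d : Prog} {s s₁ s₂ : Mem} {t₁ t₂ : ℕ} :
      Exec c s t₁ s₁ → Exec d s₁ t₂ s₂ → Exec (.seq c d) s (t₁ + t₂) s₂
  | cond_true {b : Test} {c d : Prog} {s s₁ : Mem} {t : ℕ} :
      b.Holds s → Exec c s t s₁ → Exec (.cond b c d) s (t + 1) s₁
  | cond_false {b : Test} {c d : Prog} {s s₁ : Mem} {t : ℕ} :
      ¬ b.Holds s → Exec d s t s₁ → Exec (.cond b c d) s (t + 1) s₁
  | loop_true {b : Test} {c : Prog} {s s₁ s₂ : Mem} {t₁ t₂ : ℕ} :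
      b.Holds s → Exec c s t₁ s₁ → Exec (.loop b c) s₁ t₂ s₂ →
        Exec (.loop b c) s (t₁ + t₂ + 1) s₂
  | loop_false {b : Test} {c : Prog} {s : Mem} :
      ¬ b.Holds s → Exec (.loop b c) s 1 s

/-- `L` lists every edge of `G` exactly once, in any order and with any orientation. -/
def IsEdgeList {n : ℕ} (G : SimpleGraph (Fin n)) (L : List (Fin n × Fin n)) : Prop :=
  (L.map fun e => s(e.1, e.2)).Nodup ∧
    ∀ e : Sym2 (Fin n), e ∈ (L.map fun e => s(e.1, e.2)) ↔ e ∈ G.edgeSet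

/-- Initial memory for a graph with vertices `0, …, n - 1` given by the edge list `L`: register 0
holds `n`, register 1 the number of edges, arrays 0 and 1 the first and second ends of the edges;
everything else is zero. -/
def inputMem {n : ℕ} (L : List (Fin n × Fin n)) : Mem where
  reg := fun x => if x = 0 then n else if x = 1 then L.length else 0
  arr := fun A j =>
    if A = 0 then (L.map fun e => (e.1 : ℕ)).getD j 0
    else if A = 1 then (L.map fun e => (e.2 : ℕ)).getD j 0
    else 0

end TotTrans

namespace TotTrans
open SimpleGraph

/-! ### Rooted trees -/

section RootedTree

variable {V : Type u} {T : SimpleGraph V}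

/-! A partition is encoded as a colouring by positive integers. It is total transitive exactly when
every vertex sees, among its neighbours, all colours from 1 up to its own and no class is empty.
Cutting all colours off at a given value preserves this, so the colours attainable at `x` form an
initial segment, and `ttr` and `mttr` become thresholds of two predicates: `Full`, where every
vertex is satisfied, and `Half`, where `x` may lack a neighbour of its own colour (`le_ttr_iff`,
`le_mttr_iff`). The total transitivity is the largest `ttr`, because a vertex of the last part has
`ttr` at least the number of parts, and a colouring that realises the largest `ttr` has no larger
colour.

In a rooted tree the edge from a child `w` to `x` is the only link between the subtree of `w` and
the rest. Let `x` have colour `p`. A child of colour below `p` never needs `x`, so its colour is at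
most `rttr T c w`; a child of colour `p` may use `x` as its neighbour of equal colour, so its colour
is only bounded by `rmttr T c w`. Conversely, colourings of the child subtrees with such values glue
together (`exists_glue`). Hence, if no child is a leaf, `p ≤ rmttr T c x` means that distinct
children have `rttr` at least 1, …, p - 1, and `p ≤ rttr T c x` means the same for 1, …, p, where
the child for `p` may use `rmttr` instead (`le_rmttr_iff_sys`, `le_rttr_iff_helpedSys`). A leaf
child forces colour 1 on `x`. It follows that the two labels differ by at most one, so that the
label passed to the parent is always `rttr` (`passedLabel_eq`), and sorting the children turns
systems into admissible subsequences.

For the algorithm, Hall's theorem expresses the largest size of a system as the minimum over `i` of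
`i` plus the number of children with label above `i` (`isGreatest_sys_of_count`); a greedy sweep
over buckets of labels finds it in linear time. The part of the tree at `x` that is cut off from a
neighbour `y` does not depend on the root, so labels belong to darts, that is, oriented edges. Along
a search order, a backward pass labels the darts to parents and a forward pass those from parents;
taking each vertex as its own root then gives all `ttr`. These are O(n) sweeps of O(n) steps. A
search from a vertex of largest `ttr` yields an order in which the same sweep hands out colours to
children, and a colour not supplied by the children is the colour of the parent. -/

theorem mem_subtreeSet_iff (hT : T.IsTree) {c w v : V} (p : T.Walk c w) (hp : p.IsPath) :
    w ∈ subtreeSet T c v ↔ v ∈ p.support := by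
  refine ⟨fun h => h p hp, fun h q hq => ?_⟩
  have := (hT.existsUnique_path c w).unique hp hq
  rwa [← this]

theorem exists_isPath (hT : T.IsTree) (c w : V) : ∃ p : T.Walk c w, p.IsPath :=
  (hT.existsUnique_path c w).exists

theorem subtreeSet_self (c : V) : subtreeSet T c c = Set.univ :=
  Set.eq_univ_of_forall fun _ p _ => p.start_mem_support

/-- `v` is a child of `u` in the tree `T` rooted at `c`. -/
def IsChild (T : SimpleGraph V) (c u v : V) : Prop :=
  T.Adj u v ∧ (∀ a, v ∈ subtreeSet T c a ↔ u ∈ subtreeSet T c a ∨ a = v) ∧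
    u ∉ subtreeSet T c v

theorem isChild_of_notMem (hT : T.IsTree) {c u v : V} (h : T.Adj u v) (p : T.Walk c u)
    (hp : p.IsPath) (hv : v ∉ p.support) : IsChild T c u v := by
  have hq : (p.concat h).IsPath := hp.concat hv h
  refine ⟨h, fun a => ?_, ?_⟩
  · rw [mem_subtreeSet_iff hT _ hq, mem_subtreeSet_iff hT p hp, Walk.support_concat]
    simp
  · rwa [mem_subtreeSet_iff hT p hp]

theorem isChild_or_isChild (hT : T.IsTree) (c : V) {u v : V} (h : T.Adj u v) :
    IsChild T c u v ∨ IsChild T c v u := by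
  classical
  obtain ⟨p, hp⟩ := exists_isPath hT c u
  by_cases hv : v ∈ p.support
  · right
    refine isChild_of_notMem hT h.symm (p.takeUntil v hv) (hp.takeUntil hv) ?_
    exact Walk.endpoint_notMem_support_takeUntil hp hv h.ne
  · exact Or.inl (isChild_of_notMem hT h p hp hv)

/-- Induction on the length of the path from `c`; deleting its last vertex leads to the parent. -/
theorem tree_induction (hT : T.IsTree) (c : V) {P : V → Prop} (h0 : P c)
    (hs : ∀ u v, IsChild T c u v → P u → P v) (v : V) : P v := by
  obtain ⟨p, hp⟩ := exists_isPath hT c v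
  induction hn : p.length generalizing v with
  | zero => exact (Walk.eq_of_length_eq_zero hn) ▸ h0
  | succ n ih =>
    have hnil : ¬ p.Nil := by
      intro h; rw [← Walk.length_eq_zero_iff] at h; omega
    have hadj := p.adj_penultimate hnil
    have hp' : p.dropLast.IsPath := hp.dropLast
    refine hs p.penultimate v (isChild_of_notMem hT hadj p.dropLast hp' ?_) (ih _ _ hp' ?_)
    · have : (p.dropLast.concat hadj).IsPath := by
        rw [Walk.concat_dropLast]; exact hp
      rw [Walk.concat_isPath_iff] at this
      exact this.2
    · have := congrArg Walk.length (p.concat_dropLast hadj)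
      rw [Walk.length_concat] at this
      omega

/-! ### Ancestry and the subtrees of the children -/

theorem subtreeSet_antisymm (hT : T.IsTree) {c v w : V} (h₁ : w ∈ subtreeSet T c v)
    (h₂ : v ∈ subtreeSet T c w) : v = w := by
  classical
  obtain ⟨p, hp⟩ := exists_isPath hT c w
  have hv := h₁ p hp
  by_contra hne
  exact Walk.endpoint_notMem_support_takeUntil hp hv (Ne.symm hne) (h₂ _ (hp.takeUntil hv))

theorem subtreeSet_trans (hT : T.IsTree) {c u v w : V} (h₁ : v ∈ subtreeSet T c u)
    (h₂ : w ∈ subtreeSet T c v) : w ∈ subtreeSet T c u := by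
  classical
  obtain ⟨p, hp⟩ := exists_isPath hT c w
  have hv := h₂ p hp
  rw [mem_subtreeSet_iff hT p hp]
  exact p.support_takeUntil_subset_support hv (h₁ _ (hp.takeUntil hv))

theorem mem_childSet_iff (hT : T.IsTree) {c x w : V} : w ∈ childSet T c x ↔ IsChild T c x w := by
  constructor
  · rintro ⟨h, hw⟩
    rcases isChild_or_isChild hT c h with h' | h'
    · exact h'
    · exact absurd hw h'.2.2
  · intro h
    exact ⟨h.1, (h.2.1 x).2 (Or.inl (self_mem_subtreeSet T c x))⟩

theorem IsChild.unique (hT : T.IsTree) {c u u' v : V} (h : IsChild T c u v)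
    (h' : IsChild T c u' v) : u = u' := by
  have h₁ : u' ∈ subtreeSet T c u := by
    rcases (h'.2.1 u).1 ((h.2.1 u).2 (Or.inl (self_mem_subtreeSet T c u))) with h₁ | h₁
    · exact h₁
    · exact absurd h₁ h.1.ne
  have h₂ : u ∈ subtreeSet T c u' := by
    rcases (h.2.1 u').1 ((h'.2.1 u').2 (Or.inl (self_mem_subtreeSet T c u'))) with h₁ | h₁
    · exact h₁
    · exact absurd h₁ h'.1.ne
  exact subtreeSet_antisymm hT h₁ h₂

theorem exists_child_of_mem_subtreeSet (hT : T.IsTree) {c x v : V} (hv : v ∈ subtreeSet T c x)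
    (hne : v ≠ x) : ∃ w ∈ childSet T c x, v ∈ subtreeSet T c w := by
  induction v using tree_induction hT c with
  | h0 => exact absurd (by simpa using hv Walk.nil Walk.IsPath.nil) hne.symm
  | hs u v h ih =>
    rcases (h.2.1 x).1 hv with hu | hu
    · by_cases hux : u = x
      · subst hux
        exact ⟨v, (mem_childSet_iff hT).2 h, self_mem_subtreeSet T c v⟩
      · obtain ⟨w, hw, huw⟩ := ih hu hux
        exact ⟨w, hw, (h.2.1 w).2 (Or.inl huw)⟩
    · exact absurd hu.symm hne

theorem subtreeSet_child_subset (hT : T.IsTree) {c x w : V} (hw : w ∈ childSet T c x) :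
    subtreeSet T c w ⊆ subtreeSet T c x :=
  fun _ hv => subtreeSet_trans hT hw.2 hv

theorem notMem_subtreeSet_child (hT : T.IsTree) {c x w : V} (hw : w ∈ childSet T c x) :
    x ∉ subtreeSet T c w := ((mem_childSet_iff hT).1 hw).2.2

theorem subtreeSet_child_disjoint (hT : T.IsTree) {c x w w' v : V} (hw : w ∈ childSet T c x)
    (hw' : w' ∈ childSet T c x) (hv : v ∈ subtreeSet T c w) (hv' : v ∈ subtreeSet T c w') :
    w = w' := by
  have key : ∀ {a b u : V}, a ∈ childSet T c x → b ∈ childSet T c x → IsChild T c u a →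
      u ∈ subtreeSet T c b → False := by
    intro a b u ha hb h hu
    rw [h.unique hT ((mem_childSet_iff hT).1 ha)] at hu
    exact notMem_subtreeSet_child hT hb hu
  induction v using tree_induction hT c with
  | h0 =>
    have h1 : w = c := by simpa using hv Walk.nil Walk.IsPath.nil
    have h2 : w' = c := by simpa using hv' Walk.nil Walk.IsPath.nil
    rw [h1, h2]
  | hs u v h ih =>
    rcases (h.2.1 w).1 hv with h1 | rfl
    · rcases (h.2.1 w').1 hv' with h2 | rfl
      · exact ih h1 h2
      · exact (key hw' hw h h1).elim
    · rcases (h.2.1 w').1 hv' with h2 | rfl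
      · exact (key hw hw' h h2).elim
      · rfl

/-- A step to a child stays below `w`. A step to the parent can leave only from `w` itself, since
any other vertex below `w` has a parent below `w`. -/
theorem mem_subtreeSet_child_of_adj (hT : T.IsTree) {c x w v u : V} (hw : w ∈ childSet T c x)
    (hv : v ∈ subtreeSet T c w) (h : T.Adj v u) :
    u ∈ subtreeSet T c w ∨ (v = w ∧ u = x) := by
  rcases isChild_or_isChild hT c h with h' | h'
  · exact Or.inl ((h'.2.1 w).2 (Or.inl hv))
  · rcases (h'.2.1 w).1 hv with h1 | rfl
    · exact Or.inl h1
    · exact Or.inr ⟨rfl, h'.unique hT ((mem_childSet_iff hT).1 hw)⟩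

theorem exists_adj_mem_subtreeSet (hT : T.IsTree) {c x v : V} (hv : v ∈ subtreeSet T c x)
    (hne : v ≠ x) : ∃ u ∈ subtreeSet T c x, T.Adj v u := by
  revert hv hne
  refine tree_induction hT c (P := fun v => v ∈ subtreeSet T c x → v ≠ x →
    ∃ u ∈ subtreeSet T c x, T.Adj v u) ?_ ?_ v
  · intro hv hne
    exact absurd (by simpa using hv Walk.nil Walk.IsPath.nil) hne.symm
  · intro u v h _ hv hne
    rcases (h.2.1 x).1 hv with h1 | rfl
    · exact ⟨u, h1, h.1.symm⟩
    · exact absurd rfl hne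

/-! ### Changing the root -/

theorem mem_subtreeSet_comm (hT : T.IsTree) {c v w : V} :
    w ∈ subtreeSet T c v ↔ c ∈ subtreeSet T w v := by
  obtain ⟨p, hp⟩ := exists_isPath hT c w
  rw [mem_subtreeSet_iff hT p hp, mem_subtreeSet_iff hT p.reverse hp.reverse]
  simp

theorem childSet_of_adj (hT : T.IsTree) {x y : V} (h : y = x ∨ T.Adj y x) :
    childSet T y x = {w | T.Adj x w ∧ w ≠ y} := by
  ext w
  constructor
  · rintro ⟨h1, h2⟩
    refine ⟨h1, ?_⟩
    rintro rfl
    have := h2 Walk.nil Walk.IsPath.nil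
    simp at this
    exact h1.ne this
  · rintro ⟨h1, h2⟩
    refine ⟨h1, ?_⟩
    rcases h with rfl | h
    · rw [subtreeSet_self]; trivial
    · rw [mem_subtreeSet_iff hT (Walk.cons h (Walk.cons h1 Walk.nil))]
      · simp
      · simp [Walk.cons_isPath_iff, h1.ne, h.ne, Ne.symm h2]

theorem subtreeSet_of_adj (hT : T.IsTree) {x y u : V} (h : y = x ∨ T.Adj y x) (hu : T.Adj x u)
    (huy : u ≠ y) : subtreeSet T y u = subtreeSet T x u := by
  rcases h with rfl | h
  · rfl
  ext w
  rw [mem_subtreeSet_comm hT, mem_subtreeSet_comm hT (c := x)]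
  -- Seen from `w`, one of the adjacent vertices `x`, `y` is the parent of the other, so their sets
  -- of ancestors differ by one of these two vertices, and `u` is neither.
  rcases isChild_or_isChild hT w h with h' | h'
  · rw [h'.2.1 u]
    simp [hu.ne']
  · rw [h'.2.1 u]
    simp [huy]

end RootedTree
end TotTrans

namespace TotTrans
open SimpleGraph

/-! ### Partitions as colourings -/

section Colouring

variable {V : Type u} {G T : SimpleGraph V}

/-- Within `S`, the vertex `v` has a neighbour coloured `i`. -/
def Sees (G : SimpleGraph V) (S : Set V) (f : V → ℕ) (v : V) (i : ℕ) : Prop :=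
  ∃ w ∈ S, G.Adj v w ∧ f w = i

/-- Within `S`, the vertex `v` has a positive colour and sees every colour up to its own. -/
def Satisfied (G : SimpleGraph V) (S : Set V) (f : V → ℕ) (v : V) : Prop :=
  1 ≤ f v ∧ ∀ i, 1 ≤ i → i ≤ f v → Sees G S f v i

/-- Some colouring satisfies all vertices of `S` and gives `x` the colour `p`. -/
def Full (G : SimpleGraph V) (S : Set V) (x : V) (p : ℕ) : Prop :=
  ∃ f : V → ℕ, f x = p ∧ ∀ v ∈ S, Satisfied G S f v

/-- Some colouring gives `x` the colour `p` and satisfies all vertices of `S`, except that `x`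
need not see its own colour. -/
def Half (G : SimpleGraph V) (S : Set V) (x : V) (p : ℕ) : Prop :=
  ∃ f : V → ℕ, f x = p ∧ 1 ≤ p ∧ (∀ v ∈ S, v ≠ x → Satisfied G S f v) ∧
    ∀ i, 1 ≤ i → i < p → Sees G S f x i

theorem Full.half {S : Set V} {x : V} {p : ℕ} (hx : x ∈ S) (h : Full G S x p) :
    Half G S x p := by
  obtain ⟨f, hf, h⟩ := h
  refine ⟨f, hf, hf ▸ (h x hx).1, fun v hv _ => h v hv, fun i h1 h2 => (h x hx).2 i h1 ?_⟩
  omega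

theorem Sees.min {S : Set V} {f : V → ℕ} {v : V} {i : ℕ} (q : ℕ) (h : Sees G S f v i) :
    Sees G S (fun v => min (f v) q) v (min i q) := by
  obtain ⟨w, h1, h2, h3⟩ := h
  exact ⟨w, h1, h2, by simp [h3]⟩

/-- The colours that still have to be seen are at most `q`, and these survive the cut. -/
theorem Satisfied.min {S : Set V} {f : V → ℕ} {v : V} {q : ℕ} (hq : 1 ≤ q)
    (h : Satisfied G S f v) : Satisfied G S (fun v => min (f v) q) v := by
  refine ⟨le_min h.1 hq, fun i h1 h2 => ?_⟩
  have h3 : i ≤ f v := h2.trans (min_le_left _ _)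
  have := (h.2 i h1 h3).min q
  rwa [min_eq_left (h2.trans (min_le_right _ _))] at this

theorem Full.anti {S : Set V} {x : V} {p q : ℕ} (h : Full G S x p) (hq : 1 ≤ q) (hqp : q ≤ p) :
    Full G S x q := by
  obtain ⟨f, hf, h⟩ := h
  exact ⟨fun v => min (f v) q, by simp [hf, hqp], fun v hv => (h v hv).min hq⟩

theorem Half.anti {S : Set V} {x : V} {p q : ℕ} (h : Half G S x p) (hq : 1 ≤ q) (hqp : q ≤ p) :
    Half G S x q := by
  obtain ⟨f, hf, -, h, h'⟩ := h
  refine ⟨fun v => min (f v) q, by simp [hf, hqp], hq, fun v hv hvx => (h v hv hvx).min hq,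
    fun i h1 h2 => ?_⟩
  have := (h' i h1 (h2.trans_le hqp)).min q
  rwa [min_eq_left h2.le] at this

/-- Colours 1, …, p - 1 occur at neighbours of `x` and `p` at `x`. The bound makes the suprema in
the definitions of the labels genuine maxima. -/
theorem Half.le_card [Finite V] {S : Set V} {x : V} {p : ℕ} (h : Half G S x p) :
    p ≤ Nat.card V := by
  obtain ⟨f, hf, h1, -, h⟩ := h
  have : ∀ i : Fin p, ∃ w, f w = i + 1 := by
    intro i
    rcases Nat.lt_or_ge (i + 1) p with hi | hi
    · obtain ⟨w, -, -, hw⟩ := h (i + 1) (by omega) hi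
      exact ⟨w, hw⟩
    · exact ⟨x, by omega⟩
  choose g hg using this
  have hinj : Function.Injective g := by
    intro i j hij
    have := congrArg f hij
    rw [hg, hg] at this
    exact Fin.ext (by omega)
  simpa using Nat.card_le_card_of_injective g hinj

/-! ### Partitions versus colourings -/

theorem isTotalTransitivePartition_iff {k : ℕ} {P : Fin k → Set V} {f : V → ℕ}
    (hf : ∀ v i, v ∈ P i ↔ f v = (i : ℕ) + 1) (h1 : ∀ v, 1 ≤ f v) (hk : ∀ v, f v ≤ k) :
    IsTotalTransitivePartition G P ↔
      (∀ v, Satisfied G Set.univ f v) ∧ ∀ i, 1 ≤ i → i ≤ k → ∃ v, f v = i := by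
  constructor
  · rintro ⟨hP, hd⟩
    refine ⟨fun v => ⟨h1 v, fun i hi hiv => ?_⟩, fun i hi hik => ?_⟩
    · have := h1 v
      have := hk v
      obtain ⟨w, hw, hvw⟩ := hd ⟨i - 1, by omega⟩ ⟨f v - 1, by omega⟩
        (by rw [Fin.le_def]; simp; omega) v (by rw [hf]; simp; omega)
      rw [hf] at hw
      exact ⟨w, trivial, hvw, by simp at hw; omega⟩
    · obtain ⟨w, hw⟩ := hP.nonempty ⟨i - 1, by omega⟩
      rw [hf] at hw
      exact ⟨w, by simp at hw; omega⟩
  · rintro ⟨h, hs⟩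
    refine ⟨⟨fun i => ?_, fun i j hij => ?_, ?_⟩, fun i j hij v hv => ?_⟩
    · obtain ⟨v, hv⟩ := hs (i + 1) (by omega) (by omega)
      exact ⟨v, (hf v i).2 hv⟩
    · rw [Set.disjoint_left]
      intro v hv hv'
      rw [hf] at hv hv'
      exact hij (Fin.ext (by omega))
    · refine Set.eq_univ_of_forall fun v => Set.mem_iUnion.2 ⟨⟨f v - 1, ?_⟩, ?_⟩
      · have := h1 v; have := hk v; omega
      · rw [hf]; have := h1 v; simp; omega
    · rw [hf] at hv
      obtain ⟨w, -, hvw, hw⟩ := (h v).2 (i + 1) (by omega) (by rw [Fin.le_def] at hij; omega)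
      exact ⟨w, (hf w i).2 hw, hvw⟩

theorem IsOrderedPartition.exists_colouring {k : ℕ} {P : Fin k → Set V}
    (hP : IsOrderedPartition P) :
    ∃ f : V → ℕ, (∀ v i, v ∈ P i ↔ f v = (i : ℕ) + 1) ∧ (∀ v, 1 ≤ f v) ∧ ∀ v, f v ≤ k := by
  have : ∀ v, ∃ i, v ∈ P i := fun v => by
    have : v ∈ ⋃ i, P i := hP.cover ▸ Set.mem_univ v
    simpa using this
  choose g hg using this
  refine ⟨fun v => g v + 1, fun v i => ⟨fun h => ?_, fun h => ?_⟩, fun v => ?_,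
    fun v => ?_⟩
  · by_contra hne
    have : i ≠ g v := by rintro rfl; exact hne rfl
    exact Set.disjoint_left.1 (hP.disjoint i (g v) this) h (hg v)
  · have : i = g v := Fin.ext (by simpa using h.symm)
    exact this ▸ hg v
  · exact Nat.succ_le_succ (Nat.zero_le _)
  · exact (g v).2

/-- No class is empty because `x`, whose colour is largest, sees every colour up to its own. -/
theorem exists_isTotalTransitivePartition {f : V → ℕ}
    (h : ∀ v, Satisfied G Set.univ f v) {x : V} (hx : ∀ v, f v ≤ f x) :
    IsTotalTransitivePartition G (fun i : Fin (f x) => {v | f v = (i : ℕ) + 1}) := by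
  refine (isTotalTransitivePartition_iff (f := f) (fun v i => Iff.rfl) (fun v => (h v).1) hx).2
    ⟨h, fun i h1 h2 => ?_⟩
  obtain ⟨w, -, -, hw⟩ := (h x).2 i h1 h2
  exact ⟨w, hw⟩

theorem setOf_ttr_eq [Finite V] (x : V) :
    {p : ℕ | ∃ (k : ℕ) (P : Fin k → Set V) (i : Fin k),
      IsTotalTransitivePartition G P ∧ x ∈ P i ∧ p = (i : ℕ) + 1} =
    {p | Full G Set.univ x p} := by
  ext p
  constructor
  · rintro ⟨k, P, i, hP, hx, rfl⟩
    obtain ⟨f, hf, h1, hk⟩ := hP.1.exists_colouring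
    exact ⟨f, (hf x i).1 hx, fun v _ => ((isTotalTransitivePartition_iff hf h1 hk).1 hP).1 v⟩
  · rintro ⟨f, rfl, h⟩
    have : Nonempty V := ⟨x⟩
    obtain ⟨y, hy⟩ := Finite.exists_max f
    have h1 := (h x trivial).1
    refine ⟨f y, _, ⟨f x - 1, ?_⟩, exists_isTotalTransitivePartition (fun v => h v trivial) hy,
      ?_, ?_⟩
    · have := hy x; omega
    · simp; omega
    · simp; omega

/-- Only the last part may fail to dominate itself, so cutting the other vertices below the colour
of `x` satisfies them all. The hypothesis on isolated vertices serves `p = 1`: a single part imposes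
no condition at all, whereas `Half` wants the other vertices to see colour 1. -/
theorem setOf_mttr_eq [Finite V] {x : V} (hiso : ∀ v, v ≠ x → ∃ w, G.Adj v w) :
    {p : ℕ | ∃ (k : ℕ) (P : Fin k → Set V) (i : Fin k),
      IsModifiedTotalTransitivePartition G P ∧ x ∈ P i ∧ p = (i : ℕ) + 1} =
    {p | Half G Set.univ x p} := by
  ext p
  constructor
  · rintro ⟨k, P, i, hP, hx, rfl⟩
    obtain ⟨f, hf, h1, hk⟩ := hP.1.exists_colouring
    have hfx := (hf x i).1 hx
    have key : ∀ v a, 1 ≤ a → a ≤ f v → a < k → Sees G Set.univ f v a := by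
      intro v a ha hav hak
      have := h1 v
      have := hk v
      have : ∃ w ∈ P ⟨a - 1, by omega⟩, G.Adj v w := by
        rcases Nat.lt_or_ge a (f v) with hlt | hge
        · exact hP.2 ⟨a - 1, by omega⟩ ⟨f v - 1, by omega⟩ (by rw [Fin.lt_def]; simp; omega) v
            (Or.inr (by rw [hf]; simp; omega))
        -- The own colour of a vertex is seen by comparing its part with the next one, which exists
        -- because `a < k`.
        · exact hP.2 ⟨a - 1, by omega⟩ ⟨a, by omega⟩ (by rw [Fin.lt_def]; simp; omega) v
            (Or.inl (by rw [hf]; simp; omega))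
      obtain ⟨w, hw, hvw⟩ := this
      rw [hf] at hw
      exact ⟨w, trivial, hvw, by simp at hw; omega⟩
    by_cases hp : (i : ℕ) = 0
    · refine ⟨fun _ => 1, by simp [hp], by omega, fun v _ hvx => ⟨le_rfl, fun j hj hj' => ?_⟩,
        fun j hj hj' => by omega⟩
      obtain ⟨w, hw⟩ := hiso v hvx
      exact ⟨w, trivial, hw, le_antisymm hj hj'⟩
    · classical
      have hik := i.2
      -- Cut down to colour `i`, which is below the last colour `k`, every other vertex sees all it
      -- needs; `x` alone keeps `i + 1`, so no neighbour used as a witness is `x`.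
      refine ⟨fun v => if v = x then i + 1 else min (f v) i, by simp, by omega,
        fun v _ hvx => ?_, fun j hj hj' => ?_⟩
      · have h1v := h1 v
        simp only [Satisfied, if_neg hvx]
        refine ⟨le_min h1v (by omega), fun j hj hj' => ?_⟩
        rw [le_min_iff] at hj'
        obtain ⟨w, -, hvw, hw⟩ := key v j hj hj'.1 (by omega)
        refine ⟨w, trivial, hvw, ?_⟩
        have : w ≠ x := by rintro rfl; omega
        simp only [if_neg this]
        omega
      · obtain ⟨w, -, hvw, hw⟩ := key x j hj (by omega) (by omega)
        refine ⟨w, trivial, hvw, ?_⟩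
        simp only [if_neg hvw.ne']
        omega
  · rintro ⟨f, hfx, h1, h, h'⟩
    have hs : ∀ v, v ≠ x → 1 ≤ min (f v) p ∧ ∀ i, 1 ≤ i → i ≤ min (f v) p →
        ∃ w, G.Adj v w ∧ min (f w) p = i := fun v hvx => by
      obtain ⟨h2, h3⟩ := (h v trivial hvx).min h1
      refine ⟨h2, fun i hi hi' => ?_⟩
      obtain ⟨w, -, hw⟩ := h3 i hi hi'
      exact ⟨w, hw⟩
    have hx' : ∀ i, 1 ≤ i → i < p → ∃ w, G.Adj x w ∧ min (f w) p = i := fun i hi hi' => by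
      obtain ⟨w, -, hw, hw'⟩ := h' i hi hi'
      exact ⟨w, hw, by omega⟩
    have hpos : ∀ v, 1 ≤ min (f v) p := fun v => by
      by_cases hv : v = x
      · subst hv; omega
      · exact (hs v hv).1
    have key : ∀ v (i : ℕ), i + 1 ≤ min (f v) p → i + 1 < p →
        ∃ w, min (f w) p = i + 1 ∧ G.Adj v w := fun v i hi hip => by
      by_cases hv : v = x
      · obtain ⟨w, hw⟩ := hx' (i + 1) (by omega) hip
        exact ⟨w, hw.2, hv ▸ hw.1⟩
      · obtain ⟨w, hw⟩ := (hs v hv).2 (i + 1) (by omega) hi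
        exact ⟨w, hw.2, hw.1⟩
    refine ⟨p, fun i => {v | min (f v) p = (i : ℕ) + 1}, ⟨p - 1, by omega⟩,
      ⟨⟨fun i => ?_, fun i j hij => ?_, ?_⟩, fun i j hij v hv => ?_⟩, ?_, ?_⟩
    · rcases Nat.lt_or_ge (i + 1) p with hi | hi
      · obtain ⟨w, -, hw⟩ := hx' (i + 1) (by omega) hi
        exact ⟨w, hw⟩
      · exact ⟨x, by simp [hfx]; omega⟩
    · rw [Set.disjoint_left]
      intro v hv hv'
      simp only [Set.mem_ofPred_eq] at hv hv'
      exact hij (Fin.ext (by omega))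
    · refine Set.eq_univ_of_forall fun v => Set.mem_iUnion.2 ⟨⟨min (f v) p - 1, ?_⟩, ?_⟩
      · have := hpos v; omega
      · have := hpos v; simp only [Set.mem_ofPred_eq]; omega
    · rw [Fin.lt_def] at hij
      refine key v i ?_ (by omega)
      rcases hv with hv | hv <;> simp only [Set.mem_ofPred_eq] at hv <;> omega
    · simp [hfx]; omega
    · simp; omega

theorem sSup_eq_iff_of_anti {s : Set ℕ} {n p : ℕ} (hb : ∀ q ∈ s, q ≤ n)
    (ha : ∀ q r, q ∈ s → 1 ≤ r → r ≤ q → r ∈ s) (hp : 1 ≤ p) : p ≤ sSup s ↔ p ∈ s := by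
  have hbdd : BddAbove s := ⟨n, hb⟩
  constructor
  · intro h
    rcases s.eq_empty_or_nonempty with rfl | hs
    · simp at h; omega
    · exact ha _ _ (Nat.sSup_mem hs hbdd) hp h
  · exact fun h => le_csSup hbdd h

theorem le_ttr_iff [Finite V] {x : V} {p : ℕ} (hp : 1 ≤ p) :
    p ≤ ttr G x ↔ Full G Set.univ x p := by
  rw [ttr, setOf_ttr_eq]
  exact sSup_eq_iff_of_anti (fun q hq => (Full.half (Set.mem_univ x) hq).le_card)
    (fun q r hq h1 h2 => Full.anti hq h1 h2) hp

theorem le_mttr_iff [Finite V] {x : V} {p : ℕ} (hiso : ∀ v, v ≠ x → ∃ w, G.Adj v w)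
    (hp : 1 ≤ p) : p ≤ mttr G x ↔ Half G Set.univ x p := by
  rw [mttr, setOf_mttr_eq hiso]
  exact sSup_eq_iff_of_anti (fun q hq => Half.le_card hq)
    (fun q r hq h1 h2 => Half.anti hq h1 h2) hp

/-! ### Colourings of induced subgraphs -/

theorem sees_induce {S : Set V} {f : V → ℕ} {v : S} {i : ℕ} :
    Sees (G.induce S) Set.univ (fun v => f v) v i ↔ Sees G S f v i := by
  simp [Sees, and_left_comm]

theorem satisfied_induce {S : Set V} {f : V → ℕ} {v : S} :
    Satisfied (G.induce S) Set.univ (fun v => f v) v ↔ Satisfied G S f v := by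
  simp [Satisfied, sees_induce]

theorem exists_extend {S : Set V} (f : S → ℕ) : ∃ g : V → ℕ, f = fun v : S => g v := by
  classical
  exact ⟨fun v => if h : v ∈ S then f ⟨v, h⟩ else 0, by ext v; simp⟩

theorem full_induce {S : Set V} {x : S} {p : ℕ} :
    Full (G.induce S) Set.univ x p ↔ Full G S x p := by
  constructor
  · rintro ⟨f, hf, h⟩
    obtain ⟨g, rfl⟩ := exists_extend f
    exact ⟨g, hf, fun v hv => satisfied_induce.1 (h ⟨v, hv⟩ trivial)⟩
  · rintro ⟨f, hf, h⟩
    exact ⟨fun v => f v, hf, fun v _ => satisfied_induce.2 (h v v.2)⟩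

theorem half_induce {S : Set V} {x : S} {p : ℕ} :
    Half (G.induce S) Set.univ x p ↔ Half G S x p := by
  constructor
  · rintro ⟨f, hf, h1, h, h'⟩
    obtain ⟨g, rfl⟩ := exists_extend f
    exact ⟨g, hf, h1, fun v hv hvx => satisfied_induce.1 (h ⟨v, hv⟩ trivial
      (fun e => hvx (congrArg Subtype.val e))), fun i hi hi' => sees_induce.1 (h' i hi hi')⟩
  · rintro ⟨f, hf, h1, h, h'⟩
    exact ⟨fun v => f v, hf, h1, fun v _ hvx => satisfied_induce.2 (h v v.2
      (fun e => hvx (Subtype.ext e))), fun i hi hi' => sees_induce.2 (h' i hi hi')⟩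

theorem le_rttr_iff [Finite V] {c x : V} {p : ℕ} (hp : 1 ≤ p) :
    p ≤ rttr T c x ↔ Full T (subtreeSet T c x) x p := by
  rw [rttr, le_ttr_iff hp, full_induce]

theorem le_rmttr_iff [Finite V] (hT : T.IsTree) {c x : V} {p : ℕ} (hp : 1 ≤ p) :
    p ≤ rmttr T c x ↔ Half T (subtreeSet T c x) x p := by
  rw [rmttr, le_mttr_iff _ hp, half_induce]
  rintro ⟨v, hv⟩ hvx
  obtain ⟨u, hu, hvu⟩ := exists_adj_mem_subtreeSet hT hv (fun e => hvx (Subtype.ext e))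
  exact ⟨⟨u, hu⟩, hvu⟩

end Colouring
end TotTrans

namespace TotTrans
open SimpleGraph

/-! ### The recursion for rooted labels -/

section Recursion

variable {V : Type u} {T : SimpleGraph V}

/-- Some `p` distinct elements of `W`, suitably numbered, have labels at least `1, …, p`. -/
def Sys (W : Set V) (l : V → ℕ) (p : ℕ) : Prop :=
  ∃ g : Fin p → V, Function.Injective g ∧ ∀ i, g i ∈ W ∧ (i : ℕ) + 1 ≤ l (g i)

theorem Sys.anti {W : Set V} {l : V → ℕ} {p q : ℕ} (h : Sys W l p) (hq : q ≤ p) : Sys W l q := by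
  obtain ⟨g, hg, h⟩ := h
  exact ⟨g ∘ Fin.castLE hq, hg.comp (Fin.castLE_injective hq), fun i => h (Fin.castLE hq i)⟩

theorem Sys.mono {W : Set V} {l l' : V → ℕ} {p : ℕ} (h : Sys W l p) (hl : ∀ w ∈ W, l w ≤ l' w) :
    Sys W l' p := by
  obtain ⟨g, hg, h⟩ := h
  exact ⟨g, hg, fun i => ⟨(h i).1, (h i).2.trans (hl _ (h i).1)⟩⟩

/-- The label `t` of a vertex, raised to `F` if the vertex can be coloured `F` with the help of
its parent. -/
def bump (t m : V → ℕ) (F : ℕ) (w : V) : ℕ :=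
  if t w + 1 = F ∧ m w = F then F else t w

theorem le_bump (t m : V → ℕ) (F : ℕ) (w : V) : t w ≤ bump t m F w := by
  unfold bump; split_ifs <;> omega

/-- One vertex may attain the value `p` through the second label. -/
def HelpedSys (W : Set V) (t m : V → ℕ) (p : ℕ) : Prop :=
  ∃ g : Fin p → V, Function.Injective g ∧
    ∀ i, g i ∈ W ∧ ((i : ℕ) + 1 ≤ t (g i) ∨ ((i : ℕ) + 1 = p ∧ p ≤ m (g i)))

/-- As `m ≤ t + 1`, help matters only when `t + 1 = p = m`, exactly the case in which `bump` acts.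
For positions below `p`, raising a label from `p - 1` to `p` changes nothing. -/
theorem helpedSys_iff {W : Set V} {t m : V → ℕ} (h : ∀ w ∈ W, m w ≤ t w + 1) {p : ℕ} :
    HelpedSys W t m p ↔ Sys W (bump t m p) p := by
  refine exists_congr fun g => and_congr_right fun _ => forall_congr' fun i =>
    and_congr_right fun hi => ?_
  have := h _ hi
  have := i.2
  unfold bump
  split_ifs <;> omega

/-- The child subtrees are coloured independently. A child of colour `p` may carry a `Half`
colouring: the only colour it can lack is `p`, and `x` supplies it. -/
theorem exists_glue [Finite V] (hT : T.IsTree) {c x : V} {p : ℕ} (col : V → ℕ)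
    (hcol : ∀ w ∈ childSet T c x, 1 ≤ col w ∧
      (col w ≤ rttr T c w ∨ (col w = p ∧ p ≤ rmttr T c w))) :
    ∃ f : V → ℕ, f x = p ∧ (∀ w ∈ childSet T c x, f w = col w) ∧
      ∀ v ∈ subtreeSet T c x, v ≠ x → Satisfied T (subtreeSet T c x) f v := by
  classical
  have hF : ∀ w, ∃ F : V → ℕ, w ∈ childSet T c x → F w = col w ∧
      (∀ v ∈ subtreeSet T c w, v ≠ w → Satisfied T (subtreeSet T c w) F v) ∧
      ∀ i, 1 ≤ i → i ≤ col w → Sees T (subtreeSet T c w) F w i ∨ i = p := by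
    intro w
    by_cases hw : w ∈ childSet T c x
    · obtain ⟨h1, h2 | ⟨h2, h3⟩⟩ := hcol w hw
      · obtain ⟨F, hF, h⟩ := (le_rttr_iff h1).1 h2
        exact ⟨F, fun _ => ⟨hF, fun v hv _ => h v hv, fun i hi hi' =>
          Or.inl ((h w (self_mem_subtreeSet T c w)).2 i hi (by omega))⟩⟩
      · rw [← h2] at h3
        obtain ⟨F, hF, -, h, h'⟩ := (le_rmttr_iff hT h1).1 h3
        refine ⟨F, fun _ => ⟨hF, h, fun i hi hi' => ?_⟩⟩
        rcases Nat.lt_or_ge i (col w) with hlt | hge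
        · exact Or.inl (h' i hi hlt)
        · exact Or.inr (by omega)
    · exact ⟨fun _ => 0, fun h => absurd h hw⟩
  choose F hF using hF
  have hown : ∀ v, ∃ w, v ∈ subtreeSet T c x → v ≠ x → w ∈ childSet T c x ∧
      v ∈ subtreeSet T c w := by
    intro v
    by_cases hv : v ∈ subtreeSet T c x ∧ v ≠ x
    · obtain ⟨w, hw⟩ := exists_child_of_mem_subtreeSet hT hv.1 hv.2
      exact ⟨w, fun _ _ => hw⟩
    · exact ⟨x, fun h1 h2 => absurd ⟨h1, h2⟩ hv⟩
  choose own hown using hown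
  -- `own v` is the child whose subtree contains `v`; the child subtrees are disjoint, so `f` agrees
  -- with `F w` on the whole subtree of `w`.
  set f : V → ℕ := fun v => if v = x then p else F (own v) v with hf
  have hfx : f x = p := by simp [hf]
  have hfw : ∀ w ∈ childSet T c x, ∀ v ∈ subtreeSet T c w, f v = F w v := by
    intro w hw v hv
    have hvx : v ≠ x := by rintro rfl; exact notMem_subtreeSet_child hT hw hv
    obtain ⟨h1, h2⟩ := hown v (subtreeSet_child_subset hT hw hv) hvx
    simp only [hf, if_neg hvx]
    rw [subtreeSet_child_disjoint hT h1 hw h2 hv]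
  have hsee : ∀ w ∈ childSet T c x, ∀ v ∈ subtreeSet T c w, ∀ i,
      Sees T (subtreeSet T c w) (F w) v i → Sees T (subtreeSet T c x) f v i := by
    rintro w hw v hv i ⟨u, hu, hvu, hui⟩
    exact ⟨u, subtreeSet_child_subset hT hw hu, hvu, by rw [hfw w hw u hu, hui]⟩
  refine ⟨f, hfx, fun w hw => ?_, fun v hv hvx => ?_⟩
  · rw [hfw w hw w (self_mem_subtreeSet T c w), (hF w hw).1]
  · obtain ⟨hw, hvw⟩ := hown v hv hvx
    obtain ⟨h1, h2, h3⟩ := hF _ hw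
    by_cases hvo : v = own v
    · rw [← hvo] at hw h1 h2 h3 hvw
      have hfv : f v = col v := by rw [hfw v hw v hvw, h1]
      refine ⟨hfv ▸ (hcol v hw).1, fun i hi hi' => ?_⟩
      rcases h3 i hi (hfv ▸ hi') with h | h
      · exact hsee v hw v hvw i h
      · exact ⟨x, self_mem_subtreeSet T c x, hw.1.symm, by rw [hfx, h]⟩
    · have hs := h2 v hvw hvo
      have hfv := hfw _ hw v hvw
      exact ⟨hfv ▸ hs.1, fun i hi hi' => hsee _ hw v hvw i (hs.2 i hi (hfv ▸ hi'))⟩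

/-- The only neighbour lost on passing to the subtree of `w` is `x`, and only `w` loses it, so only
the colour `f x` at `w` is in danger. -/
theorem Sees.restrict (hT : T.IsTree) {c x w v : V} {f : V → ℕ} (hw : w ∈ childSet T c x)
    (hv : v ∈ subtreeSet T c w) {i : ℕ} (h : Sees T (subtreeSet T c x) f v i)
    (hne : v = w → i ≠ f x) : Sees T (subtreeSet T c w) f v i := by
  obtain ⟨u, hu, hvu, hui⟩ := h
  rcases mem_subtreeSet_child_of_adj hT hw hv hvu with h | ⟨h1, rfl⟩
  · exact ⟨u, h, hvu, hui⟩
  · exact absurd hui.symm (hne h1)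

/-- The child needs colours up to `f w < f x` only and never relies on `x`. -/
theorem le_rttr_of_child [Finite V] (hT : T.IsTree) {c x w : V} {f : V → ℕ}
    (hw : w ∈ childSet T c x)
    (hf : ∀ v ∈ subtreeSet T c x, v ≠ x → Satisfied T (subtreeSet T c x) f v) (hlt : f w < f x) :
    f w ≤ rttr T c w := by
  have hS := subtreeSet_child_subset hT hw
  have hx := notMem_subtreeSet_child hT hw
  have hs : ∀ v ∈ subtreeSet T c w, Satisfied T (subtreeSet T c x) f v := fun v hv =>
    hf v (hS hv) (fun e => hx (e ▸ hv))
  rw [le_rttr_iff (hs w (self_mem_subtreeSet T c w)).1]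
  refine ⟨f, rfl, fun v hv => ⟨(hs v hv).1, fun i hi hi' => ?_⟩⟩
  refine Sees.restrict hT hw hv ((hs v hv).2 i hi hi') ?_
  rintro rfl
  omega

theorem le_rmttr_of_child [Finite V] (hT : T.IsTree) {c x w : V} {f : V → ℕ}
    (hw : w ∈ childSet T c x)
    (hf : ∀ v ∈ subtreeSet T c x, v ≠ x → Satisfied T (subtreeSet T c x) f v) (hlt : f w = f x) :
    f w ≤ rmttr T c w := by
  have hS := subtreeSet_child_subset hT hw
  have hx := notMem_subtreeSet_child hT hw
  have hs : ∀ v ∈ subtreeSet T c w, Satisfied T (subtreeSet T c x) f v := fun v hv =>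
    hf v (hS hv) (fun e => hx (e ▸ hv))
  have hw' := self_mem_subtreeSet T c w
  rw [le_rmttr_iff hT (hs w hw').1]
  refine ⟨f, rfl, (hs w hw').1, fun v hv hvw => ⟨(hs v hv).1, fun i hi hi' => ?_⟩,
    fun i hi hi' => ?_⟩
  · exact Sees.restrict hT hw hv ((hs v hv).2 i hi hi') (fun e => absurd e hvw)
  · exact Sees.restrict hT hw hw' ((hs w hw').2 i hi hi'.le) (fun _ => by omega)

theorem injective_of_colours {p : ℕ} {g : Fin p → V} {f : V → ℕ}
    (h : ∀ i, f (g i) = (i : ℕ) + 1) : Function.Injective g := by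
  intro i j hij
  have := congrArg f hij
  rw [h, h] at this
  exact Fin.ext (by omega)

theorem exists_children_of_sees {c x : V} {f : V → ℕ} {p : ℕ}
    (h : ∀ i, 1 ≤ i → i ≤ p → Sees T (subtreeSet T c x) f x i) :
    ∃ g : Fin p → V, Function.Injective g ∧ ∀ i, g i ∈ childSet T c x ∧ f (g i) = (i : ℕ) + 1 := by
  have : ∀ i : Fin p, ∃ w, w ∈ childSet T c x ∧ f w = (i : ℕ) + 1 := by
    intro i
    obtain ⟨w, hw, hxw, hwi⟩ := h (i + 1) (by omega) (by omega)
    exact ⟨w, ⟨hxw, hw⟩, hwi⟩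
  choose g hg using this
  exact ⟨g, injective_of_colours fun i => (hg i).2, hg⟩

/-- The default colour 1 is meant for the children that are not selected; it is feasible for every
child that is not a leaf. -/
theorem exists_colours_of_injective {p : ℕ} {g : Fin p → V} (hg : Function.Injective g) :
    ∃ col : V → ℕ, (∀ i, col (g i) = (i : ℕ) + 1) ∧ ∀ w, w ∉ Set.range g → col w = 1 := by
  classical
  refine ⟨fun w => if h : ∃ i, g i = w then h.choose + 1 else 1, fun i => ?_, fun w hw => ?_⟩
  · have h : ∃ j, g j = g i := ⟨i, rfl⟩
    simp only [dif_pos h]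
    rw [hg h.choose_spec]
  · exact dif_neg hw

theorem le_rmttr_iff_sys [Finite V] (hT : T.IsTree) {c x : V}
    (h1 : ∀ w ∈ childSet T c x, 1 ≤ rttr T c w) {p : ℕ} (hp : 1 ≤ p) :
    p ≤ rmttr T c x ↔ Sys (childSet T c x) (rttr T c) (p - 1) := by
  rw [le_rmttr_iff hT hp]
  constructor
  · rintro ⟨f, hfx, -, h, h'⟩
    obtain ⟨g, hg, hg'⟩ := exists_children_of_sees (p := p - 1)
      (fun i hi hi' => h' i hi (by omega))
    refine ⟨g, hg, fun i => ⟨(hg' i).1, ?_⟩⟩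
    rw [← (hg' i).2]
    refine le_rttr_of_child hT (hg' i).1 h ?_
    rw [(hg' i).2]
    omega
  · rintro ⟨g, hg, hg'⟩
    obtain ⟨col, hcol, hcol'⟩ := exists_colours_of_injective hg
    obtain ⟨f, hfx, hf, h⟩ := exists_glue hT (c := c) (x := x) (p := p) col (by
      intro w hw
      by_cases hwr : w ∈ Set.range g
      · obtain ⟨i, rfl⟩ := hwr
        rw [hcol]
        exact ⟨by omega, Or.inl (hg' i).2⟩
      · rw [hcol' w hwr]
        exact ⟨le_rfl, Or.inl (h1 w hw)⟩)
    refine ⟨f, hfx, hp, h, fun i hi hi' => ?_⟩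
    obtain ⟨hW, -⟩ := hg' ⟨i - 1, by omega⟩
    refine ⟨_, hW.2, hW.1, ?_⟩
    rw [hf _ hW, hcol]
    simp; omega

theorem le_rttr_iff_helpedSys [Finite V] (hT : T.IsTree) {c x : V}
    (h1 : ∀ w ∈ childSet T c x, 1 ≤ rttr T c w) {p : ℕ} (hp : 1 ≤ p) :
    p ≤ rttr T c x ↔ HelpedSys (childSet T c x) (rttr T c) (rmttr T c) p := by
  rw [le_rttr_iff hp]
  have hx := self_mem_subtreeSet T c x
  constructor
  · rintro ⟨f, rfl, h⟩
    obtain ⟨g, hg, hg'⟩ := exists_children_of_sees (h x hx).2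
    refine ⟨g, hg, fun i => ⟨(hg' i).1, ?_⟩⟩
    have hi := i.2
    rcases Nat.lt_or_ge (i + 1) (f x) with hlt | hge
    · left
      rw [← (hg' i).2]
      refine le_rttr_of_child hT (hg' i).1 (fun v hv _ => h v hv) ?_
      rw [(hg' i).2]
      exact hlt
    · right
      have he : (i : ℕ) + 1 = f x := by omega
      have := le_rmttr_of_child hT (hg' i).1 (fun v hv _ => h v hv) ((hg' i).2.trans he)
      rw [(hg' i).2, he] at this
      exact ⟨he, this⟩
  · rintro ⟨g, hg, hg'⟩
    obtain ⟨col, hcol, hcol'⟩ := exists_colours_of_injective hg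
    obtain ⟨f, hfx, hf, h⟩ := exists_glue hT (c := c) (x := x) (p := p) col (by
      intro w hw
      by_cases hwr : w ∈ Set.range g
      · obtain ⟨i, rfl⟩ := hwr
        rw [hcol]
        exact ⟨by omega, (hg' i).2⟩
      · rw [hcol' w hwr]
        exact ⟨le_rfl, Or.inl (h1 w hw)⟩)
    refine ⟨f, hfx, fun v hv => ?_⟩
    by_cases hvx : v = x
    · subst hvx
      refine ⟨by omega, fun i hi hi' => ?_⟩
      obtain ⟨hW, -⟩ := hg' ⟨i - 1, by omega⟩
      refine ⟨_, hW.2, hW.1, ?_⟩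
      rw [hf _ hW, hcol]
      simp; omega
    · exact h v hv hvx

/-! ### Leaves, support vertices and the gap between the two labels -/

theorem one_le_rmttr [Finite V] (hT : T.IsTree) (c x : V) : 1 ≤ rmttr T c x := by
  rw [le_rmttr_iff hT le_rfl]
  refine ⟨fun _ => 1, rfl, le_rfl, fun v hv hvx => ⟨le_rfl, fun i hi hi' => ?_⟩,
    fun i hi hi' => by omega⟩
  obtain ⟨u, hu, hvu⟩ := exists_adj_mem_subtreeSet hT hv hvx
  exact ⟨u, hu, hvu, le_antisymm hi hi'⟩

theorem rttr_pos_iff [Finite V] (hT : T.IsTree) {c x : V} :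
    1 ≤ rttr T c x ↔ (childSet T c x).Nonempty := by
  rw [le_rttr_iff le_rfl]
  constructor
  · rintro ⟨f, hf, h⟩
    obtain ⟨w, hw, hxw, -⟩ := (h x (self_mem_subtreeSet T c x)).2 1 le_rfl hf.ge
    exact ⟨w, hxw, hw⟩
  · rintro ⟨w, hxw, hw⟩
    refine ⟨fun _ => 1, rfl, fun v hv => ⟨le_rfl, fun i hi hi' => ?_⟩⟩
    by_cases hvx : v = x
    · subst hvx
      exact ⟨w, hw, hxw, le_antisymm hi hi'⟩
    · obtain ⟨u, hu, hvu⟩ := exists_adj_mem_subtreeSet hT hv hvx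
      exact ⟨u, hu, hvu, le_antisymm hi hi'⟩

theorem rttr_le_rmttr [Finite V] (hT : T.IsTree) (c x : V) : rttr T c x ≤ rmttr T c x := by
  rcases Nat.eq_zero_or_pos (rttr T c x) with h | h
  · omega
  · rw [le_rmttr_iff hT h]
    exact ((le_rttr_iff h).1 le_rfl).half (self_mem_subtreeSet T c x)

theorem rmttr_le_card [Finite V] (hT : T.IsTree) (c x : V) : rmttr T c x ≤ Nat.card V :=
  ((le_rmttr_iff hT (one_le_rmttr hT c x)).1 le_rfl).le_card

theorem rmttr_eq_one_of_leaf [Finite V] (hT : T.IsTree) {c x : V} (h : childSet T c x = ∅) :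
    rmttr T c x = 1 := by
  refine le_antisymm ?_ (one_le_rmttr hT c x)
  by_contra! h2
  rw [← Nat.succ_le_iff, le_rmttr_iff_sys hT (by simp [h]) (by omega)] at h2
  obtain ⟨g, -, hg⟩ := h2
  have := (hg ⟨0, by omega⟩).1
  rw [h] at this
  exact this

/-- The childless `w` must see colour 1, and its only neighbour is `x`; hence in a `Half` colouring
that realises `rmttr T c x` the colour of `x` is 1. -/
theorem labels_of_leaf_child [Finite V] (hT : T.IsTree) {c x w : V} (hw : w ∈ childSet T c x)
    (h0 : rttr T c w = 0) : rttr T c x = 1 ∧ rmttr T c x = 1 := by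
  have hle : rmttr T c x ≤ 1 := by
    obtain ⟨f, hfx, -, h, -⟩ := (le_rmttr_iff hT (one_le_rmttr hT c x)).1 le_rfl
    have hwx : w ≠ x := hw.1.ne'
    have hs := h w hw.2 hwx
    by_contra! hlt
    have hne : (childSet T c w) = ∅ := by
      rw [← Set.not_nonempty_iff_eq_empty, ← rttr_pos_iff hT]
      omega
    obtain ⟨u, hu, hwu, hu1⟩ := hs.2 1 le_rfl hs.1
    rcases mem_subtreeSet_child_of_adj hT hw (self_mem_subtreeSet T c w) hwu with h' | ⟨-, h'⟩
    · have : u ∈ childSet T c w := ⟨hwu, h'⟩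
      rw [hne] at this
      exact this
    · rw [h', hfx] at hu1
      omega
  have h1 := (rttr_pos_iff hT).2 ⟨w, hw⟩
  have := rttr_le_rmttr hT c x
  omega

/-- The system of size `rmttr T c x - 1` behind the second label is also a helped system in which
the help is not used. -/
theorem rmttr_le_rttr_add_one [Finite V] (hT : T.IsTree) (c x : V) :
    rmttr T c x ≤ rttr T c x + 1 := by
  by_cases h1 : ∀ w ∈ childSet T c x, 1 ≤ rttr T c w
  · rcases Nat.lt_or_ge 1 (rmttr T c x) with h | h
    · have := (le_rmttr_iff_sys hT h1 (by omega)).1 (le_refl (rmttr T c x))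
      have : rmttr T c x - 1 ≤ rttr T c x := by
        rw [le_rttr_iff_helpedSys hT h1 (by omega)]
        obtain ⟨g, hg, hg'⟩ := this
        exact ⟨g, hg, fun i => ⟨(hg' i).1, Or.inl (hg' i).2⟩⟩
      omega
    · omega
  · push Not at h1
    obtain ⟨w, hw, hw'⟩ := h1
    have := labels_of_leaf_child hT hw (by omega)
    omega

/-- The gap is at most one, so lowering the label whenever the two differ recovers `rttr` exactly.
-/
theorem passedLabel_eq [Finite V] (hT : T.IsTree) (c x : V) : passedLabel T c x = rttr T c x := by
  have := rmttr_le_rttr_add_one hT c x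
  have := rttr_le_rmttr hT c x
  unfold passedLabel
  split_ifs <;> omega

theorem le_rttr_iff_sys [Finite V] (hT : T.IsTree) {c x : V}
    (h1 : ∀ w ∈ childSet T c x, 1 ≤ rttr T c w) {p : ℕ} (hp : 1 ≤ p) :
    p ≤ rttr T c x ↔ Sys (childSet T c x) (bump (rttr T c) (rmttr T c) p) p := by
  rw [le_rttr_iff_helpedSys hT h1 hp, helpedSys_iff fun w _ => rmttr_le_rttr_add_one hT c w]

theorem rmttr_eq_of_isGreatest [Finite V] (hT : T.IsTree) {c x : V}
    (h1 : ∀ w ∈ childSet T c x, 1 ≤ rttr T c w) {z : ℕ}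
    (hz : IsGreatest {p | Sys (childSet T c x) (rttr T c) p} z) : rmttr T c x = z + 1 := by
  refine le_antisymm ?_ ?_
  · have := hz.2 ((le_rmttr_iff_sys hT h1 (one_le_rmttr hT c x)).1 le_rfl)
    omega
  · rw [le_rmttr_iff_sys hT h1 (by omega)]
    exact hz.1

/-- Since `rmttr T c x = z + 1` and `rttr` is smaller by at most one, only the value `z + 1` has to
be tested, and a single bumping at `z + 1` decides it. -/
theorem rttr_eq_of_isGreatest [Finite V] (hT : T.IsTree) {c x : V}
    (h1 : ∀ w ∈ childSet T c x, 1 ≤ rttr T c w) {z z' : ℕ}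
    (hz : IsGreatest {p | Sys (childSet T c x) (rttr T c) p} z)
    (hz' : IsGreatest {p | Sys (childSet T c x) (bump (rttr T c) (rmttr T c) (z + 1)) p} z') :
    rttr T c x = min (z + 1) z' := by
  have hm := rmttr_eq_of_isGreatest hT h1 hz
  have h2 := rttr_le_rmttr hT c x
  have h3 := rmttr_le_rttr_add_one hT c x
  have h4 : z ≤ z' := hz'.2 (hz.1.mono fun w _ => le_bump _ _ _ w)
  have h5 := le_rttr_iff_sys hT h1 (p := z + 1) (by omega)
  rcases Nat.lt_or_ge z z' with hlt | hge
  · have := h5.2 (hz'.1.anti hlt)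
    omega
  · have : ¬ z + 1 ≤ rttr T c x := fun h => by
      have := hz'.2 (h5.1 h)
      omega
    omega

end Recursion
end TotTrans

namespace TotTrans
open SimpleGraph

/-! ### Reduction to rooted trees and the recursion -/

section Theorems

variable {V : Type u} {T : SimpleGraph V}

/-- Sorting does no harm: `p + 1` chosen indices with labels at most `p` would all be among the `p`
indices `h 0, …, h (p - 1)`. The range is kept so that an index outside the system stays outside the
sorted one. -/
theorem exists_isAdmissibleSubsequence {k z : ℕ} {l : Fin k → ℕ} (hl : Monotone l)
    {h : Fin z → Fin k} (hinj : Function.Injective h) (hh : ∀ p : Fin z, (p : ℕ) + 1 ≤ l (h p)) :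
    ∃ i : Fin z → Fin k, IsAdmissibleSubsequence l i ∧ Set.range i = Set.range h := by
  classical
  set A : Finset (Fin k) := Finset.univ.image h with hA
  have hcard : A.card = z := by
    rw [hA, Finset.card_image_of_injective _ hinj]; simp
  refine ⟨A.orderEmbOfFin hcard, ⟨(A.orderEmbOfFin hcard).strictMono, fun p => ?_⟩, ?_⟩
  · by_contra! hlt
    -- the first `p + 1` elements of `A` have labels at most `p`
    have h1 : ((Finset.Iic p).image (A.orderEmbOfFin hcard)) ⊆ (Finset.Iio p).image h := by
      intro a ha
      obtain ⟨q, hq, rfl⟩ := Finset.mem_image.1 ha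
      have hqp : q ≤ p := Finset.mem_Iic.1 hq
      have hmem := A.orderEmbOfFin_mem hcard q
      obtain ⟨r, -, hr⟩ := Finset.mem_image.1 (hA.subset hmem)
      refine Finset.mem_image.2 ⟨r, ?_, hr⟩
      have h2 := hh r
      have h3 : l (A.orderEmbOfFin hcard q) ≤ l (A.orderEmbOfFin hcard p) :=
        hl ((A.orderEmbOfFin hcard).monotone hqp)
      rw [← hr] at h3
      rw [Finset.mem_Iio, Fin.lt_def]
      omega
    have h2 := Finset.card_le_card h1
    rw [Finset.card_image_of_injective _ (A.orderEmbOfFin hcard).injective,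
      Finset.card_image_of_injective _ hinj] at h2
    simp at h2
  · rw [Finset.range_orderEmbOfFin, hA]
    simp

theorem sys_iff_isAdmissibleSubsequence {k : ℕ} {W : Set V} {l : V → ℕ} {v : Fin k → V}
    (hv : Function.Injective v) (hW : Set.range v = W) (hl : Monotone fun j => l (v j)) {z : ℕ} :
    Sys W l z ↔ ∃ i : Fin z → Fin k, IsAdmissibleSubsequence (fun j => l (v j)) i := by
  constructor
  · rintro ⟨g, hg, hg'⟩
    have : ∀ p, ∃ j, v j = g p := fun p => by
      have := (hg' p).1
      rwa [← hW] at this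
    choose h hh using this
    obtain ⟨i, hi, -⟩ := exists_isAdmissibleSubsequence hl (h := h)
      (fun a b hab => hg (by rw [← hh, ← hh, hab])) (fun p => by rw [hh]; exact (hg' p).2)
    exact ⟨i, hi⟩
  · rintro ⟨i, hi, hi'⟩
    exact ⟨v ∘ i, hv.comp hi.injective, fun p => ⟨hW ▸ Set.mem_range_self _, hi' p⟩⟩

/-- The index `q` is the child in the last position of a helped system of size `z + 1`, the only
position in which help is allowed; the other `z` children are sorted into `i`. -/
theorem recursion_step [Finite V] (hT : T.IsTree) {c x : V}
    (h1 : ∀ w ∈ childSet T c x, 1 ≤ rttr T c w) {k : ℕ} {v : Fin k → V}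
    (hv : Function.Injective v) (hW : Set.range v = childSet T c x)
    (hl : Monotone fun j => rttr T c (v j)) {z : ℕ}
    (hz : IsGreatest {z : ℕ | ∃ i : Fin z → Fin k,
      IsAdmissibleSubsequence (fun j => rttr T c (v j)) i} z) :
    rmttr T c x = z + 1 ∧ z ≤ rttr T c x ∧
    (z + 1 ≤ rttr T c x ↔ ∃ (i : Fin z → Fin k) (q : Fin k),
      IsAdmissibleSubsequence (fun j => rttr T c (v j)) i ∧
      q ∉ Set.range i ∧ rttr T c (v q) ≠ rmttr T c (v q) ∧ z + 1 ≤ rmttr T c (v q)) := by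
  have hz' : IsGreatest {p | Sys (childSet T c x) (rttr T c) p} z := by
    simpa only [sys_iff_isAdmissibleSubsequence hv hW hl] using hz
  have hm := rmttr_eq_of_isGreatest hT h1 hz'
  refine ⟨hm, by have := rmttr_le_rttr_add_one hT c x; omega, ?_⟩
  rw [le_rttr_iff_helpedSys hT h1 (by omega)]
  constructor
  · rintro ⟨g, hg, hg'⟩
    have : ∀ p, ∃ j, v j = g p := fun p => by
      have := (hg' p).1
      rwa [← hW] at this
    choose h hh using this
    have hinj : Function.Injective h := fun a b hab => hg (by rw [← hh, ← hh, hab])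
    obtain ⟨i, hi, hr⟩ := exists_isAdmissibleSubsequence hl (h := fun p : Fin z => h p.castSucc)
      (hinj.comp (Fin.castSucc_injective z)) (fun p => by
        rw [hh]
        rcases (hg' p.castSucc).2 with h2 | ⟨h2, -⟩
        · exact h2
        · simp at h2; omega)
    -- Otherwise the system would need no help, against the maximality of `z`. This is why the two
    -- labels of `q` differ.
    have hlast : ¬ z + 1 ≤ rttr T c (g (Fin.last z)) := fun hle => by
      have : Sys (childSet T c x) (rttr T c) (z + 1) := ⟨g, hg, fun p => ⟨(hg' p).1, by
        rcases (hg' p).2 with h2 | ⟨h2, -⟩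
        · exact h2
        · have : p = Fin.last z := Fin.ext (by simpa using h2)
          subst this
          simpa using hle⟩⟩
      have := hz'.2 this
      omega
    refine ⟨i, h (Fin.last z), hi, ?_, ?_⟩
    · rw [hr]
      rintro ⟨p, hp⟩
      exact p.castSucc_lt_last.ne (hinj hp)
    · rw [hh]
      rcases (hg' (Fin.last z)).2 with h2 | ⟨-, h2⟩
      · exact absurd (by simpa using h2) hlast
      · exact ⟨by omega, h2⟩
  · rintro ⟨i, q, hi, hq, -, hqm⟩
    refine ⟨Fin.snoc (v ∘ i) (v q), ?_, fun p => ?_⟩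
    · rw [Fin.snoc_injective_iff]
      refine ⟨hv.comp hi.1.injective, ?_⟩
      rintro ⟨p, hp⟩
      exact hq ⟨p, hv hp⟩
    · refine Fin.lastCases ?_ (fun p => ?_) p
      · simp only [Fin.snoc_last, Fin.val_last]
        exact ⟨hW ▸ Set.mem_range_self q, Or.inr ⟨trivial, hqm⟩⟩
      · simp only [Fin.snoc_castSucc, Fin.val_castSucc]
        exact ⟨hW ▸ Set.mem_range_self _, Or.inl (hi.2 p)⟩

theorem exists_adj_of_isTree [Nontrivial V] (hT : T.IsTree) (v : V) : ∃ w, T.Adj v w :=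
  hT.connected.preconnected.exists_adj_of_nontrivial v

theorem ttr_pos [Finite V] [Nontrivial V] (hT : T.IsTree) (v : V) : 1 ≤ ttr T v := by
  rw [le_ttr_iff le_rfl]
  refine ⟨fun _ => 1, rfl, fun u _ => ⟨le_rfl, fun i hi hi' => ?_⟩⟩
  obtain ⟨w, hw⟩ := exists_adj_of_isTree hT u
  exact ⟨w, trivial, hw, le_antisymm hi hi'⟩

theorem rttr_self [Finite V] (c : V) : rttr T c c = ttr T c := by
  refine eq_of_forall_le_iff fun p => ?_
  rcases Nat.eq_zero_or_pos p with rfl | hp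
  · simp
  · rw [le_rttr_iff hp, le_ttr_iff hp, subtreeSet_self]

theorem IsTotalTransitivePartition.exists_le_ttr [Finite V] [Nonempty V] {k : ℕ}
    {P : Fin k → Set V} (hP : IsTotalTransitivePartition T P) : ∃ v, k ≤ ttr T v := by
  rcases Nat.eq_zero_or_pos k with rfl | hk
  · exact ⟨Classical.arbitrary V, Nat.zero_le _⟩
  · obtain ⟨f, hf, h1, hfk⟩ := hP.1.exists_colouring
    have h := (isTotalTransitivePartition_iff hf h1 hfk).1 hP
    obtain ⟨v, hv⟩ := h.2 k hk le_rfl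
    exact ⟨v, (le_ttr_iff hk).2 ⟨f, hv, fun u _ => h.1 u⟩⟩

/-- In a colouring that realises `ttr T v`, each colour `f w` is at most `ttr T w ≤ ttr T v`, so `v`
has the top colour. -/
theorem isGreatest_of_max_ttr [Finite V] [Nontrivial V] (hT : T.IsTree) {v : V}
    (hv : ∀ w, ttr T w ≤ ttr T v) :
    IsGreatest {k : ℕ | ∃ P : Fin k → Set V, IsTotalTransitivePartition T P} (ttr T v) := by
  refine ⟨?_, ?_⟩
  · obtain ⟨f, hf, h⟩ := (le_ttr_iff (ttr_pos hT v)).1 le_rfl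
    have hle : ∀ w, f w ≤ f v := fun w => by
      rw [hf]
      refine le_trans ?_ (hv w)
      exact (le_ttr_iff (h w trivial).1).2 ⟨f, rfl, h⟩
    rw [← hf]
    exact ⟨_, exists_isTotalTransitivePartition (fun w => h w trivial) hle⟩
  · rintro k ⟨P, hP⟩
    obtain ⟨w, hw⟩ := hP.exists_le_ttr
    exact hw.trans (hv w)

theorem totalTransitivity_eq [Finite V] [Nontrivial V] (hT : T.IsTree) {v : V}
    (hv : ∀ w, ttr T w ≤ ttr T v) : totalTransitivity T = ttr T v :=
  (isGreatest_of_max_ttr hT hv).csSup_eq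

theorem reduction_to_rooted_trees [Finite V] [Nontrivial V] (hT : T.IsTree) :
    IsGreatest {k : ℕ | ∃ P : Fin k → Set V, IsTotalTransitivePartition T P}
      (totalTransitivity T) ∧
    IsGreatest (Set.range (ttr T)) (totalTransitivity T) ∧ ∀ c : V, ttr T c = rttr T c c := by
  obtain ⟨v, hv⟩ := Finite.exists_max (ttr T)
  rw [totalTransitivity_eq hT hv]
  refine ⟨isGreatest_of_max_ttr hT hv, ⟨⟨v, rfl⟩, ?_⟩, fun c => (rttr_self c).symm⟩
  rintro _ ⟨w, rfl⟩
  exact hv w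

theorem recursion_at_vertex [Finite V] (hT : T.IsTree) (c x : V) :
      (childSet T c x = ∅ → rmttr T c x = 1) ∧
      ((∃ w ∈ childSet T c x, childSet T c w = ∅) → rttr T c x = 1 ∧ rmttr T c x = 1) ∧
      ((childSet T c x).Nonempty →
        (∀ w ∈ childSet T c x, (childSet T c w).Nonempty) →
        ∀ (k : ℕ) (v : Fin k → V), Function.Injective v →
          Set.range v = childSet T c x →
          Monotone (fun j => passedLabel T c (v j)) →
          ∀ z : ℕ, IsGreatest {z : ℕ | ∃ i : Fin z → Fin k,
              IsAdmissibleSubsequence (fun j => passedLabel T c (v j)) i} z →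
            ((∃ (i : Fin z → Fin k) (q : Fin k),
                IsAdmissibleSubsequence (fun j => passedLabel T c (v j)) i ∧
                q ∉ Set.range i ∧ rttr T c (v q) ≠ rmttr T c (v q) ∧
                z + 1 ≤ rmttr T c (v q)) →
              rttr T c x = z + 1 ∧ rmttr T c x = z + 1) ∧
            ((¬ ∃ (i : Fin z → Fin k) (q : Fin k),
                IsAdmissibleSubsequence (fun j => passedLabel T c (v j)) i ∧
                q ∉ Set.range i ∧ rttr T c (v q) ≠ rmttr T c (v q) ∧
                z + 1 ≤ rmttr T c (v q)) →
              rttr T c x = z ∧ rmttr T c x = z + 1)) := by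
  simp only [passedLabel_eq hT]
  refine ⟨rmttr_eq_one_of_leaf hT, ?_, ?_⟩
  · rintro ⟨w, hw, hw'⟩
    refine labels_of_leaf_child hT hw ?_
    by_contra h
    exact ((rttr_pos_iff hT).1 (Nat.pos_of_ne_zero h)).ne_empty hw'
  · intro _ hc k v hv hW hl z hz
    obtain ⟨h2, h3, h4⟩ := recursion_step hT (fun w hw => (rttr_pos_iff hT).2 (hc w hw)) hv hW hl hz
    have h5 := rttr_le_rmttr hT c x
    refine ⟨fun h => ?_, fun h => ?_⟩
    · have := h4.2 h
      omega
    · have := mt h4.1 h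
      omega

end Theorems
end TotTrans

namespace TotTrans
open SimpleGraph

/-! ### Counting form of the recursion -/

section Counting

variable {V : Type u} {T : SimpleGraph V}

/-- Hall's theorem for nested sets: position `j` admits the elements with label above `j`, so the
union over a set of positions contains the set for the least of them, and `h₁` is Hall's condition.
Conversely, in a system of size `p` the positions from `i` on use distinct elements with labels
above `i`. -/
theorem isGreatest_sys_of_count {E : Finset ℕ} {s : ℕ → V} (hs : Set.InjOn s E) {W : Set V}
    (hW : s '' E = W) {l : V → ℕ} {z : ℕ}
    (h₁ : ∀ i, z ≤ i + (E.filter fun e => i < l (s e)).card)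
    (h₂ : ∃ i, i + (E.filter fun e => i < l (s e)).card ≤ z) :
    IsGreatest {p | Sys W l p} z := by
  classical
  constructor
  · have hall : ∀ A : Finset (Fin z), A.card ≤
        (A.biUnion fun j => E.filter fun e => (j : ℕ) < l (s e)).card := by
      intro A
      rcases A.eq_empty_or_nonempty with rfl | hA
      · simp
      · have hj := A.min'_mem hA
        set j := A.min' hA
        have hsub : A ⊆ Finset.Ici j := fun a ha => Finset.mem_Ici.2 (A.min'_le a ha)
        have h3 := Finset.card_le_card hsub
        rw [Fin.card_Ici] at h3
        have h4 := Finset.card_le_card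
          (Finset.subset_biUnion_of_mem (fun j : Fin z => E.filter fun e => (j : ℕ) < l (s e)) hj)
        have := h₁ j
        omega
    obtain ⟨f, hf, hf'⟩ := (Finset.all_card_le_biUnion_card_iff_exists_injective _).1 hall
    simp only [Finset.mem_filter] at hf'
    refine ⟨fun j => s (f j), fun i j hij => hf (hs (hf' i).1 (hf' j).1 hij), fun j => ⟨?_, ?_⟩⟩
    · rw [← hW]; exact ⟨f j, (hf' j).1, rfl⟩
    · exact (hf' j).2
  · rintro p ⟨g, hg, hg'⟩
    obtain ⟨i, hi⟩ := h₂
    have : ∀ j, ∃ e ∈ E, s e = g j := fun j => by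
      have := (hg' j).1
      rw [← hW] at this
      exact this
    choose h hE hh using this
    have hinj : Function.Injective h := fun a b hab => hg (by rw [← hh, ← hh, hab])
    have h3 : (Finset.univ.filter fun j : Fin p => i ≤ (j : ℕ)).image h ⊆
        E.filter fun e => i < l (s e) := by
      intro e he
      obtain ⟨j, hj, rfl⟩ := Finset.mem_image.1 he
      refine Finset.mem_filter.2 ⟨hE j, ?_⟩
      have := (hg' j).2
      have := (Finset.mem_filter.1 hj).2
      rw [hh]
      omega
    have h4 := Finset.card_le_card h3
    rw [Finset.card_image_of_injective _ hinj] at h4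
    have h5 : p - i ≤ (Finset.univ.filter fun j : Fin p => i ≤ (j : ℕ)).card := by
      have := Finset.card_filter_add_card_filter_not (s := (Finset.univ : Finset (Fin p)))
        (fun j : Fin p => i ≤ (j : ℕ))
      have h6 : (Finset.univ.filter fun j : Fin p => ¬ i ≤ (j : ℕ)).card ≤ i := by
        have := Finset.card_le_card_of_injOn (s := Finset.univ.filter fun j : Fin p => ¬ i ≤ (j : ℕ))
          (t := Finset.range i) (fun j : Fin p => (j : ℕ))
          (fun j hj => by simp at hj; simpa using hj) (fun a _ b _ hab => Fin.ext hab)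
        simpa using this
      rw [Finset.card_univ, Fintype.card_fin] at this
      omega
    omega

/-! ### Labels of darts do not depend on the root -/

theorem rttr_congr_root [Finite V] (hT : T.IsTree) {x y w : V} (h : y = x ∨ T.Adj y x)
    (hw : T.Adj x w) (hwy : w ≠ y) : rttr T y w = rttr T x w := by
  refine eq_of_forall_le_iff fun p => ?_
  rcases Nat.eq_zero_or_pos p with rfl | hp
  · simp
  · rw [le_rttr_iff hp, le_rttr_iff hp, subtreeSet_of_adj hT h hw hwy]

theorem rmttr_congr_root [Finite V] (hT : T.IsTree) {x y w : V} (h : y = x ∨ T.Adj y x)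
    (hw : T.Adj x w) (hwy : w ≠ y) : rmttr T y w = rmttr T x w := by
  refine eq_of_forall_le_iff fun p => ?_
  rcases Nat.eq_zero_or_pos p with rfl | hp
  · simp
  · rw [le_rmttr_iff hT hp, le_rmttr_iff hT hp, subtreeSet_of_adj hT h hw hwy]

theorem sys_congr {W : Set V} {l l' : V → ℕ} {p : ℕ} (h : ∀ w ∈ W, l w = l' w) :
    Sys W l p ↔ Sys W l' p :=
  ⟨fun H => H.mono fun w hw => (h w hw).le, fun H => H.mono fun w hw => (h w hw).ge⟩

/-- The labels of `x` with parent `y` (or of the root `x`, if `y = x`) from those of the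
other neighbours of `x`, in terms of counts. -/
theorem labels_eq_of_count [Finite V] (hT : T.IsTree) {x y : V} (hxy : y = x ∨ T.Adj y x)
    {E : Finset ℕ} {s : ℕ → V} (hs : Set.InjOn s E) (hW : s '' E = {w | T.Adj x w ∧ w ≠ y})
    {t m : ℕ → ℕ} (ht : ∀ e ∈ E, t e = rttr T x (s e)) (hm : ∀ e ∈ E, m e = rmttr T x (s e))
    {a z z' q : ℕ} (ha : 0 < a ↔ ∃ e ∈ E, t e = 0)
    (h₁ : ∀ i, a = 0 → z ≤ i + (E.filter fun e => i < t e).card)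
    (h₂ : a = 0 → ∃ i, i + (E.filter fun e => i < t e).card ≤ z)
    (hq : q = if 0 < a then 1 else z + 1)
    (h₃ : ∀ i, z' ≤ i + (E.filter fun e => i < bump t m q e).card)
    (h₄ : ∃ i, i + (E.filter fun e => i < bump t m q e).card ≤ z') :
    rttr T y x = min q z' ∧ rmttr T y x = q := by
  classical
  have hc := childSet_of_adj hT hxy
  have hE : ∀ e ∈ E, T.Adj x (s e) ∧ s e ≠ y := fun e he => by
    have : s e ∈ s '' E := ⟨e, he, rfl⟩
    rw [hW] at this
    exact this
  have hrt : ∀ w ∈ childSet T y x, rttr T y w = rttr T x w := fun w hw => by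
    rw [hc] at hw; exact rttr_congr_root hT hxy hw.1 hw.2
  have hrm : ∀ w ∈ childSet T y x, rmttr T y w = rmttr T x w := fun w hw => by
    rw [hc] at hw; exact rmttr_congr_root hT hxy hw.1 hw.2
  have hbump : ∀ e ∈ E, bump t m q e = bump (rttr T x) (rmttr T x) q (s e) := fun e he => by
    simp only [bump, ht e he, hm e he]
  -- A positive `a` signals a leaf child; both labels are then 1 and `z` carries no information.
  by_cases h0 : 0 < a
  · obtain ⟨e, he, hte⟩ := ha.1 h0
    rw [if_pos h0] at hq
    subst hq
    have hmem : s e ∈ childSet T y x := by rw [hc]; exact hE e he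
    have := labels_of_leaf_child hT hmem (by rw [hrt _ hmem, ← ht e he, hte])
    rw [this.1, this.2]
    refine ⟨?_, rfl⟩
    -- The leaf child has second label exactly 1, so bumping at `q = 1` gives it a positive label.
    have hz' : 1 ≤ z' := by
      obtain ⟨i, hi⟩ := h₄
      rcases Nat.eq_zero_or_pos i with rfl | hi0
      · have : e ∈ E.filter fun e => 0 < bump t m 1 e := by
          refine Finset.mem_filter.2 ⟨he, ?_⟩
          have h5 : m e = 1 := by
            have h6 := rmttr_le_rttr_add_one hT x (s e)
            have h7 := one_le_rmttr hT x (s e)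
            rw [← ht e he, ← hm e he] at h6
            rw [← hm e he] at h7
            omega
          simp [bump, hte, h5]
        have := Finset.card_pos.2 ⟨e, this⟩
        omega
      · omega
    omega
  · have h0' : a = 0 := by omega
    rw [if_neg h0] at hq
    subst hq
    have hpos : ∀ w ∈ childSet T y x, 1 ≤ rttr T y w := by
      intro w hw
      have hw' := hw
      rw [hc, ← hW] at hw'
      obtain ⟨e, he, rfl⟩ := hw'
      rw [hrt _ hw, ← ht e he]
      by_contra hlt
      exact h0 (ha.2 ⟨e, he, by omega⟩)
    have hft : ∀ i, (E.filter fun e => i < t e) = E.filter fun e => i < rttr T x (s e) :=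
      fun i => Finset.filter_congr fun e he => by rw [ht e he]
    have hfb : ∀ i, (E.filter fun e => i < bump t m (z + 1) e) =
        E.filter fun e => i < bump (rttr T x) (rmttr T x) (z + 1) (s e) :=
      fun i => Finset.filter_congr fun e he => by rw [hbump e he]
    have hg := isGreatest_sys_of_count hs (hW.trans hc.symm) (l := rttr T x) (z := z)
      (fun i => hft i ▸ h₁ i h0') (by simpa only [hft] using h₂ h0')
    have hg' := isGreatest_sys_of_count hs (hW.trans hc.symm)
      (l := bump (rttr T x) (rmttr T x) (z + 1)) (z := z')
      (fun i => hfb i ▸ h₃ i) (by simpa only [hfb] using h₄)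
    have e1 : {p | Sys (childSet T y x) (rttr T x) p} = {p | Sys (childSet T y x) (rttr T y) p} :=
      Set.ext fun p => sys_congr fun w hw => (hrt w hw).symm
    have e2 : {p | Sys (childSet T y x) (bump (rttr T x) (rmttr T x) (z + 1)) p} =
        {p | Sys (childSet T y x) (bump (rttr T y) (rmttr T y) (z + 1)) p} :=
      Set.ext fun p => sys_congr fun w hw => by simp only [bump, hrt w hw, hrm w hw]
    rw [e1] at hg
    rw [e2] at hg'
    exact ⟨rttr_eq_of_isGreatest hT hpos hg hg', rmttr_eq_of_isGreatest hT hpos hg⟩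

end Counting
end TotTrans

namespace TotTrans

/-! ### Program logic -/

section ProgramLogic

@[simp] theorem Mem.setReg_reg (s : Mem) (x a y : ℕ) :
    (s.setReg x a).reg y = if y = x then a else s.reg y := by
  simp [Mem.setReg, Function.update_apply]

@[simp] theorem Mem.setReg_arr (s : Mem) (x a : ℕ) : (s.setReg x a).arr = s.arr := rfl

@[simp] theorem Mem.setArr_reg (s : Mem) (A j a : ℕ) : (s.setArr A j a).reg = s.reg := rfl

@[simp] theorem Mem.setArr_arr (s : Mem) (A j a B : ℕ) :
    (s.setArr A j a).arr B = if B = A then Function.update (s.arr A) j a else s.arr B := by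
  simp [Mem.setArr, Function.update_apply]

instance (b : Test) (s : Mem) : Decidable (b.Holds s) := by
  cases b <;> unfold Test.Holds <;> infer_instance

@[simp] theorem Test.holds_lt (x y : ℕ) (s : Mem) :
    (Test.lt x y).Holds s ↔ s.reg x < s.reg y := Iff.rfl

@[simp] theorem Test.holds_eq (x y : ℕ) (s : Mem) :
    (Test.eq x y).Holds s ↔ s.reg x = s.reg y := Iff.rfl

/-- `c` contains no loop. -/
def Prog.loopFree : Prog → Bool
  | .seq c d => c.loopFree && d.loopFree
  | .cond _ c d => c.loopFree && d.loopFree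
  | .loop _ _ => false
  | _ => true

/-- A bound for the number of steps of a loop-free program. -/
def Prog.cost : Prog → ℕ
  | .seq c d => c.cost + d.cost
  | .cond _ c d => max c.cost d.cost + 1
  | _ => 1

/-- The effect of a loop-free program. -/
def Prog.run : Prog → Mem → Mem
  | .const x m, s => s.setReg x m
  | .copy x y, s => s.setReg x (s.reg y)
  | .succ x y, s => s.setReg x (s.reg y + 1)
  | .pred x y, s => s.setReg x (s.reg y - 1)
  | .load x A y, s => s.setReg x (s.arr A (s.reg y))
  | .store A x y, s => s.setArr A (s.reg x) (s.reg y)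
  | .seq c d, s => d.run (c.run s)
  | .cond b c d, s => if b.Holds s then c.run s else d.run s
  | .loop _ _, s => s

/-- `c`, started in `s`, halts within `t` steps in a memory satisfying `Q`. -/
def Runs (c : Prog) (s : Mem) (t : ℕ) (Q : Mem → Prop) : Prop :=
  ∃ t' s', Exec c s t' s' ∧ t' ≤ t ∧ Q s'

theorem exec_run {c : Prog} (h : c.loopFree) (s : Mem) :
    ∃ t, Exec c s t (c.run s) ∧ t ≤ c.cost := by
  induction c generalizing s with
  | const x m => exact ⟨1, .const x m s, le_rfl⟩
  | copy x y => exact ⟨1, .copy x y s, le_rfl⟩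
  | succ x y => exact ⟨1, .succ x y s, le_rfl⟩
  | pred x y => exact ⟨1, .pred x y s, le_rfl⟩
  | load x A y => exact ⟨1, .load x A y s, le_rfl⟩
  | store A x y => exact ⟨1, .store A x y s, le_rfl⟩
  | seq c d ihc ihd =>
    simp only [Prog.loopFree, Bool.and_eq_true] at h
    obtain ⟨t₁, h₁, h₁'⟩ := ihc h.1 s
    obtain ⟨t₂, h₂, h₂'⟩ := ihd h.2 (c.run s)
    exact ⟨t₁ + t₂, .seq h₁ h₂, Nat.add_le_add h₁' h₂'⟩
  | cond b c d ihc ihd =>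
    simp only [Prog.loopFree, Bool.and_eq_true] at h
    by_cases hb : b.Holds s
    · obtain ⟨t, h₁, h₁'⟩ := ihc h.1 s
      refine ⟨t + 1, ?_, ?_⟩
      · simpa only [Prog.run, if_pos hb] using Exec.cond_true hb h₁
      · simp only [Prog.cost]; omega
    · obtain ⟨t, h₁, h₁'⟩ := ihd h.2 s
      refine ⟨t + 1, ?_, ?_⟩
      · simpa only [Prog.run, if_neg hb] using Exec.cond_false hb h₁
      · simp only [Prog.cost]; omega
  | loop b c => simp [Prog.loopFree] at h

theorem Runs.of_run {c : Prog} (h : c.loopFree) {s : Mem} {t : ℕ} {Q : Mem → Prop}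
    (ht : c.cost ≤ t) (hQ : Q (c.run s)) : Runs c s t Q := by
  obtain ⟨t', h₁, h₂⟩ := exec_run h s
  exact ⟨t', _, h₁, h₂.trans ht, hQ⟩

theorem Runs.mono {c : Prog} {s : Mem} {t t' : ℕ} {Q Q' : Mem → Prop} (h : Runs c s t Q)
    (ht : t ≤ t') (hQ : ∀ s', Q s' → Q' s') : Runs c s t' Q' := by
  obtain ⟨t₁, s₁, h₁, h₂, h₃⟩ := h
  exact ⟨t₁, s₁, h₁, h₂.trans ht, hQ _ h₃⟩

theorem Runs.seq {c d : Prog} {s : Mem} {t₁ t₂ t : ℕ} {P Q : Mem → Prop} (h : Runs c s t₁ P)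
    (h' : ∀ s', P s' → Runs d s' t₂ Q) (ht : t₁ + t₂ ≤ t) : Runs (.seq c d) s t Q := by
  obtain ⟨t₁', s₁, h₁, h₂, h₃⟩ := h
  obtain ⟨t₂', s₂, h₄, h₅, h₆⟩ := h' s₁ h₃
  exact ⟨_, _, .seq h₁ h₄, by omega, h₆⟩

theorem Runs.seq_run {c d : Prog} (hc : c.loopFree) {s : Mem} {t₂ t : ℕ} {Q : Mem → Prop}
    (h' : Runs d (c.run s) t₂ Q) (ht : c.cost + t₂ ≤ t) : Runs (.seq c d) s t Q :=
  Runs.seq (P := fun s' => s' = c.run s) (Runs.of_run hc le_rfl rfl) (by rintro _ rfl; exact h') ht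

/-- Loop rule; `I k` is the invariant when at most `k` rounds are left. -/
theorem Runs.loop {b : Test} {c : Prog} {t T : ℕ} {Q : Mem → Prop} (I : ℕ → Mem → Prop)
    (hstep : ∀ k s, I k s → b.Holds s → Runs c s t fun s' => ∃ k' < k, I k' s')
    (hend : ∀ k s, I k s → ¬ b.Holds s → Q s) {k : ℕ} {s : Mem} (h : I k s)
    (hT : k * (t + 1) + 1 ≤ T) : Runs (.loop b c) s T Q := by
  suffices H : Runs (.loop b c) s (k * (t + 1) + 1) Q from H.mono hT fun _ => id
  clear hT
  induction k using Nat.strong_induction_on generalizing s with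
  | _ k ih =>
    by_cases hb : b.Holds s
    · obtain ⟨t₁, s₁, h₁, h₂, k', hk', h₃⟩ := hstep k s h hb
      obtain ⟨t₂, s₂, h₄, h₅, h₆⟩ := ih k' hk' h₃
      refine ⟨_, _, .loop_true hb h₁ h₄, ?_, h₆⟩
      have : (k' + 1) * (t + 1) ≤ k * (t + 1) := Nat.mul_le_mul_right _ hk'
      rw [Nat.add_mul] at this
      omega
    · exact ⟨1, s, .loop_false hb, by omega, hend k s h hb⟩

/-- Rule for `while x < y do c` in which register `x` counts from `0` to `N`, the value of
register `y`. -/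
theorem Runs.count {x y : ℕ} {c : Prog} {N t T : ℕ} {Q : Mem → Prop} (I : ℕ → Mem → Prop)
    (hx : ∀ i s, I i s → s.reg x = i) (hy : ∀ i s, I i s → s.reg y = N)
    (hstep : ∀ i s, I i s → i < N → Runs c s t (I (i + 1)))
    (hend : ∀ s, I N s → Q s) {i : ℕ} {s : Mem} (h : I i s) (hi : i ≤ N)
    (hT : N * (t + 1) + 1 ≤ T) : Runs (.loop (.lt x y) c) s T Q := by
  refine Runs.loop (fun k s => k ≤ N ∧ I (N - k) s) ?_ ?_ (k := N - i)
    ⟨Nat.sub_le _ _, by rwa [Nat.sub_sub_self hi]⟩ ?_ (t := t)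
  · rintro k s ⟨hk, hI⟩ hb
    rw [Test.holds_lt, hx _ _ hI, hy _ _ hI] at hb
    refine (hstep _ _ hI hb).mono le_rfl fun s' h' => ⟨k - 1, by omega, by omega, ?_⟩
    rwa [show N - (k - 1) = N - k + 1 by omega]
  · rintro k s ⟨hk, hI⟩ hb
    rw [Test.holds_lt, hx _ _ hI, hy _ _ hI] at hb
    have : k = 0 := by omega
    subst this
    exact hend s hI
  · have := Nat.mul_le_mul_right (t + 1) (Nat.sub_le N i)
    omega

end ProgramLogic

infixr:30 " ;; " => Prog.seq

/-- A program without effect. -/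
def Prog.skip : Prog := .copy 99 99

@[simp] theorem Prog.run_skip (s : Mem) : Prog.skip.run s = s := by
  simp [Prog.skip, Prog.run, Mem.setReg]

end TotTrans

namespace TotTrans

/-! ### Buckets of child labels -/

/-- `src` and `dst` list the two orientations of every edge of `T`, in positions below `D`. -/
structure IsDartList {n : ℕ} (T : SimpleGraph (Fin n)) (D : ℕ) (src dst : ℕ → Fin n) : Prop where
  adj : ∀ e < D, T.Adj (src e) (dst e)
  exists_dart : ∀ u v, T.Adj u v → ∃ e < D, src e = u ∧ dst e = v
  inj : ∀ e < D, ∀ e' < D, src e = src e' → dst e = dst e' → e = e'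
  le : D ≤ 2 * n

/-- Registers 0, 2, 3, 4 hold `n`, the number of darts, zero, `n + 1`; arrays 4 and 5 hold the
darts. -/
structure Env {n : ℕ} (D : ℕ) (src dst : ℕ → Fin n) (s : Mem) : Prop where
  r0 : s.reg 0 = n
  r2 : s.reg 2 = D
  r3 : s.reg 3 = 0
  r4 : s.reg 4 = n + 1
  src : ∀ e < D, s.arr 4 e = src e
  dst : ∀ e < D, s.arr 5 e = dst e

theorem Env.congr {n D : ℕ} {src dst : ℕ → Fin n} {s s' : Mem} (h : Env D src dst s)
    (hr : ∀ r < 5, s'.reg r = s.reg r) (h4 : s'.arr 4 = s.arr 4) (h5 : s'.arr 5 = s.arr 5) :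
    Env D src dst s' :=
  ⟨by rw [hr 0 (by omega), h.r0], by rw [hr 2 (by omega), h.r2], by rw [hr 3 (by omega), h.r3],
    by rw [hr 4 (by omega), h.r4], by rw [h4]; exact h.src, by rw [h5]; exact h.dst⟩

open Prog

/-- For every dart from a vertex other than register 9 to the vertex in register 8, with the dart
in register 21, its label, bumped according to register 10, in register 22, and its source in
register 23, execute `body`. -/
def childStep (body : Prog) : Prog :=
  load 24 5 21 ;;
  cond (.eq 24 8)
    (load 23 4 21 ;;
      cond (.eq 23 9) skip
        (load 22 6 21 ;; succ 24 22 ;;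
          cond (.eq 24 10) (load 24 7 21 ;; cond (.eq 24 10) (copy 22 10) skip) skip ;;
          body))
    skip ;;
  succ 21 21

def forChildren (body : Prog) : Prog := const 21 0 ;; .loop (.lt 21 2) (childStep body)

/-- The darts from vertices other than `y` to `x`. -/
def childDarts {n : ℕ} (D : ℕ) (src dst : ℕ → Fin n) (x y : Fin n) : Finset ℕ :=
  (Finset.range D).filter fun e => dst e = x ∧ src e ≠ y

theorem mem_childDarts {n D : ℕ} {src dst : ℕ → Fin n} {x y : Fin n} {e : ℕ} :
    e ∈ childDarts D src dst x y ↔ e < D ∧ dst e = x ∧ src e ≠ y := by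
  simp [childDarts]

/-- `J e` is the invariant of the arrays once the darts below `e` have been scanned. The body may
change registers from 22 on but not arrays 4 to 7, which are read again in each round. -/
theorem runs_forChildren {n D : ℕ} {src dst : ℕ → Fin n} {x y : Fin n} {body : Prog}
    (hb : body.loopFree) {s : Mem} (henv : Env D src dst s) (hx : s.reg 8 = x)
    (hy : s.reg 9 = y) (J : ℕ → (ℕ → ℕ → ℕ) → Prop)
    (hJ : ∀ e a, J e a → a 4 = s.arr 4 ∧ a 5 = s.arr 5 ∧ a 6 = s.arr 6 ∧ a 7 = s.arr 7)
    (h0 : J 0 s.arr)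
    (hskip : ∀ e a, J e a → e < D → e ∉ childDarts D src dst x y → J (e + 1) a)
    (hstep : ∀ e s', J e s'.arr → e ∈ childDarts D src dst x y →
      (∀ r < 21, s'.reg r = s.reg r) → s'.reg 21 = e →
      s'.reg 22 = bump (s.arr 6) (s.arr 7) (s.reg 10) e → s'.reg 23 = (src e : ℕ) →
      J (e + 1) (body.run s').arr ∧ ∀ r < 22, (body.run s').reg r = s'.reg r) :
    Runs (forChildren body) s (D * (body.cost + 13) + 2)
      fun s' => J D s'.arr ∧ ∀ r < 21, s'.reg r = s.reg r := by
  refine Runs.seq_run rfl (t₂ := D * (body.cost + 13) + 1) ?_ (by simp only [Prog.cost]; omega)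
  refine Runs.count (N := D) (t := body.cost + 12)
    (fun e s' => J e s'.arr ∧ s'.reg 21 = e ∧ ∀ r < 21, s'.reg r = s.reg r)
    (fun _ _ h => h.2.1) (fun _ s' h => by rw [h.2.2 2 (by omega), henv.r2]) ?_
    (fun s' h => ⟨h.1, h.2.2⟩) (i := 0) ?_ (Nat.zero_le _) le_rfl
  · rintro e s' ⟨hJe, he, hr⟩ heD
    obtain ⟨h4, h5, h6, h7⟩ := hJ e _ hJe
    refine Runs.of_run (by simp [childStep, Prog.loopFree, hb, Prog.skip])
      (by simp only [childStep, Prog.cost, Prog.skip]; omega) ?_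
    have hd := henv.dst e heD
    have hs := henv.src e heD
    have h8 := hr 8 (by omega)
    have h9 := hr 9 (by omega)
    have h10 := hr 10 (by omega)
    by_cases hex : dst e = x
    · by_cases hey : src e = y
      · have hne : e ∉ childDarts D src dst x y := by simp [mem_childDarts, hey]
        have := hskip e _ hJe heD hne
        simp [childStep, Prog.run, he, h4, h5, hd, hs, h8, hx, hex, h9, hy, hey, this]
        intro r hr'
        rw [if_neg (by omega), if_neg (by omega), if_neg (by omega), hr r hr']
      · have hmem : e ∈ childDarts D src dst x y := mem_childDarts.2 ⟨heD, hex, hey⟩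
        have hey' : (src e : ℕ) ≠ y := fun h => hey (Fin.ext h)
        suffices H : ∃ s₁ : Mem, (childStep body).run s' = (succ 21 21).run (body.run s₁) ∧
            s₁.arr = s'.arr ∧ (∀ r < 22, s₁.reg r = s'.reg r) ∧
            s₁.reg 22 = bump (s.arr 6) (s.arr 7) (s.reg 10) e ∧ s₁.reg 23 = src e by
          obtain ⟨s₁, h, ha, hr₁, h22, h23⟩ := H
          obtain ⟨k1, k2⟩ := hstep e s₁ (ha ▸ hJe) hmem
            (fun r hr' => by rw [hr₁ r (by omega), hr r hr'])
            (by rw [hr₁ 21 (by omega), he]) h22 h23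
          rw [h]
          simp only [Prog.run, Mem.setReg_arr, Mem.setReg_reg]
          refine ⟨k1, by rw [if_pos trivial, k2 21 (by omega), hr₁ 21 (by omega), he], fun r hr' => ?_⟩
          rw [if_neg (by omega), k2 r (by omega), hr₁ r (by omega), hr r hr']
        refine ⟨(load 24 5 21 ;; load 23 4 21 ;; load 22 6 21 ;; succ 24 22 ;;
          cond (.eq 24 10) (load 24 7 21 ;; cond (.eq 24 10) (copy 22 10) skip) skip).run s',
          ?_, ?_⟩
        · simp [childStep, Prog.run, he, h4, h5, hd, hs, h8, hx, hex, h9, hy, hey']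
        · simp only [Prog.run, bump]
          by_cases c1 : s.arr 6 e + 1 = s.reg 10
          · by_cases c2 : s.arr 7 e = s.reg 10
            · simp [he, h4, h5, h6, h7, hs, h10, c1, c2]
              intro r hr'
              simp (disch := omega) [if_neg]
            · simp [he, h4, h5, h6, h7, hs, h10, c1, c2]
              intro r hr'
              simp (disch := omega) [if_neg]
          · simp [he, h4, h5, h6, hs, h10, c1]
            intro r hr'
            simp (disch := omega) [if_neg]
    · have hne : e ∉ childDarts D src dst x y := by simp [mem_childDarts, hex]
      have hex' : (dst e : ℕ) ≠ x := fun h => hex (Fin.ext h)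
      have := hskip e _ hJe heD hne
      simp [childStep, Prog.run, he, h5, hd, h8, hx, hex', this]
      intro r hr'
      rw [if_neg (by omega), if_neg (by omega), hr r hr']
  · refine ⟨h0, by simp [Prog.run], fun r hr => ?_⟩
    simp only [Prog.run, Mem.setReg_reg]
    rw [if_neg (by omega)]

/-! ### Counting the children by label -/

def clearBuckets : Prog := const 21 0 ;; .loop (.lt 21 4) (store 11 21 3 ;; succ 21 21)

theorem runs_clearBuckets {n D : ℕ} {src dst : ℕ → Fin n} {s : Mem} (henv : Env D src dst s) :
    Runs clearBuckets s (3 * n + 5) fun s' =>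
      (∀ b ≤ n, s'.arr 11 b = 0) ∧ (∀ A < 11, s'.arr A = s.arr A) ∧
        ∀ r < 21, s'.reg r = s.reg r := by
  refine Runs.seq_run rfl (t₂ := (n + 1) * 3 + 1) ?_ (by simp only [Prog.cost]; omega)
  refine Runs.count (N := n + 1) (t := 2) (fun i s' => s'.reg 21 = i ∧
      (∀ b < i, s'.arr 11 b = 0) ∧ (∀ A < 11, s'.arr A = s.arr A) ∧
        ∀ r < 21, s'.reg r = s.reg r)
    (fun _ _ h => h.1) (fun _ s' h => by rw [h.2.2.2 4 (by omega), henv.r4]) ?_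
    (fun s' h => ⟨fun b hb => h.2.1 b (by omega), h.2.2⟩) (i := 0) ?_ (Nat.zero_le _) le_rfl
  · rintro i s' ⟨h1, h2, h3, h4⟩ hi
    refine Runs.of_run rfl le_rfl ?_
    have hz := h4 3 (by omega)
    rw [henv.r3] at hz
    refine ⟨by simp [Prog.run, h1], fun b hb => ?_, fun A hA => ?_, fun r hr => ?_⟩
    · simp only [Prog.run, Mem.setReg_arr, Mem.setArr_arr, if_true, h1, hz,
        Function.update_apply]
      split_ifs with h
      · rfl
      · exact h2 b (by omega)
    · simp (disch := omega) [Prog.run, if_neg, h3 A hA]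
    · simp (disch := omega) [Prog.run, if_neg, h4 r hr]
  · refine ⟨by simp [Prog.run], fun b hb => by omega, fun A _ => rfl, fun r hr => ?_⟩
    simp (disch := omega) [Prog.run, if_neg]

theorem card_filter_lt_succ (E : Finset ℕ) (lab : ℕ → ℕ) (e b : ℕ) :
    (E.filter fun e' => e' < e + 1 ∧ lab e' = b).card =
      (E.filter fun e' => e' < e ∧ lab e' = b).card + if e ∈ E ∧ lab e = b then 1 else 0 := by
  split_ifs with h
  · rw [← Finset.card_insert_of_notMem
      (a := e) (s := E.filter fun e' => e' < e ∧ lab e' = b) (by simp)]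
    congr 1
    ext e'
    simp only [Finset.mem_insert, Finset.mem_filter]
    constructor
    · rintro ⟨h1, h2, h3⟩
      rcases Nat.lt_or_ge e' e with hlt | hge
      · exact Or.inr ⟨h1, hlt, h3⟩
      · exact Or.inl (by omega)
    · rintro (rfl | ⟨h1, h2, h3⟩)
      · exact ⟨h.1, by omega, h.2⟩
      · exact ⟨h1, by omega, h3⟩
  · rw [Nat.add_zero]
    congr 1
    refine Finset.filter_congr fun e' he' => ?_
    constructor
    · rintro ⟨h1, h2⟩
      have : e' ≠ e := by rintro rfl; exact h ⟨he', h2⟩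
      exact ⟨by omega, h2⟩
    · rintro ⟨h1, h2⟩
      exact ⟨by omega, h2⟩

def fillBuckets : Prog := clearBuckets ;; forChildren (load 25 11 22 ;; succ 25 25 ;; store 11 22 25)

theorem runs_fillBuckets {n D : ℕ} {src dst : ℕ → Fin n} {x y : Fin n} {s : Mem}
    (henv : Env D src dst s) (hx : s.reg 8 = x) (hy : s.reg 9 = y) :
    Runs fillBuckets s (3 * n + 16 * D + 7) fun s' =>
      (∀ b ≤ n, s'.arr 11 b = ((childDarts D src dst x y).filter fun e =>
        bump (s.arr 6) (s.arr 7) (s.reg 10) e = b).card) ∧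
      (∀ A < 11, s'.arr A = s.arr A) ∧ ∀ r < 21, s'.reg r = s.reg r := by
  refine Runs.seq (runs_clearBuckets henv) (t₂ := 16 * D + 2) ?_ (by omega)
  rintro s₁ ⟨h1, h2, h3⟩
  have henv₁ : Env D src dst s₁ :=
    henv.congr (fun r hr => h3 r (by omega)) (h2 4 (by omega)) (h2 5 (by omega))
  set E := childDarts D src dst x y with hE
  set lab := bump (s.arr 6) (s.arr 7) (s.reg 10) with hlab
  refine (runs_forChildren (x := x) (y := y) rfl henv₁ (by rw [h3 8 (by omega), hx])
    (by rw [h3 9 (by omega), hy])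
    (fun e a => (∀ A < 11, a A = s.arr A) ∧
      ∀ b ≤ n, a 11 b = (E.filter fun e' => e' < e ∧ lab e' = b).card) ?_ ?_ ?_ ?_).mono
    (by simp only [Prog.cost]; omega) (Q := fun s' => _ ∧ _) ?_
  · rintro e a ⟨ha, -⟩
    refine ⟨?_, ?_, ?_, ?_⟩ <;> rw [ha _ (by omega), h2 _ (by omega)]
  · refine ⟨h2, fun b hb => ?_⟩
    rw [h1 b hb]
    simp
  · rintro e a ⟨ha, hb⟩ heD he
    refine ⟨ha, fun b hbn => ?_⟩
    rw [hb b hbn]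
    rw [card_filter_lt_succ, if_neg (fun h => he h.1), Nat.add_zero]
  · rintro e s' ⟨ha, hb⟩ he hr h21 h22 h23
    have hl : s'.reg 22 = lab e := by
      rw [h22, h2 6 (by omega), h2 7 (by omega), h3 10 (by omega)]
    refine ⟨⟨fun A hA => ?_, fun b hbn => ?_⟩, fun r hr => ?_⟩
    · simp (disch := omega) [Prog.run, if_neg, ha A hA]
    · simp only [Prog.run, Mem.setReg_arr, Mem.setArr_arr, Mem.setReg_reg, if_true, hl,
        Function.update_apply]
      simp only [Nat.reduceEqDiff, if_false]
      split_ifs with h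
      · rw [card_filter_lt_succ, if_pos ⟨he, h.symm⟩, ← h, hb _ hbn]
      · rw [card_filter_lt_succ, if_neg (fun h' => h h'.2.symm), hb b hbn, Nat.add_zero]
    · simp (disch := omega) [Prog.run, if_neg]
  · rintro s' ⟨⟨ha, hb⟩, hr⟩
    refine ⟨fun b hbn => ?_, ha, fun r hr' => by rw [hr r hr', h3 r hr']⟩
    rw [hb b hbn]
    congr 1
    refine Finset.filter_congr fun e' he' => ?_
    have := (mem_childDarts.1 he').1
    simp [this]

end TotTrans

namespace TotTrans
open Prog

/-! ### The sweep over the buckets -/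

/-- The current value becomes the upper end of this bucket and the lower end of the next. -/
def closeBucket : Prog := store 13 21 20 ;; succ 21 21 ;; store 12 21 20

/-- An element of bucket `a` serves for the value `z + 1` as long as `z < a`. Register 3 is zero, so
the first test asks whether the bucket has elements left. -/
def sweepStep : Prog :=
  load 22 11 21 ;;
  cond (.lt 3 22) (cond (.lt 20 21) (pred 22 22 ;; store 11 21 22 ;; succ 20 20) closeBucket)
    closeBucket

def sweep : Prog := const 21 0 ;; const 20 0 ;; store 12 3 3 ;; .loop (.lt 21 4) sweepStep

/-- Result of the sweep over the buckets `0, …, n` of the elements of `E` with labels `lab`: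
register 20 holds the greatest size of a system, bucket `b` receives the values
`arr 12 b + 1, …, arr 13 b`, and `arr 11 0` is the size of bucket zero. -/
structure Swept (n : ℕ) (E : Finset ℕ) (lab : ℕ → ℕ) (s : Mem) : Prop where
  le : ∀ i, s.reg 20 ≤ i + (E.filter fun e => i < lab e).card
  ge : ∃ i, i + (E.filter fun e => i < lab e).card ≤ s.reg 20
  zero : s.arr 11 0 = (E.filter fun e => lab e = 0).card
  cover : ∀ p, 1 ≤ p → p ≤ s.reg 20 → ∃ b ≤ n, s.arr 12 b < p ∧ p ≤ s.arr 13 b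
  bucket : ∀ b ≤ n, s.arr 13 b ≤ b ∧ s.arr 12 b ≤ s.arr 13 b ∧
    s.arr 13 b ≤ s.arr 12 b + (E.filter fun e => lab e = b).card

theorem card_filter_lt_eq (E : Finset ℕ) (lab : ℕ → ℕ) (a : ℕ) :
    (E.filter fun e => a < lab e).card =
      (E.filter fun e => lab e = a + 1).card + (E.filter fun e => a + 1 < lab e).card := by
  rw [← Finset.card_union_of_disjoint]
  · congr 1
    ext e
    simp only [Finset.mem_union, Finset.mem_filter]
    constructor
    · rintro ⟨h, h'⟩
      rcases Nat.lt_or_ge (a + 1) (lab e) with h1 | h1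
      · exact Or.inr ⟨h, h1⟩
      · exact Or.inl ⟨h, by omega⟩
    · rintro (⟨h, h'⟩ | ⟨h, h'⟩) <;> exact ⟨h, by omega⟩
  · rw [Finset.disjoint_left]
    intro e he he'
    simp only [Finset.mem_filter] at he he'
    omega

/-- Invariant of the sweep, in bucket `a` with current value `z` and `r` elements left in the
bucket; `C` and `H` are the sizes of the buckets and of their upper unions. -/
structure SweepInv (n : ℕ) (C H : ℕ → ℕ) (a z r : ℕ) (cnt lo hi : ℕ → ℕ) : Prop where
  a_le : a ≤ n + 1
  z_le : z ≤ a
  r_eq : a ≤ n → cnt a = r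
  zr : z + r = lo a + C a
  lo_le : lo a ≤ z
  cnt_eq : ∀ b, a < b → b ≤ n → cnt b = C b
  zero : cnt 0 = C 0
  -- With `ge`: for `a > 0`, `z` plus the number of elements still to come is the minimum of `i + H
  -- i` over `i < a`. At the end nothing is to come, and `z` is the minimum over all `i`.
  le : ∀ i < a, z + (H a + r) ≤ i + H i
  ge : a = 0 ∨ ∃ i < a, i + H i ≤ z + (H a + r)
  cover : ∀ p, 1 ≤ p → p ≤ lo a → ∃ b < a, lo b < p ∧ p ≤ hi b
  bucket : ∀ b < a, hi b ≤ b ∧ lo b ≤ hi b ∧ hi b ≤ lo b + C b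

/-- One element is traded for one unit of `z`, so `z + (H a + r)` is unchanged. -/
theorem SweepInv.take {n : ℕ} {C H : ℕ → ℕ} {a z r : ℕ} {cnt lo hi : ℕ → ℕ}
    (h : SweepInv n C H a z r cnt lo hi) (hr : 0 < r) (hz : z < a) :
    SweepInv n C H a (z + 1) (r - 1) (Function.update cnt a (r - 1)) lo hi where
  a_le := h.a_le
  z_le := hz
  r_eq _ := by simp
  zr := by have := h.zr; omega
  lo_le := by have := h.lo_le; omega
  cnt_eq b hb hb' := by
    rw [Function.update_of_ne (by omega), h.cnt_eq b hb hb']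
  zero := by rw [Function.update_of_ne (by omega), h.zero]
  le i hi := by have := h.le i hi; omega
  ge := by
    rcases h.ge with h' | ⟨i, hi, h'⟩
    · omega
    · exact Or.inr ⟨i, hi, by omega⟩
  cover := h.cover
  bucket := h.bucket

/-- Closing an exhausted bucket keeps the sum, and the new bound at `i = a` is `z ≤ a`. Closing at
`z = a` discards the `r` elements left, and the minimum is then attained at `i = a`. -/
theorem SweepInv.close {n : ℕ} {C H : ℕ → ℕ} {a z r : ℕ} {cnt lo hi : ℕ → ℕ}
    (hH : ∀ a, H a = C (a + 1) + H (a + 1)) (h : SweepInv n C H a z r cnt lo hi) (ha : a ≤ n)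
    (hr : r = 0 ∨ z = a) :
    SweepInv n C H (a + 1) z (C (a + 1)) cnt (Function.update lo (a + 1) z)
      (Function.update hi a z) := by
  have hHa := hH a
  have hzr := h.zr
  have hlz := h.lo_le
  have hza := h.z_le
  refine ⟨by omega, by omega, fun h' => h.cnt_eq _ (by omega) h', by simp, by simp,
    fun b hb hb' => h.cnt_eq b (by omega) hb', h.zero, fun i hi => ?_, Or.inr ?_,
    fun p hp hp' => ?_, fun b hb => ?_⟩
  · rcases Nat.lt_or_ge i a with hia | hia
    · have := h.le i hia
      omega
    · have : i = a := by omega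
      subst this
      omega
  · rcases hr with rfl | rfl
    · rcases h.ge with rfl | ⟨i, hi, h'⟩
      · exact ⟨0, by omega, by omega⟩
      · exact ⟨i, by omega, by omega⟩
    · exact ⟨z, by omega, by omega⟩
  · rw [Function.update_self] at hp'
    rcases Nat.lt_or_ge (lo a) p with h1 | h1
    · refine ⟨a, by omega, ?_, ?_⟩
      · rwa [Function.update_of_ne (by omega)]
      · rwa [Function.update_self]
    · obtain ⟨b, hb, h2, h3⟩ := h.cover p hp h1
      refine ⟨b, by omega, ?_, ?_⟩
      · rwa [Function.update_of_ne (by omega)]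
      · rwa [Function.update_of_ne (by omega)]
  · rw [Function.update_of_ne (by omega : b ≠ a + 1)]
    rcases Nat.lt_or_ge b a with h1 | h1
    · rw [Function.update_of_ne (by omega)]
      exact h.bucket b h1
    · have : b = a := by omega
      subst this
      rw [Function.update_self]
      omega

theorem runs_sweep {n D : ℕ} {src dst : ℕ → Fin n} {s : Mem} (henv : Env D src dst s)
    {E : Finset ℕ} {lab : ℕ → ℕ} (hlab : ∀ e ∈ E, lab e ≤ n)
    (hcnt : ∀ b ≤ n, s.arr 11 b = (E.filter fun e => lab e = b).card) :
    Runs sweep s (14 * n + 18) fun s' => Swept n E lab s' ∧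
      (∀ A < 11, s'.arr A = s.arr A) ∧ ∀ r < 20, s'.reg r = s.reg r := by
  set C : ℕ → ℕ := fun b => (E.filter fun e => lab e = b).card with hC
  set H : ℕ → ℕ := fun b => (E.filter fun e => b < lab e).card with hHdef
  have hH : ∀ a, H a = C (a + 1) + H (a + 1) := card_filter_lt_eq E lab
  have hHn : ∀ a, n ≤ a → H a = 0 := fun a ha => by
    simp only [hHdef, Finset.card_eq_zero, Finset.filter_eq_empty_iff]
    intro e he
    have := hlab e he
    omega
  refine Runs.seq_run rfl (t₂ := 14 * n + 17) ?_ (by simp only [Prog.cost]; omega)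
  refine Runs.seq_run rfl (t₂ := 14 * n + 16) ?_ (by simp only [Prog.cost]; omega)
  refine Runs.seq_run rfl (t₂ := 14 * n + 15) ?_ (by simp only [Prog.cost]; omega)
  -- Every round raises the bucket number or `z` by one, and both are at most `n` when a round
  -- begins.
  refine Runs.loop (t := 6) (k := 2 * n + 2) (fun k s' => ∃ r,
    SweepInv n C H (s'.reg 21) (s'.reg 20) r (s'.arr 11) (s'.arr 12) (s'.arr 13) ∧
      k + s'.reg 21 + s'.reg 20 = 2 * n + 2 ∧
      (∀ A < 11, s'.arr A = s.arr A) ∧ ∀ r < 20, s'.reg r = s.reg r) ?_ ?_ ?_ (by omega)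
  · rintro k s' ⟨r, hI, hk, ha, hr⟩ hb
    have h3 := hr 3 (by omega)
    have h4 := hr 4 (by omega)
    rw [henv.r3] at h3
    rw [henv.r4] at h4
    rw [Test.holds_lt, h4] at hb
    have hra := hI.r_eq (by omega)
    refine Runs.of_run rfl le_rfl ?_
    by_cases c : 0 < r ∧ s'.reg 20 < s'.reg 21
    · refine ⟨k - 1, by omega, r - 1, ?_⟩
      have := hI.take c.1 c.2
      have hs : sweepStep.run s' = (((s'.setReg 22 r).setReg 22 (r - 1)).setArr 11 (s'.reg 21)
          (r - 1)).setReg 20 (s'.reg 20 + 1) := by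
        simp [sweepStep, Prog.run, hra, h3, c.1, c.2]
      rw [hs]
      refine ⟨by simpa using this, by simp; omega, fun A hA => ?_, fun i hi => ?_⟩
      · simp (disch := omega) [if_neg, ha A hA]
      · simp (disch := omega) [if_neg, hr i hi]
    · have hz := hI.z_le
      have := hI.close hH (by omega) (by omega)
      refine ⟨k - 1, by omega, C (s'.reg 21 + 1), ?_⟩
      have hs : sweepStep.run s' = closeBucket.run (s'.setReg 22 r) := by
        by_cases c1 : 0 < r
        · have c2 : ¬ s'.reg 20 < s'.reg 21 := fun h => c ⟨c1, h⟩
          simp [sweepStep, Prog.run, hra, h3, c1, c2]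
        · simp [sweepStep, Prog.run, hra, h3, c1]
      rw [hs]
      refine ⟨by simpa [closeBucket, Prog.run] using this,
        by simp [closeBucket, Prog.run]; omega, fun A hA => ?_, fun i hi => ?_⟩
      · simp (disch := omega) [closeBucket, Prog.run, if_neg, ha A hA]
      · simp (disch := omega) [closeBucket, Prog.run, if_neg, hr i hi]
  · rintro k s' ⟨r, hI, hk, ha, hr⟩ hb
    have h4 := hr 4 (by omega)
    rw [henv.r4] at h4
    rw [Test.holds_lt, h4] at hb
    have hI1 := hI.a_le
    have han : s'.reg 21 = n + 1 := by omega
    rw [han] at hI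
    -- No label exceeds `n`, so the bucket entered when the loop stops is empty.
    have hC0 : C (n + 1) = 0 := by
      have h1 := hH n
      have h2 := hHn n le_rfl
      omega
    have hzr := hI.zr
    have hlo := hI.lo_le
    have hn := hI.le n (by omega)
    have hHn' := hHn n le_rfl
    have hHn1 := hHn (n + 1) (by omega)
    refine ⟨⟨fun i => ?_, ?_, hI.zero, fun p hp hp' => ?_, fun b hb => ?_⟩, ha, hr⟩
    · rcases Nat.lt_or_ge i (n + 1) with hi | hi
      · have := hI.le i hi
        simp only [hHdef] at this
        omega
      · omega
    · rcases hI.ge with h | ⟨i, hi, h⟩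
      · omega
      · refine ⟨i, ?_⟩
        simp only [hHdef] at h hHn1
        omega
    · obtain ⟨b, hb, h⟩ := hI.cover p hp (by omega)
      exact ⟨b, by omega, h⟩
    · exact hI.bucket b (by omega)
  · refine ⟨C 0, ?_, by simp [Prog.run], fun A hA => ?_, fun r hr => ?_⟩
    · have h3 := henv.r3
      simp only [Prog.run, Mem.setReg_reg, Mem.setArr_reg, Mem.setReg_arr, Mem.setArr_arr]
      simp only [Nat.reduceEqDiff, if_true, if_false, h3]
      exact ⟨by omega, le_rfl, fun _ => hcnt 0 (by omega), by simp, by simp,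
        fun b hb hb' => hcnt b hb', hcnt 0 (by omega), fun i hi => by omega, Or.inl rfl,
        fun p hp hp' => by simp at hp'; omega, fun b hb => by omega⟩
    · simp (disch := omega) [Prog.run, if_neg]
    · simp (disch := omega) [Prog.run, if_neg]

def fillSweep : Prog := fillBuckets ;; sweep

theorem runs_fillSweep {n D : ℕ} {src dst : ℕ → Fin n} {x y : Fin n} {s : Mem}
    (henv : Env D src dst s) (hx : s.reg 8 = x) (hy : s.reg 9 = y)
    (hlab : ∀ e ∈ childDarts D src dst x y, bump (s.arr 6) (s.arr 7) (s.reg 10) e ≤ n) :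
    Runs fillSweep s (17 * n + 16 * D + 25) fun s' =>
      Swept n (childDarts D src dst x y) (bump (s.arr 6) (s.arr 7) (s.reg 10)) s' ∧
      (∀ A < 11, s'.arr A = s.arr A) ∧ ∀ r < 20, s'.reg r = s.reg r := by
  refine Runs.seq (runs_fillBuckets henv hx hy) (t₂ := 14 * n + 18) ?_ (by omega)
  rintro s₁ ⟨h1, h2, h3⟩
  have henv₁ : Env D src dst s₁ :=
    henv.congr (fun r hr => h3 r (by omega)) (h2 4 (by omega)) (h2 5 (by omega))
  refine (runs_sweep henv₁ hlab h1).mono le_rfl ?_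
  rintro s' ⟨k1, k2, k3⟩
  exact ⟨k1, fun A hA => by rw [k2 A hA, h2 A hA], fun r hr => by rw [k3 r hr, h3 r (by omega)]⟩

end TotTrans

namespace TotTrans
open Prog

/-! ### Computing the labels of one dart -/

section Compute

variable {n D : ℕ} {T : SimpleGraph (Fin n)} {src dst : ℕ → Fin n} {x y : Fin n}

/-- Arrays 6 and 7 hold the correct labels of the dart `e`. -/
def LabelOk (T : SimpleGraph (Fin n)) (src dst : ℕ → Fin n) (s : Mem) (e : ℕ) : Prop :=
  s.arr 6 e = rttr T (dst e) (src e) ∧ s.arr 7 e = rmttr T (dst e) (src e)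

theorem IsDartList.injOn_src (hd : IsDartList T D src dst) (x y : Fin n) :
    Set.InjOn src (childDarts D src dst x y) := by
  intro e he e' he' h
  rw [Finset.mem_coe, mem_childDarts] at he he'
  exact hd.inj e he.1 e' he'.1 h (he.2.1.trans he'.2.1.symm)

theorem IsDartList.image_src (hd : IsDartList T D src dst) (x y : Fin n) :
    src '' (childDarts D src dst x y) = {w | T.Adj x w ∧ w ≠ y} := by
  ext w
  constructor
  · rintro ⟨e, he, rfl⟩
    rw [Finset.mem_coe, mem_childDarts] at he
    exact ⟨he.2.1 ▸ (hd.adj e he.1).symm, he.2.2⟩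
  · rintro ⟨h1, h2⟩
    obtain ⟨e, he, rfl, h⟩ := hd.exists_dart w x h1.symm
    exact ⟨e, by rw [Finset.mem_coe, mem_childDarts]; exact ⟨he, h, h2⟩, rfl⟩

theorem bump_le_of_labelOk (hT : T.IsTree) {s : Mem} {e : ℕ} (h : LabelOk T src dst s e) (F : ℕ) :
    bump (s.arr 6) (s.arr 7) F e ≤ n := by
  have h1 := rmttr_le_card hT (dst e) (src e)
  have h2 := rttr_le_rmttr hT (dst e) (src e)
  rw [← h.1, ← h.2] at h2
  rw [← h.2, Nat.card_fin] at h1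
  unfold bump
  split_ifs <;> omega

/-- Write registers 12 and 13 as labels of the dart from register 8 to register 9. -/
def writeLabels : Prog :=
  const 21 0 ;;
  .loop (.lt 21 2)
    (load 22 4 21 ;;
      cond (.eq 22 8)
        (load 22 5 21 ;; cond (.eq 22 9) (store 6 21 12 ;; store 7 21 13) skip) skip ;;
      succ 21 21)

/-- The position of the dart is unknown and is found by a scan. Each value written is the correct
label of its dart, so labels that were correct remain so. -/
theorem runs_writeLabels {s : Mem} (henv : Env D src dst s) (hx : s.reg 8 = x)
    (hy : s.reg 9 = y) (h12 : s.reg 12 = rttr T y x) (h13 : s.reg 13 = rmttr T y x) :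
    Runs writeLabels s (8 * D + 2) fun s' =>
      (∀ e < D, src e = x → dst e = y → LabelOk T src dst s' e) ∧
      (∀ e, LabelOk T src dst s e → LabelOk T src dst s' e) ∧
      (∀ A, A ≠ 6 → A ≠ 7 → s'.arr A = s.arr A) ∧ ∀ r < 20, s'.reg r = s.reg r := by
  refine Runs.seq_run rfl (t₂ := D * 8 + 1) ?_ (by simp only [Prog.cost]; omega)
  refine Runs.count (N := D) (t := 7) (fun i s' => s'.reg 21 = i ∧
      (∀ e < i, e < D → src e = x → dst e = y → LabelOk T src dst s' e) ∧
      (∀ e, LabelOk T src dst s e → LabelOk T src dst s' e) ∧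
      (∀ A, A ≠ 6 → A ≠ 7 → s'.arr A = s.arr A) ∧ ∀ r < 20, s'.reg r = s.reg r)
    (fun _ _ h => h.1) (fun _ s' h => by rw [h.2.2.2.2 2 (by omega), henv.r2]) ?_
    (fun s' h => ⟨fun e he => h.2.1 e he he, h.2.2⟩) (i := 0) ?_ (Nat.zero_le _) le_rfl
  · rintro i s' ⟨h1, h2, h3, h4, h5⟩ hi
    refine Runs.of_run rfl le_rfl ?_
    have hs := henv.src i hi
    have hd := henv.dst i hi
    rw [← h4 4 (by omega) (by omega)] at hs
    rw [← h4 5 (by omega) (by omega)] at hd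
    have e8 := h5 8 (by omega)
    have e9 := h5 9 (by omega)
    have e12 := h5 12 (by omega)
    have e13 := h5 13 (by omega)
    rw [hx] at e8
    rw [hy] at e9
    rw [h12] at e12
    rw [h13] at e13
    by_cases c : src i = x ∧ dst i = y
    · have hrun : (load 22 4 21 ;;
      cond (.eq 22 8)
        (load 22 5 21 ;; cond (.eq 22 9) (store 6 21 12 ;; store 7 21 13) skip) skip ;;
      succ 21 21).run s' = ((((s'.setReg 22 x).setReg 22 y).setArr 6 i (rttr T y x)).setArr 7 i
          (rmttr T y x)).setReg 21 (i + 1) := by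
        simp [Prog.run, h1, hs, hd, e8, e9, e12, e13, c.1, c.2]
      rw [hrun]
      have hok : ∀ e, LabelOk T src dst s' e ∨ e = i → LabelOk T src dst
          (((((s'.setReg 22 x).setReg 22 y).setArr 6 i (rttr T y x)).setArr 7 i
          (rmttr T y x)).setReg 21 (i + 1)) e := by
        intro e he
        by_cases hei : e = i
        · subst hei
          simp [LabelOk, c.1, c.2]
        · have := he.resolve_right hei
          simpa [LabelOk, Function.update_of_ne hei] using this
      refine ⟨by simp, fun e he heD hex hey => hok e ?_, fun e he => hok e (Or.inl (h3 e he)),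
        fun A hA hA' => ?_, fun r hr => ?_⟩
      · rcases Nat.lt_or_ge e i with h | h
        · exact Or.inl (h2 e h heD hex hey)
        · exact Or.inr (by omega)
      · simp [hA, hA', h4 A hA hA']
      · simp (disch := omega) [if_neg, h5 r hr]
    · have hrun : ∃ a, (load 22 4 21 ;;
      cond (.eq 22 8)
        (load 22 5 21 ;; cond (.eq 22 9) (store 6 21 12 ;; store 7 21 13) skip) skip ;;
      succ 21 21).run s' = ((s'.setReg 22 (src i)).setReg 22 a).setReg 21 (i + 1) := by
        by_cases c1 : src i = x
        · have c2 : (dst i : ℕ) ≠ y := fun h => c ⟨c1, Fin.ext h⟩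
          exact ⟨dst i, by simp [Prog.run, h1, hs, hd, e8, e9, c1, c2]⟩
        · have c2 : (src i : ℕ) ≠ x := fun h => c1 (Fin.ext h)
          exact ⟨src i, by simp [Prog.run, h1, hs, e8, c2]; simp [Mem.setReg]⟩
      obtain ⟨a, hrun⟩ := hrun
      rw [hrun]
      refine ⟨by simp, fun e he heD hex hey => ?_, h3, h4, fun r hr => ?_⟩
      · have : e ≠ i := by rintro rfl; exact c ⟨hex, hey⟩
        exact h2 e (by omega) heD hex hey
      · simp (disch := omega) [if_neg, h5 r hr]
  · refine ⟨by simp [Prog.run], fun e he => by omega, fun e he => he, fun A _ _ => rfl,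
      fun r hr => ?_⟩
    simp (disch := omega) [Prog.run, if_neg]

/-- Compute in registers 12 and 13 the labels of the vertex in register 8 with parent in
register 9, and store them. -/
def compute : Prog :=
  const 10 0 ;; fillSweep ;;
  (load 21 11 3 ;; cond (.lt 3 21) (const 20 0) skip ;; succ 13 20 ;; copy 10 13) ;;
  fillSweep ;;
  (copy 12 20 ;; cond (.lt 13 12) (copy 12 13) skip) ;;
  writeLabels

/-- Two sweeps: the one without bumping yields `rmttr`, which is `z + 1`, or 1 if there is a leaf
child; the one bumped at this value yields `z'`, and `rttr` is the minimum of the two. -/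
theorem runs_compute (hT : T.IsTree) (hd : IsDartList T D src dst) (hxy : y = x ∨ T.Adj y x)
    {s : Mem} (henv : Env D src dst s) (hx : s.reg 8 = x) (hy : s.reg 9 = y)
    (hok : ∀ e ∈ childDarts D src dst x y, LabelOk T src dst s e) :
    Runs compute s (34 * n + 40 * D + 61) fun s' => s'.reg 12 = rttr T y x ∧
      (∀ e < D, src e = x → dst e = y → LabelOk T src dst s' e) ∧
      (∀ e, LabelOk T src dst s e → LabelOk T src dst s' e) ∧
      (∀ A < 11, A ≠ 6 → A ≠ 7 → s'.arr A = s.arr A) ∧ ∀ r < 10, s'.reg r = s.reg r := by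
  refine Runs.seq_run rfl (t₂ := 34 * n + 40 * D + 60) ?_ (by simp only [Prog.cost]; omega)
  set s₁ := (const 10 0).run s with hs₁
  have hr₁ : ∀ r, r ≠ 10 → s₁.reg r = s.reg r := fun r hr => by simp [hs₁, Prog.run, hr]
  have h10 : s₁.reg 10 = 0 := by simp [hs₁, Prog.run]
  have ha₁ : s₁.arr = s.arr := rfl
  have henv₁ : Env D src dst s₁ := henv.congr (fun r hr => hr₁ r (by omega)) rfl rfl
  -- The value 0 in register 10 switches bumping off, since `t + 1 = 0` never holds.
  have hb0 : bump (s.arr 6) (s.arr 7) 0 = s.arr 6 := by ext e; simp [bump]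
  have hx₁ : s₁.reg 8 = x := by rw [hr₁ 8 (by omega), hx]
  have hy₁ : s₁.reg 9 = y := by rw [hr₁ 9 (by omega), hy]
  refine Runs.seq (runs_fillSweep henv₁ hx₁ hy₁
    fun e he => bump_le_of_labelOk hT (hok e he) _) (t₂ := 17 * n + 24 * D + 35) ?_ (by omega)
  rintro s₂ ⟨hsw₂, ha₂, hr₂⟩
  rw [h10, ha₁, hb0] at hsw₂
  rw [ha₁] at ha₂
  set E := childDarts D src dst x y with hE
  refine Runs.seq_run rfl (t₂ := 17 * n + 24 * D + 30) ?_ (by simp [Prog.cost, skip]; omega)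
  -- Bucket 0 holds the leaf children; the sweep takes nothing from it, as `z < 0` fails.
  set a := s₂.arr 11 0 with ha
  set z := s₂.reg 20 with hz
  set q := if 0 < a then 1 else z + 1 with hq
  have h3₂ : s₂.reg 3 = 0 := by rw [hr₂ 3 (by omega)]; exact henv₁.r3
  set s₃ := (load 21 11 3 ;; cond (.lt 3 21) (const 20 0) skip ;; succ 13 20 ;; copy 10 13).run s₂
    with hs₃
  have hs₃' : s₃.arr = s₂.arr ∧ s₃.reg 10 = q ∧ s₃.reg 13 = q ∧
      ∀ r < 20, r ≠ 10 → r ≠ 13 → s₃.reg r = s₂.reg r := by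
    by_cases c : 0 < a
    · simp only [hs₃, Prog.run, hq, if_pos c]
      simp [h3₂, ← ha, c]
      intro r hr h1 h2
      simp (disch := omega) [if_neg]
    · simp only [hs₃, Prog.run, hq, if_neg c]
      simp [h3₂, ← ha, c]
      refine ⟨hz.symm, fun r hr h1 h2 => ?_⟩
      simp (disch := omega) [if_neg]
  clear_value s₃
  obtain ⟨ha₃, h10₃, h13₃, hr₃⟩ := hs₃'
  have hr₃' : ∀ r < 20, r ≠ 10 → r ≠ 13 → s₃.reg r = s.reg r := fun r hr h1 h2 => by
    rw [hr₃ r hr h1 h2, hr₂ r hr, hr₁ r h1]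
  have ha₃' : ∀ A < 11, s₃.arr A = s.arr A := fun A hA => by rw [ha₃, ha₂ A hA]
  have henv₃ : Env D src dst s₃ := henv.congr
    (fun r hr => hr₃' r (by omega) (by omega) (by omega)) (ha₃' 4 (by omega)) (ha₃' 5 (by omega))
  refine Runs.seq (runs_fillSweep (x := x) (y := y) henv₃
    (by rw [hr₃' 8 (by omega) (by omega) (by omega), hx])
    (by rw [hr₃' 9 (by omega) (by omega) (by omega), hy])
    fun e he => by
      rw [ha₃' 6 (by omega), ha₃' 7 (by omega)]
      exact bump_le_of_labelOk hT (hok e he) _) (t₂ := 8 * D + 5) ?_ (by omega)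
  rintro s₄ ⟨hsw₄, ha₄, hr₄⟩
  rw [ha₃' 6 (by omega), ha₃' 7 (by omega), h10₃] at hsw₄
  have hmain := labels_eq_of_count hT hxy (E := E) (s := src) (hd.injOn_src x y) (hd.image_src x y)
    (t := s.arr 6) (m := s.arr 7) (a := a) (z := z) (z' := s₄.reg 20) (q := q)
    (fun e he => by rw [(hok e he).1, (mem_childDarts.1 he).2.1])
    (fun e he => by rw [(hok e he).2, (mem_childDarts.1 he).2.1])
    (by
      rw [ha, hsw₂.zero, Finset.card_pos]
      simp [Finset.Nonempty])
    (fun i _ => hsw₂.le i) (fun _ => hsw₂.ge) hq hsw₄.le hsw₄.ge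
  refine Runs.seq_run rfl (t₂ := 8 * D + 2) ?_ (by simp [Prog.cost, skip]; omega)
  set s₅ := (copy 12 20 ;; cond (.lt 13 12) (copy 12 13) skip).run s₄ with hs₅
  have h13₄ : s₄.reg 13 = q := by rw [hr₄ 13 (by omega), h13₃]
  have hs₅' : s₅.arr = s₄.arr ∧ s₅.reg 12 = min q (s₄.reg 20) ∧ s₅.reg 13 = q ∧
      ∀ r < 20, r ≠ 12 → s₅.reg r = s₄.reg r := by
    by_cases c : q < s₄.reg 20
    · simp only [hs₅, Prog.run]
      simp [h13₄, c, c.le]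
      intro r hr h1
      simp [h1]
    · simp only [hs₅, Prog.run]
      simp [h13₄, c, Nat.le_of_not_lt c]
      intro r hr h1
      simp [h1]
  clear_value s₅
  obtain ⟨ha₅, h12₅, h13₅, hr₅⟩ := hs₅'
  have hr₅' : ∀ r < 10, s₅.reg r = s.reg r := fun r hr => by
    rw [hr₅ r (by omega) (by omega), hr₄ r (by omega), hr₃' r (by omega) (by omega) (by omega)]
  have ha₅' : ∀ A < 11, s₅.arr A = s.arr A := fun A hA => by rw [ha₅, ha₄ A hA, ha₃' A hA]
  have henv₅ : Env D src dst s₅ := henv.congr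
    (fun r hr => hr₅' r (by omega)) (ha₅' 4 (by omega)) (ha₅' 5 (by omega))
  refine (runs_writeLabels (x := x) (y := y) (T := T) henv₅ (by rw [hr₅' 8 (by omega), hx])
    (by rw [hr₅' 9 (by omega), hy]) (by rw [h12₅, hmain.1]) (by rw [h13₅, hmain.2])).mono le_rfl ?_
  rintro s' ⟨k1, k2, k3, k4⟩
  refine ⟨by rw [k4 12 (by omega), h12₅, hmain.1], k1, fun e he => k2 e ?_,
    fun A hA h6 h7 => by rw [k3 A h6 h7, ha₅' A hA], fun r hr => by
      rw [k4 r (by omega), hr₅' r hr]⟩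
  simpa only [LabelOk, ha₅' 6 (by omega), ha₅' 7 (by omega)] using he

end Compute
end TotTrans

namespace TotTrans
open Prog

/-! ### Breadth-first search -/

section Bfs

variable {n D : ℕ} {T : SimpleGraph (Fin n)} {src dst : ℕ → Fin n} {root : Fin n}

/-- `ord 0, …, ord (k - 1)` are distinct vertices, beginning with the root, each of them but the
root being adjacent to its parent, which comes earlier. -/
structure SearchOrder (T : SimpleGraph (Fin n)) (root : Fin n) (k : ℕ) (ord : ℕ → Fin n)
    (par : Fin n → Fin n) : Prop where
  pos : 0 < k
  ord_zero : ord 0 = root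
  par_root : par root = root
  inj : ∀ i < k, ∀ j < k, ord i = ord j → i = j
  par : ∀ j < k, 0 < j → ∃ i < j, ord i = par (ord j) ∧ T.Adj (ord i) (ord j)

theorem SearchOrder.extend {k : ℕ} {ord : ℕ → Fin n} {par : Fin n → Fin n}
    (h : SearchOrder T root k ord par) {i : ℕ} (hi : i < k) {w : Fin n} (hw : T.Adj (ord i) w)
    (hnew : ∀ j < k, ord j ≠ w) :
    SearchOrder T root (k + 1) (Function.update ord k w) (Function.update par w (ord i)) where
  pos := by omega
  ord_zero := by rw [Function.update_of_ne (by have := h.pos; omega), h.ord_zero]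
  par_root := by
    rw [Function.update_of_ne, h.par_root]
    rw [← h.ord_zero]
    exact hnew 0 h.pos
  inj a ha b hb hab := by
    simp only [Function.update_apply] at hab
    split_ifs at hab with h1 h2 h2
    · omega
    · exact absurd hab.symm (hnew b (by omega))
    · exact absurd hab (hnew a (by omega))
    · exact h.inj a (by omega) b (by omega) hab
  par j hj hj0 := by
    by_cases hjk : j = k
    · subst hjk
      exact ⟨i, hi, by simp [Function.update_of_ne hi.ne], by
        simpa [Function.update_of_ne hi.ne] using hw⟩
    · obtain ⟨a, ha, h1, h2⟩ := h.par j (by omega) hj0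
      refine ⟨a, ha, ?_, ?_⟩
      · rw [Function.update_of_ne (by omega), Function.update_of_ne hjk,
          Function.update_of_ne (hnew j (by omega)), h1]
      · rwa [Function.update_of_ne (by omega), Function.update_of_ne hjk]

theorem SearchOrder.le {k : ℕ} {ord : ℕ → Fin n} {par : Fin n → Fin n}
    (h : SearchOrder T root k ord par) : k ≤ n := by
  have : Function.Injective fun i : Fin k => ord i := fun a b hab =>
    Fin.ext (h.inj a a.2 b b.2 hab)
  simpa using Fintype.card_le_of_injective _ this

theorem SearchOrder.eq_of_closed {k : ℕ} {ord : ℕ → Fin n} {par : Fin n → Fin n}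
    (h : SearchOrder T root k ord par) (hT : T.Connected)
    (hcl : ∀ j < k, ∀ w, T.Adj (ord j) w → ∃ i < k, ord i = w) : k = n := by
  have hall : ∀ v, ∃ i < k, ord i = v := by
    intro v
    obtain ⟨p⟩ := hT.preconnected v root
    induction p with
    | nil => exact ⟨0, h.pos, h.ord_zero⟩
    | cons hadj p ih =>
      obtain ⟨i, hi, hiv⟩ := ih h
      rw [← hiv] at hadj
      exact hcl i hi _ hadj.symm
  refine le_antisymm h.le ?_
  have : Function.Surjective fun i : Fin k => ord i := fun v => by
    obtain ⟨i, hi, h⟩ := hall v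
    exact ⟨⟨i, hi⟩, h⟩
  simpa using Fintype.card_le_of_surjective _ this

section Complete

variable {ord : ℕ → Fin n} {par : Fin n → Fin n}

theorem SearchOrder.exists_ord (h : SearchOrder T root n ord par) (v : Fin n) :
    ∃ i < n, ord i = v := by
  have hinj : Function.Injective fun i : Fin n => ord i := fun a b hab =>
    Fin.ext (h.inj a a.2 b b.2 hab)
  obtain ⟨i, hi⟩ := Finite.injective_iff_surjective.1 hinj v
  exact ⟨i, i.2, hi⟩

/-- The edges to parents form a connected spanning subgraph, and a tree is minimal among its
connected spanning subgraphs, so there is no other edge. -/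
theorem SearchOrder.par_or_par (h : SearchOrder T root n ord par) (hT : T.IsTree) {u v : Fin n}
    (hadj : T.Adj u v) : par v = u ∨ par u = v := by
  set H : SimpleGraph (Fin n) := SimpleGraph.fromRel fun a b => par b = a with hH
  have key : ∀ a b : Fin n, a ≠ b → par b = a → T.Adj a b := by
    rintro a b hab rfl
    obtain ⟨j, hj, rfl⟩ := h.exists_ord b
    rcases Nat.eq_zero_or_pos j with rfl | hj0
    · rw [h.ord_zero, h.par_root] at hab
      exact absurd rfl hab
    · obtain ⟨i, -, h1, h2⟩ := h.par j hj hj0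
      rwa [h1] at h2
  have hle : H ≤ T := by
    intro a b hab
    rw [hH, SimpleGraph.fromRel_adj] at hab
    rcases hab.2 with h1 | h1
    · exact key a b hab.1 h1
    · exact (key b a hab.1.symm h1).symm
  have hreach : ∀ j, j < n → H.Reachable root (ord j) := by
    intro j
    induction j using Nat.strong_induction_on with
    | _ j ih =>
      intro hj
      rcases Nat.eq_zero_or_pos j with rfl | hj0
      · rw [h.ord_zero]
      · obtain ⟨i, hi, h1, h2⟩ := h.par j hj hj0
        refine (ih i hi (by omega)).trans (SimpleGraph.Adj.reachable ?_)
        rw [hH, SimpleGraph.fromRel_adj]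
        exact ⟨h2.ne, Or.inl h1.symm⟩
  have hconn : H.Connected := by
    have : Nonempty (Fin n) := ⟨root⟩
    refine ⟨fun a b => ?_⟩
    obtain ⟨i, hi, rfl⟩ := h.exists_ord a
    obtain ⟨j, hj, rfl⟩ := h.exists_ord b
    exact (hreach i hi).symm.trans (hreach j hj)
  have := (SimpleGraph.isTree_iff_minimal_connected.1 hT).2 hconn hle hadj
  rw [hH, SimpleGraph.fromRel_adj] at this
  exact this.2

/-- Every neighbour except the parent is a child and comes later, which is what makes a backward
pass meet children before parents. -/
theorem SearchOrder.lt_of_adj (h : SearchOrder T root n ord par) (hT : T.IsTree) {i : ℕ}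
    (hi : i < n) {w : Fin n} (hw : T.Adj (ord i) w) (hne : w ≠ par (ord i)) :
    ∃ j, i < j ∧ j < n ∧ ord j = w ∧ par w = ord i := by
  have hp : par w = ord i := (h.par_or_par hT hw).resolve_right (Ne.symm hne)
  obtain ⟨j, hj, rfl⟩ := h.exists_ord w
  rcases Nat.eq_zero_or_pos j with rfl | hj0
  · rw [h.ord_zero, h.par_root] at hp
    rw [h.ord_zero, hp] at hw
    exact absurd rfl hw.ne
  · obtain ⟨a, ha, h1, -⟩ := h.par j hj hj0
    have := h.inj a (by omega) i hi (h1.trans hp)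
    exact ⟨j, by omega, hj, rfl, hp⟩

theorem SearchOrder.par_adj (h : SearchOrder T root n ord par) (v : Fin n) :
    par v = v ∨ T.Adj (par v) v := by
  obtain ⟨j, hj, rfl⟩ := h.exists_ord v
  rcases Nat.eq_zero_or_pos j with rfl | hj0
  · left; rw [h.ord_zero, h.par_root]
  · obtain ⟨i, -, h1, h2⟩ := h.par j hj hj0
    right; rwa [h1] at h2

end Complete

/-- Array 8 lists the first `k` vertices found, array 9 gives the parents of the vertices found,
and array 10 marks the vertices found. -/
structure SearchMem (T : SimpleGraph (Fin n)) (root : Fin n) (k : ℕ) (ord : ℕ → Fin n)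
    (par : Fin n → Fin n) (s : Mem) : Prop where
  order : SearchOrder T root k ord par
  arr8 : ∀ j < k, s.arr 8 j = ord j
  arr9 : ∀ j < k, s.arr 9 (ord j) = par (ord j)
  vis : ∀ v : Fin n, s.arr 10 v ≠ 0 ↔ ∃ j < k, ord j = v

def searchStep : Prog :=
  load 26 4 21 ;;
  cond (.eq 26 25)
    (load 27 5 21 ;; load 28 10 27 ;;
      cond (.eq 28 3) (store 10 27 22 ;; store 8 23 27 ;; store 9 27 25 ;; succ 23 23) skip) skip ;;
  succ 21 21

/-- Scan the darts from the vertex with number in register 24 for new vertices. -/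
def searchVertex : Prog :=
  (load 25 8 24 ;; const 21 0) ;; .loop (.lt 21 2) searchStep ;; succ 24 24

def clearMarks : Prog := const 21 0 ;; .loop (.lt 21 0) (store 10 21 3 ;; succ 21 21)

/-- Breadth-first search from the vertex in register 6. -/
def search : Prog :=
  clearMarks ;;
  (const 22 1 ;; store 8 3 6 ;; store 9 6 6 ;; store 10 6 22 ;; const 23 1 ;; const 24 0) ;;
  .loop (.lt 24 23) searchVertex

/-- Registers below 20 and arrays below 8 are unchanged. -/
def SearchFrame (s s' : Mem) : Prop :=
  (∀ A, A < 8 → s'.arr A = s.arr A) ∧ ∀ r < 20, s'.reg r = s.reg r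

theorem runs_clearMarks {s : Mem} (henv : Env D src dst s) :
    Runs clearMarks s (3 * n + 2) fun s' => (∀ v : Fin n, s'.arr 10 v = 0) ∧ SearchFrame s s' := by
  refine Runs.seq_run rfl (t₂ := n * 3 + 1) ?_ (by simp only [Prog.cost]; omega)
  refine Runs.count (N := n) (t := 2) (fun i s' => s'.reg 21 = i ∧
      (∀ b < i, s'.arr 10 b = 0) ∧ SearchFrame s s')
    (fun _ _ h => h.1) (fun _ s' h => by rw [h.2.2.2 0 (by omega), henv.r0]) ?_
    (fun s' h => ⟨fun v => h.2.1 v v.2, h.2.2⟩) (i := 0) ?_ (Nat.zero_le _) le_rfl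
  · rintro i s' ⟨h1, h2, h3, h4⟩ hi
    refine Runs.of_run rfl le_rfl ?_
    have hz := h4 3 (by omega)
    rw [henv.r3] at hz
    refine ⟨by simp [Prog.run, h1], fun b hb => ?_, fun A hA => ?_, fun r hr => ?_⟩
    · simp only [Prog.run, Mem.setReg_arr, Mem.setArr_arr, if_true, h1, hz,
        Function.update_apply]
      split_ifs with h
      · rfl
      · exact h2 b (by omega)
    · simp (disch := omega) [Prog.run, if_neg, h3 A hA]
    · simp (disch := omega) [Prog.run, if_neg, h4 r hr]
  · refine ⟨by simp [Prog.run], fun b hb => by omega, fun A _ => rfl, fun r hr => ?_⟩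
    simp (disch := omega) [Prog.run, if_neg]

/-- Array 8 is the queue, with its head in register 24 and its end in register 23. By `hcl`, all
neighbours of the vertices before the head have been found. -/
theorem runs_searchVertex (hd : IsDartList T D src dst) {s₀ s : Mem} (henv : Env D src dst s₀)
    (hfr : SearchFrame s₀ s) {i k : ℕ} {ord : ℕ → Fin n} {par : Fin n → Fin n}
    (hs : SearchMem T root k ord par s) (h22 : s.reg 22 = 1) (h23 : s.reg 23 = k)
    (h24 : s.reg 24 = i) (hik : i < k)
    (hcl : ∀ j < i, ∀ w, T.Adj (ord j) w → ∃ a < k, ord a = w) :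
    Runs searchVertex s (12 * D + 4) fun s' => ∃ k' ord' par', SearchMem T root k' ord' par' s' ∧
      SearchFrame s₀ s' ∧ s'.reg 22 = 1 ∧ s'.reg 23 = k' ∧ s'.reg 24 = i + 1 ∧ i < k' ∧
      ∀ j < i + 1, ∀ w, T.Adj (ord' j) w → ∃ a < k', ord' a = w := by
  refine Runs.seq_run rfl (t₂ := 12 * D + 2) ?_ (by simp only [Prog.cost]; omega)
  refine Runs.seq (t₁ := D * 12 + 1) (t₂ := 1) (P := fun s' => ∃ k' ord' par',
    SearchMem T root k' ord' par' s' ∧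
      SearchFrame s₀ s' ∧ s'.reg 22 = 1 ∧ s'.reg 23 = k' ∧ s'.reg 24 = i ∧ i < k' ∧
      ∀ j < i + 1, ∀ w, T.Adj (ord' j) w → ∃ a < k', ord' a = w) ?_ ?_ (by omega)
  · refine Runs.count (N := D) (t := 11) (fun e s' => s'.reg 21 = e ∧ ∃ k' ord' par',
      SearchMem T root k' ord' par' s' ∧
      SearchFrame s₀ s' ∧ s'.reg 22 = 1 ∧ s'.reg 23 = k' ∧ s'.reg 24 = i ∧ s'.reg 25 = ord i ∧
      k ≤ k' ∧ (∀ j < k, ord' j = ord j) ∧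
      ∀ e' < e, src e' = ord i → ∃ a < k', ord' a = dst e')
      (fun _ _ h => h.1) (fun _ s' h => by
        obtain ⟨-, k', ord', par', -, h, -⟩ := h
        rw [h.2 2 (by omega), henv.r2]) ?_ ?_ (i := 0) ?_ (Nat.zero_le _) le_rfl
    · rintro e s' ⟨h21, k', ord', par', hs', hfr', h22', h23', h24', h25', hkk, hoo, hsc⟩ he
      refine Runs.of_run rfl (by simp [searchStep, Prog.cost, skip]) ?_
      have hse := henv.src e he
      have hde := henv.dst e he
      rw [← hfr'.1 4 (by omega)] at hse
      rw [← hfr'.1 5 (by omega)] at hde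
      have h3 := hfr'.2 3 (by omega)
      rw [henv.r3] at h3
      by_cases c1 : src e = ord i
      · by_cases c2 : s'.arr 10 (dst e) = 0
        · have hnew : ∀ j < k', ord' j ≠ dst e := fun j hj hje =>
            (hs'.vis (dst e)).2 ⟨j, hj, hje⟩ c2
          have hadj : T.Adj (ord' i) (dst e) := by
            rw [hoo i hik, ← c1]; exact hd.adj e he
          have hrun : searchStep.run s' = (((((((s'.setReg 26 (ord i)).setReg 27 (dst e)).setReg
              28 0).setArr 10 (dst e) 1).setArr 8 k' (dst e)).setArr 9 (dst e) (ord i)).setReg 23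
              (k' + 1)).setReg 21 (e + 1) := by
            simp [searchStep, Prog.run, h21, hse, hde, h25', c1, c2, h3, h22', h23']
          rw [hrun]
          refine ⟨by simp, k' + 1, _, _, ⟨hs'.order.extend (by omega) hadj hnew, fun j hj => ?_,
            fun j hj => ?_, fun v => ?_⟩, ⟨fun A hA => ?_, fun r hr => ?_⟩, by simpa using h22',
            by simp, by simpa using h24', by simpa using h25', by omega, fun j hj => ?_,
            fun e' he' hse' => ?_⟩
          · rcases Nat.lt_or_ge j k' with hjk | hjk
            · simp [Function.update_of_ne hjk.ne, hs'.arr8 j hjk]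
            · have : j = k' := by omega
              subst this
              simp
          · rcases Nat.lt_or_ge j k' with hjk | hjk
            · have h1 := hnew j hjk
              have h2 : (ord' j : ℕ) ≠ dst e := fun h => h1 (Fin.ext h)
              simp [Function.update_of_ne hjk.ne, Function.update_of_ne h1,
                Function.update_of_ne h2, hs'.arr9 j hjk]
            · have : j = k' := by omega
              subst this
              simp [hoo i hik]
          · by_cases hv : v = dst e
            · subst hv
              simp only [Mem.setReg_arr, Mem.setArr_arr]
              simp only [Nat.reduceEqDiff, if_true, if_false, Function.update_self]
              exact ⟨fun _ => ⟨k', by omega, Function.update_self ..⟩, fun _ => one_ne_zero⟩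
            · have h2 : (v : ℕ) ≠ dst e := fun h => hv (Fin.ext h)
              simp only [Mem.setReg_arr, Mem.setArr_arr]
              simp only [Nat.reduceEqDiff, if_true, if_false, Function.update_of_ne h2]
              rw [hs'.vis v]
              constructor
              · rintro ⟨j, hj, rfl⟩
                exact ⟨j, by omega, Function.update_of_ne hj.ne ..⟩
              · rintro ⟨j, hj, hjv⟩
                rcases Nat.lt_or_ge j k' with hjk | hjk
                · rw [Function.update_of_ne hjk.ne] at hjv
                  exact ⟨j, hjk, hjv⟩
                · have : j = k' := by omega
                  subst this
                  rw [Function.update_self] at hjv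
                  exact absurd hjv.symm hv
          · simp (disch := omega) [if_neg, hfr'.1 A hA]
          · simp (disch := omega) [if_neg, hfr'.2 r hr]
          · rw [Function.update_of_ne (by omega), hoo j hj]
          · rcases Nat.lt_or_ge e' e with hlt | hge
            · obtain ⟨a, ha, hae⟩ := hsc e' hlt hse'
              exact ⟨a, by omega, by rw [Function.update_of_ne ha.ne, hae]⟩
            · have : e' = e := by omega
              subst this
              exact ⟨k', by omega, Function.update_self ..⟩
        · have hrun : searchStep.run s' = (((s'.setReg 26 (ord i)).setReg 27 (dst e)).setReg
              28 (s'.arr 10 (dst e))).setReg 21 (e + 1) := by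
            simp [searchStep, Prog.run, h21, hse, hde, h25', c1, c2, h3]
          rw [hrun]
          refine ⟨by simp, k', ord', par', ⟨hs'.order, hs'.arr8, hs'.arr9, hs'.vis⟩,
            ⟨hfr'.1, fun r hr => ?_⟩, by simpa using h22', by simpa using h23',
            by simpa using h24', by simpa using h25', hkk, hoo, fun e' he' hse' => ?_⟩
          · simp (disch := omega) [if_neg, hfr'.2 r hr]
          · rcases Nat.lt_or_ge e' e with hlt | hge
            · exact hsc e' hlt hse'
            · have : e' = e := by omega
              subst this
              exact (hs'.vis _).1 c2
      · have c1' : (src e : ℕ) ≠ ord i := fun h => c1 (Fin.ext h)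
        have hrun : searchStep.run s' = (s'.setReg 26 (src e)).setReg 21 (e + 1) := by
          simp [searchStep, Prog.run, h21, hse, h25', c1']
        rw [hrun]
        refine ⟨by simp, k', ord', par', ⟨hs'.order, hs'.arr8, hs'.arr9, hs'.vis⟩,
          ⟨hfr'.1, fun r hr => ?_⟩, by simpa using h22', by simpa using h23',
          by simpa using h24', by simpa using h25', hkk, hoo, fun e' he' hse' => ?_⟩
        · simp (disch := omega) [if_neg, hfr'.2 r hr]
        · have : e' ≠ e := by rintro rfl; exact c1 hse'
          exact hsc e' (by omega) hse'
    · rintro s' ⟨h21, k', ord', par', hs', hfr', h22', h23', h24', h25', hkk, hoo, hsc⟩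
      refine ⟨k', ord', par', hs', hfr', h22', h23', h24', by omega, fun j hj w hw => ?_⟩
      rw [hoo j (by omega)] at hw
      rcases Nat.lt_or_ge j i with hlt | hge
      · obtain ⟨a, ha, haw⟩ := hcl j hlt w hw
        exact ⟨a, by omega, by rw [hoo a ha, haw]⟩
      · have : j = i := by omega
        subst this
        obtain ⟨e, he, h1, h2⟩ := hd.exists_dart _ _ hw
        obtain ⟨a, ha, hae⟩ := hsc e he h1
        exact ⟨a, ha, hae.trans h2⟩
    · refine ⟨by simp [Prog.run], k, ord, par, ⟨hs.order, hs.arr8, hs.arr9, hs.vis⟩,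
        ⟨hfr.1, fun r hr => ?_⟩, by simpa [Prog.run] using h22, by simpa [Prog.run] using h23,
        by simpa [Prog.run] using h24, ?_, le_rfl, fun _ _ => rfl, fun e' he' => by omega⟩
      · simp (disch := omega) [Prog.run, if_neg, hfr.2 r hr]
      · simp [Prog.run, h24, hs.arr8 i hik]
  · rintro s' ⟨k', ord', par', hs', hfr', h22', h23', h24', hik', hcl'⟩
    refine Runs.of_run rfl le_rfl ⟨k', ord', par', ⟨hs'.order, hs'.arr8, hs'.arr9, hs'.vis⟩,
        ⟨hfr'.1, fun r hr => ?_⟩, by simpa [Prog.run] using h22', by simpa [Prog.run] using h23',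
        by simpa [Prog.run] using h24', hik', hcl'⟩
    simp (disch := omega) [Prog.run, if_neg, hfr'.2 r hr]

/-- Arrays 8 and 9 describe a search order of all vertices. -/
structure Searched (T : SimpleGraph (Fin n)) (root : Fin n) (ord : ℕ → Fin n)
    (par : Fin n → Fin n) (s : Mem) : Prop where
  order : SearchOrder T root n ord par
  arr8 : ∀ j < n, s.arr 8 j = ord j
  arr9 : ∀ v : Fin n, s.arr 9 v = par v

theorem runs_search (hT : T.IsTree) (hd : IsDartList T D src dst) {s : Mem}
    (henv : Env D src dst s) (h6 : s.reg 6 = root) :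
    Runs search s (n * (12 * D + 5) + 3 * n + 9) fun s' =>
      (∃ ord par, Searched T root ord par s') ∧ SearchFrame s s' := by
  refine Runs.seq (runs_clearMarks henv) (t₂ := n * (12 * D + 5) + 7) ?_ (by omega)
  rintro s₁ ⟨hvis, hfr⟩
  refine Runs.seq_run rfl (t₂ := n * (12 * D + 5) + 1) ?_ (by simp only [Prog.cost]; omega)
  refine Runs.loop (t := 12 * D + 4) (k := n) (fun m s' => ∃ i k ord par, m + i = n ∧
      SearchMem T root k ord par s' ∧ SearchFrame s s' ∧ s'.reg 22 = 1 ∧ s'.reg 23 = k ∧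
      s'.reg 24 = i ∧ i ≤ k ∧ ∀ j < i, ∀ w, T.Adj (ord j) w → ∃ a < k, ord a = w) ?_ ?_ ?_ le_rfl
  · rintro m s' ⟨i, k, ord, par, hm, hs, hf, h22, h23, h24, hik, hcl⟩ hb
    rw [Test.holds_lt, h23, h24] at hb
    refine (runs_searchVertex hd henv hf hs h22 h23 h24 hb hcl).mono le_rfl ?_
    rintro s'' ⟨k', ord', par', k1, k2, k3, k4, k5, k6, k7⟩
    have := hs.order.le
    exact ⟨m - 1, by omega, i + 1, k', ord', par', by omega, k1, k2, k3, k4, k5, k6, k7⟩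
  · rintro m s' ⟨i, k, ord, par, hm, hs, hf, h22, h23, h24, hik, hcl⟩ hb
    rw [Test.holds_lt, h23, h24] at hb
    have : i = k := by omega
    subst this
    -- The head has reached the end, so the vertices found are closed under adjacency, and by
    -- connectedness they are all vertices.
    have hkn := hs.order.eq_of_closed hT.connected hcl
    subst hkn
    refine ⟨⟨ord, par, hs.order, hs.arr8, fun v => ?_⟩, hf⟩
    obtain ⟨j, hj, rfl⟩ := hs.order.exists_ord v
    exact hs.arr9 j hj
  · have h3 := hfr.2 3 (by omega)
    have h6' := hfr.2 6 (by omega)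
    rw [henv.r3] at h3
    rw [h6] at h6'
    refine ⟨0, 1, fun _ => root, fun v => root, by omega, ⟨⟨by omega, rfl, rfl,
      fun i hi j hj _ => by omega, fun j hj hj' => by omega⟩, fun j hj => ?_, fun j hj => ?_,
      fun v => ?_⟩, ⟨fun A hA => ?_, fun r hr => ?_⟩, by simp [Prog.run], by simp [Prog.run],
      by simp [Prog.run], by omega, fun j hj => by omega⟩
    · have : j = 0 := by omega
      subst this
      simp [Prog.run, h3, h6']
    · simp [Prog.run, h3, h6']
    · by_cases hv : v = root
      · subst hv
        simp [Prog.run, h3, h6']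
      · have h2 : (v : ℕ) ≠ root := fun h => hv (Fin.ext h)
        simp [Prog.run, h3, h6', Function.update_of_ne h2, hvis v, Ne.symm hv]
    · simp (disch := omega) [Prog.run, if_neg, hfr.1 A hA]
    · simp (disch := omega) [Prog.run, if_neg, hfr.2 r hr]

end Bfs
end TotTrans

namespace TotTrans
open Prog

/-! ### Colouring the children of a vertex -/

section Assign

variable {n D : ℕ} {T : SimpleGraph (Fin n)} {src dst : ℕ → Fin n} {x y : Fin n}

/-- A child takes the next free value of its bucket while there is one; a surplus child takes its
own label as colour. -/
def assignBody : Prog :=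
  load 24 12 22 ;; load 25 13 22 ;;
  cond (.lt 24 25) (succ 24 24 ;; store 12 22 24 ;; store 2 23 24) (store 2 23 22)

/-- Colour the children of the vertex in register 8, after the sweep. -/
def assign : Prog := forChildren assignBody

/-- State of the colouring of the children after the darts below `e` have been treated. -/
structure AssignInv (n : ℕ) (E : Finset ℕ) (lab : ℕ → ℕ) (src : ℕ → Fin n) (lo₀ hi col₀ : ℕ → ℕ)
    (e : ℕ) (lo col : ℕ → ℕ) : Prop where
  lo_eq : ∀ b ≤ n, lo b = min (lo₀ b + (E.filter fun e' => e' < e ∧ lab e' = b).card) (hi b)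
  used : ∀ b ≤ n, ∀ p, lo₀ b < p → p ≤ lo b → ∃ e' ∈ E, e' < e ∧ col (src e') = p
  le : ∀ e' ∈ E, e' < e → col (src e') ≤ lab e'
  pos : ∀ e' ∈ E, e' < e → 1 ≤ lab e' → 1 ≤ col (src e')
  other : ∀ v : Fin n, (∀ e' ∈ E, e' < e → src e' ≠ v) → col v = col₀ v

theorem AssignInv.skip {E : Finset ℕ} {lab lo₀ hi col₀ lo col : ℕ → ℕ} {e : ℕ}
    (h : AssignInv n E lab src lo₀ hi col₀ e lo col) (he : e ∉ E) :
    AssignInv n E lab src lo₀ hi col₀ (e + 1) lo col := by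
  have key : ∀ e' ∈ E, e' < e + 1 → e' < e := fun e' he' hlt => by
    have : e' ≠ e := by rintro rfl; exact he he'
    omega
  refine ⟨fun b hb => ?_, fun b hb p hp hp' => ?_, fun e' he' hlt => h.le e' he' (key e' he' hlt),
    fun e' he' hlt => h.pos e' he' (key e' he' hlt),
    fun v hv => h.other v fun e' he' hlt => hv e' he' (by omega)⟩
  · rw [h.lo_eq b hb, card_filter_lt_succ, if_neg fun h => he h.1, Nat.add_zero]
  · obtain ⟨e', h1, h2, h3⟩ := h.used b hb p hp hp'
    exact ⟨e', h1, by omega, h3⟩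

/-- A value from the bucket is at most `hi b ≤ b`, and a surplus child gets `b` itself, so no colour
exceeds its label. -/
theorem AssignInv.step {E : Finset ℕ} {lab lo₀ hi col₀ lo col lo' : ℕ → ℕ} {e c : ℕ}
    (hinj : Set.InjOn src E) (hhi : ∀ b ≤ n, hi b ≤ b)
    (h : AssignInv n E lab src lo₀ hi col₀ e lo col) (he : e ∈ E) (hlab : lab e ≤ n)
    (hc : (lo (lab e) < hi (lab e) ∧ c = lo (lab e) + 1 ∧ lo' = Function.update lo (lab e) c) ∨
      (¬ lo (lab e) < hi (lab e) ∧ c = lab e ∧ lo' = lo)) :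
    AssignInv n E lab src lo₀ hi col₀ (e + 1) lo' (Function.update col (src e) c) := by
  have hne : ∀ e' ∈ E, e' ≠ e → (src e' : ℕ) ≠ src e := fun e' he' hne h' =>
    hne (hinj he' he (Fin.ext h'))
  have hcol : ∀ e' ∈ E, e' ≠ e →
      Function.update col (src e) c (src e') = col (src e') := fun e' he' hee =>
    Function.update_of_ne (hne e' he' hee) ..
  have hb := hhi _ hlab
  have hl := h.lo_eq _ hlab
  refine ⟨fun b hbn => ?_, fun b hbn p hp hp' => ?_, fun e' he' hlt => ?_, fun e' he' hlt hle => ?_,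
    fun v hv => ?_⟩
  · have hl' := h.lo_eq b hbn
    rw [card_filter_lt_succ]
    by_cases hbe : lab e = b
    · subst hbe
      rw [if_pos ⟨he, rfl⟩]
      rcases hc with ⟨h1, h2, rfl⟩ | ⟨h1, h2, rfl⟩
      · rw [Function.update_self]; omega
      · omega
    · rw [if_neg fun h => hbe h.2, Nat.add_zero]
      rcases hc with ⟨h1, h2, rfl⟩ | ⟨h1, h2, rfl⟩
      · rw [Function.update_of_ne (Ne.symm hbe), hl']
      · exact hl'
  · have old : p ≤ lo b → ∃ e' ∈ E, e' < e + 1 ∧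
        Function.update col (src e) c (src e') = p := fun hpl => by
      obtain ⟨e', h1, h2, h3⟩ := h.used b hbn p hp hpl
      exact ⟨e', h1, by omega, by rw [hcol e' h1 h2.ne, h3]⟩
    rcases hc with ⟨h1, h2, rfl⟩ | ⟨h1, h2, rfl⟩
    · by_cases hbe : b = lab e
      · subst hbe
        rw [Function.update_self] at hp'
        rcases Nat.lt_or_ge (lo (lab e)) p with h3 | h3
        · exact ⟨e, he, by omega, by rw [Function.update_self]; omega⟩
        · exact old h3
      · rw [Function.update_of_ne hbe] at hp'
        exact old hp'
    · exact old hp'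
  · by_cases hee : e' = e
    · subst hee
      rw [Function.update_self]
      rcases hc with ⟨h1, h2, -⟩ | ⟨h1, h2, -⟩ <;> omega
    · rw [hcol e' he' hee]
      exact h.le e' he' (by omega)
  · by_cases hee : e' = e
    · subst hee
      rw [Function.update_self]
      rcases hc with ⟨h1, h2, -⟩ | ⟨h1, h2, -⟩ <;> omega
    · rw [hcol e' he' hee]
      exact h.pos e' he' (by omega) hle
  · have h1 := hv e he (by omega)
    rw [Function.update_of_ne (fun h' => h1 (Fin.ext h'.symm))]
    exact h.other v fun e' he' hlt => hv e' he' (by omega)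

theorem runs_assign (hd : IsDartList T D src dst) {s : Mem} (henv : Env D src dst s)
    (hx : s.reg 8 = x) (hy : s.reg 9 = y)
    (hlab : ∀ e ∈ childDarts D src dst x y, bump (s.arr 6) (s.arr 7) (s.reg 10) e ≤ n)
    (hsw : Swept n (childDarts D src dst x y) (bump (s.arr 6) (s.arr 7) (s.reg 10)) s) :
    Runs assign s (19 * D + 2) fun s' =>
      (∀ p, 1 ≤ p → p ≤ s.reg 20 → ∃ e ∈ childDarts D src dst x y, s'.arr 2 (src e) = p) ∧
      (∀ e ∈ childDarts D src dst x y,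
        s'.arr 2 (src e) ≤ bump (s.arr 6) (s.arr 7) (s.reg 10) e ∧
        (1 ≤ bump (s.arr 6) (s.arr 7) (s.reg 10) e → 1 ≤ s'.arr 2 (src e))) ∧
      (∀ v : Fin n, (∀ e ∈ childDarts D src dst x y, src e ≠ v) → s'.arr 2 v = s.arr 2 v) ∧
      (∀ A, A ≠ 2 → A ≠ 12 → s'.arr A = s.arr A) ∧ ∀ r < 20, s'.reg r = s.reg r := by
  have hinj := hd.injOn_src x y
  set E := childDarts D src dst x y with hE
  set lab := bump (s.arr 6) (s.arr 7) (s.reg 10) with hlabd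
  refine (runs_forChildren (x := x) (y := y) rfl henv hx hy
    (fun e a => (∀ A, A ≠ 2 → A ≠ 12 → a A = s.arr A) ∧
      AssignInv n E lab src (s.arr 12) (s.arr 13) (s.arr 2) e (a 12) (a 2))
    ?_ ?_ ?_ ?_).mono (by simp [assignBody, Prog.cost]; omega) (Q := fun s' => _ ∧ _) ?_
  · rintro e a ⟨ha, -⟩
    refine ⟨?_, ?_, ?_, ?_⟩ <;> exact ha _ (by omega) (by omega)
  · refine ⟨fun _ _ _ => rfl, fun b hb => ?_, fun b _ p hp hp' => by omega,
      fun _ _ h => by omega, fun _ _ h => by omega, fun _ _ => rfl⟩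
    have := hsw.bucket b hb
    simp
    omega
  · rintro e a ⟨ha, hI⟩ heD he
    exact ⟨ha, hI.skip he⟩
  · rintro e s' ⟨ha, hI⟩ he hr h21 h22 h23
    have hle := hlab e he
    replace h22 : s'.reg 22 = lab e := h22
    have hhi : ∀ b ≤ n, s.arr 13 b ≤ b := fun b hb => (hsw.bucket b hb).1
    have h13 := ha 13 (by omega) (by omega)
    by_cases c : s'.arr 12 (lab e) < s.arr 13 (lab e)
    · have hst := hI.step hinj hhi he hle (Or.inl ⟨c, rfl, rfl⟩)
      have hrun : assignBody.run s' = ((((s'.setReg 24 (s'.arr 12 (lab e))).setReg 25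
          (s.arr 13 (lab e))).setReg 24 (s'.arr 12 (lab e) + 1)).setArr 12 (lab e)
          (s'.arr 12 (lab e) + 1)).setArr 2 (src e) (s'.arr 12 (lab e) + 1) := by
        simp [assignBody, Prog.run, h22, h23, h13, c]
      rw [hrun]
      refine ⟨⟨fun A h1 h2 => ?_, by simpa using hst⟩, fun r hr => ?_⟩
      · simp [h1, h2, ha A h1 h2]
      · simp (disch := omega) [if_neg]
    · have hst := hI.step hinj hhi he hle (Or.inr ⟨c, rfl, rfl⟩)
      have hrun : assignBody.run s' = ((s'.setReg 24 (s'.arr 12 (lab e))).setReg 25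
          (s.arr 13 (lab e))).setArr 2 (src e) (lab e) := by
        simp [assignBody, Prog.run, h22, h23, h13, c]
      rw [hrun]
      refine ⟨⟨fun A h1 h2 => ?_, by simpa using hst⟩, fun r hr => ?_⟩
      · simp [h1, ha A h1 h2]
      · simp (disch := omega) [if_neg]
  · rintro s' ⟨⟨ha, hI⟩, hr⟩
    have hD : ∀ e ∈ E, e < D := fun e he => (mem_childDarts.1 he).1
    refine ⟨fun p hp hp' => ?_, fun e he => ⟨hI.le e he (hD e he), hI.pos e he (hD e he)⟩,
      fun v hv => hI.other v fun e he _ => hv e he, ha, fun r hr' => hr r (by omega)⟩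
    -- The values of bucket `b` are no more than its elements, so once all darts are treated the
    -- lower end has reached `hi b` and `p` has been handed out.
    obtain ⟨b, hb, h1, h2⟩ := hsw.cover p hp hp'
    have h3 := hI.lo_eq b hb
    have h4 := (hsw.bucket b hb).2.2
    have h5 : (E.filter fun e' => e' < D ∧ lab e' = b) = E.filter fun e' => lab e' = b :=
      Finset.filter_congr fun e he => by simp [hD e he]
    rw [h5] at h3
    obtain ⟨e, he, -, h6⟩ := hI.used b hb p h1 (by omega)
    exact ⟨e, he, h6⟩

end Assign

section BumpedSystem

universe v
variable {V : Type v} {T : SimpleGraph V}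

/-- If `x` is to have colour `F`, its children can supply the colours below `F`, and `F` too if `F ≤
rttr T y x`; otherwise `F` is left to the parent. A leaf child forces `F = 1`, and then bumping
makes its label positive. -/
theorem le_of_bumped_count [Finite V] (hT : T.IsTree) {x y : V} (hxy : y = x ∨ T.Adj y x)
    {E : Finset ℕ} {s : ℕ → V} (hs : Set.InjOn s E) (hW : s '' E = {w | T.Adj x w ∧ w ≠ y})
    {t m : ℕ → ℕ} (ht : ∀ e ∈ E, t e = rttr T x (s e)) (hm : ∀ e ∈ E, m e = rmttr T x (s e))
    {z F : ℕ} (hF : 1 ≤ F) (hFm : F ≤ rmttr T y x)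
    (h₁ : ∀ i, z ≤ i + (E.filter fun e => i < bump t m F e).card)
    (h₂ : ∃ i, i + (E.filter fun e => i < bump t m F e).card ≤ z) :
    (F ≤ rttr T y x → F ≤ z) ∧ F ≤ z + 1 ∧ ∀ e ∈ E, 1 ≤ bump t m F e := by
  have hc := childSet_of_adj hT hxy
  have hE : ∀ e ∈ E, T.Adj x (s e) ∧ s e ≠ y := fun e he => by
    have : s e ∈ s '' E := ⟨e, he, rfl⟩
    rw [hW] at this
    exact this
  have hrt : ∀ w ∈ childSet T y x, rttr T y w = rttr T x w := fun w hw => by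
    rw [hc] at hw; exact rttr_congr_root hT hxy hw.1 hw.2
  have hrm : ∀ w ∈ childSet T y x, rmttr T y w = rmttr T x w := fun w hw => by
    rw [hc] at hw; exact rmttr_congr_root hT hxy hw.1 hw.2
  have hfb : ∀ i, (E.filter fun e => i < bump t m F e) =
      E.filter fun e => i < bump (rttr T y) (rmttr T y) F (s e) :=
    fun i => Finset.filter_congr fun e he => by
      have hmem : s e ∈ childSet T y x := by rw [hc]; exact hE e he
      simp only [bump, ht e he, hm e he, hrt _ hmem, hrm _ hmem]
  have hg := isGreatest_sys_of_count hs (hW.trans hc.symm)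
    (l := bump (rttr T y) (rmttr T y) F) (z := z)
    (fun i => hfb i ▸ h₁ i) (by simpa only [hfb] using h₂)
  by_cases hpos : ∀ w ∈ childSet T y x, 1 ≤ rttr T y w
  · refine ⟨fun h => hg.2 ((le_rttr_iff_sys hT hpos hF).1 h), ?_, fun e he => ?_⟩
    · have := hg.2 (((le_rmttr_iff_sys hT hpos hF).1 hFm).mono fun w _ => le_bump _ _ _ w)
      omega
    · have hmem : s e ∈ childSet T y x := by rw [hc]; exact hE e he
      refine le_trans ?_ (le_bump t m F e)
      rw [ht e he, ← hrt _ hmem]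
      exact hpos _ hmem
  · push Not at hpos
    obtain ⟨w, hw, hw0⟩ := hpos
    have hw0' : rttr T y w = 0 := by omega
    have hl := labels_of_leaf_child hT hw hw0'
    have hF1 : F = 1 := by omega
    subst hF1
    have hb : ∀ e ∈ E, 1 ≤ bump t m 1 e := fun e he => by
      have h5 := rmttr_le_rttr_add_one hT x (s e)
      have h6 := one_le_rmttr hT x (s e)
      rw [← ht e he, ← hm e he] at h5
      rw [← hm e he] at h6
      unfold bump
      split_ifs <;> omega
    have hw' := hw
    rw [hc, ← hW] at hw'
    obtain ⟨e, he, rfl⟩ := hw'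
    have : 1 ≤ z := by
      refine hg.2 ⟨fun _ => s e, Function.injective_of_subsingleton _, fun i => ⟨hw, ?_⟩⟩
      have := hb e he
      have hmem : s e ∈ childSet T y x := hw
      simp only [bump, ht e he, hm e he] at this
      simp only [bump, hrt _ hmem, hrm _ hmem]
      omega
    exact ⟨fun _ => this, by omega, hb⟩

end BumpedSystem
end TotTrans

namespace TotTrans
open Prog

/-! ### The colouring of the whole tree -/

section Colour

variable {n D : ℕ} {T : SimpleGraph (Fin n)} {src dst : ℕ → Fin n} {root : Fin n}
  {ord : ℕ → Fin n} {par : Fin n → Fin n}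

/-- The colour of `w` can be realised in the subtree of `w` with parent `v`, possibly with the
help of the parent. -/
def Realisable (T : SimpleGraph (Fin n)) (f : ℕ → ℕ) (v w : Fin n) : Prop :=
  1 ≤ f w ∧ f w ≤ rmttr T v w ∧ (f w ≤ rttr T v w ∨ f w = f v)

def colourVertex : Prog :=
  (load 8 8 5 ;; load 9 9 8 ;; load 10 2 8) ;; fillSweep ;; assign ;; succ 5 5

/-- Colour the tree, starting with colour in register 7 at the root in register 6. -/
def colour : Prog := (store 2 6 7 ;; const 5 0) ;; .loop (.lt 5 0) colourVertex

/-- The colours assigned by `colourVertex` to the children of `x`. -/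
theorem runs_colourVertex (hT : T.IsTree) (hd : IsDartList T D src dst) {s : Mem}
    (henv : Env D src dst s) (hs : Searched T root ord par s)
    (hok : ∀ e < D, LabelOk T src dst s e) {i : ℕ} (hi : i < n) (h5 : s.reg 5 = i)
    (hr : Realisable T (s.arr 2) (par (ord i)) (ord i)) :
    Runs colourVertex s (17 * n + 35 * D + 31) fun s' =>
      (∀ w, T.Adj (ord i) w → w ≠ par (ord i) → Realisable T (s'.arr 2) (ord i) w) ∧
      (∀ p, 1 ≤ p → p ≤ s.arr 2 (ord i) →
        p ≤ rttr T (par (ord i)) (ord i) ∨ p < s.arr 2 (ord i) →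
        ∃ w, T.Adj (ord i) w ∧ s'.arr 2 (w : Fin n) = p) ∧
      (∀ v : Fin n, ¬ (T.Adj (ord i) v ∧ v ≠ par (ord i)) → s'.arr 2 v = s.arr 2 v) ∧
      (∀ A < 11, A ≠ 2 → s'.arr A = s.arr A) ∧ s'.reg 5 = i + 1 ∧
      ∀ r < 8, r ≠ 5 → s'.reg r = s.reg r := by
  have hinj := hd.injOn_src (ord i) (par (ord i))
  have himg := hd.image_src (ord i) (par (ord i))
  have hxy := hs.order.par_adj (ord i)
  refine Runs.seq_run rfl (t₂ := 17 * n + 35 * D + 28) ?_ (by simp only [Prog.cost]; omega)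
  set s₁ := (load 8 8 5 ;; load 9 9 8 ;; load 10 2 8).run s with hs₁
  have h8₁ : s₁.reg 8 = ord i := by simp [hs₁, Prog.run, h5, hs.arr8 i hi]
  have h9₁ : s₁.reg 9 = par (ord i) := by simp [hs₁, Prog.run, h5, hs.arr8 i hi, hs.arr9]
  have h10₁ : s₁.reg 10 = s.arr 2 (ord i) := by simp [hs₁, Prog.run, h5, hs.arr8 i hi]
  have ha₁ : s₁.arr = s.arr := rfl
  have hr₁ : ∀ r < 8, s₁.reg r = s.reg r := fun r hr => by
    simp (disch := omega) [hs₁, Prog.run, if_neg]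
  clear_value s₁
  have henv₁ : Env D src dst s₁ := henv.congr (fun r hr => hr₁ r (by omega))
    (by rw [ha₁]) (by rw [ha₁])
  have hlab : ∀ (F : ℕ), ∀ e ∈ childDarts D src dst (ord i) (par (ord i)),
      bump (s.arr 6) (s.arr 7) F e ≤ n := fun F e he =>
    bump_le_of_labelOk hT (hok e (mem_childDarts.1 he).1) F
  refine Runs.seq (runs_fillSweep henv₁ h8₁ h9₁ (by rw [ha₁]; exact hlab _))
    (t₂ := 19 * D + 3) ?_ (by omega)
  rintro s₂ ⟨hsw, ha₂, hr₂⟩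
  rw [ha₁] at hsw ha₂
  have hb := le_of_bumped_count hT hxy hinj himg (t := s.arr 6) (m := s.arr 7)
    (fun e he => by
      rw [(hok e (mem_childDarts.1 he).1).1, (mem_childDarts.1 he).2.1])
    (fun e he => by
      rw [(hok e (mem_childDarts.1 he).1).2, (mem_childDarts.1 he).2.1])
    (by rw [h10₁]; exact hr.1) (by rw [h10₁]; exact hr.2.1) hsw.le hsw.ge
  have henv₂ : Env D src dst s₂ := henv₁.congr (fun r hr => hr₂ r (by omega))
    (by rw [ha₂ 4 (by omega), ha₁]) (by rw [ha₂ 5 (by omega), ha₁])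
  have h67 : bump (s₂.arr 6) (s₂.arr 7) (s₂.reg 10) = bump (s.arr 6) (s.arr 7) (s₁.reg 10) := by
    rw [ha₂ 6 (by omega), ha₂ 7 (by omega), hr₂ 10 (by omega)]
  refine Runs.seq (runs_assign (x := ord i) (y := par (ord i)) hd henv₂
    (by rw [hr₂ 8 (by omega), h8₁]) (by rw [hr₂ 9 (by omega), h9₁])
    (by rw [h67]; exact hlab _) (by rw [h67]; exact hsw)) (t₂ := 1) ?_ (by omega)
  rw [h67, h10₁, ha₂ 2 (by omega)]
  rw [h10₁] at hb
  rintro s₃ ⟨k1, k2, k3, k4, k5⟩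
  refine Runs.of_run rfl le_rfl ?_
  have hself : s₃.arr 2 (ord i) = s.arr 2 (ord i) := by
    refine k3 _ fun e he h => ?_
    rw [mem_childDarts] at he
    have := hd.adj e he.1
    rw [h, he.2.1] at this
    exact this.ne rfl
  have ha : (Prog.run (succ 5 5) s₃).arr = s₃.arr := rfl
  rw [ha]
  refine ⟨fun w hw hwp => ?_, fun p hp hpf hpl => ?_, fun v hv => k3 v fun e he h => hv ?_,
    fun A hA hA2 => ?_, ?_, fun r hr h5 => ?_⟩
  · have hw' : w ∈ src '' (childDarts D src dst (ord i) (par (ord i))) := by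
      rw [himg]; exact ⟨hw, hwp⟩
    obtain ⟨e, he, rfl⟩ := hw'
    obtain ⟨h1, h2⟩ := k2 e he
    have ho := hok e (mem_childDarts.1 he).1
    rw [LabelOk, (mem_childDarts.1 he).2.1] at ho
    refine ⟨h2 (hb.2.2 e he), ?_⟩
    rw [hself]
    have h3 := rttr_le_rmttr hT (ord i) (src e)
    rw [← ho.1, ← ho.2] at h3 ⊢
    unfold bump at h1
    split_ifs at h1 with h4 <;> omega
  -- Below the colour `F` of the vertex, `F ≤ z + 1` suffices. For `p = F` the first alternative
  -- gives `F ≤ rttr`, hence `F ≤ z`.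
  · have : p ≤ s₂.reg 20 := by
      rcases hpl with h | h
      · rcases hr.2.2 with h' | h'
        · exact hpf.trans (hb.1 h')
        · have h6 := hb.1
          have h7 := hb.2.1
          by_cases h8 : s.arr 2 (ord i) ≤ rttr T (par (ord i)) (ord i)
          · exact hpf.trans (h6 h8)
          · omega
      · have := hb.2.1
        omega
    obtain ⟨e, he, hep⟩ := k1 p hp this
    rw [mem_childDarts] at he
    refine ⟨src e, ?_, hep⟩
    have := hd.adj e he.1
    rw [he.2.1] at this
    exact this.symm
  · have hw' : src e ∈ src '' (childDarts D src dst (ord i) (par (ord i))) := ⟨e, he, rfl⟩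
    rw [himg, h] at hw'
    exact hw'
  · rw [k4 A hA2 (by omega), ha₂ A hA]
  · simp [Prog.run, k5 5 (by omega), hr₂ 5 (by omega), hr₁ 5 (by omega), h5]
  · simp [Prog.run, h5, k5 r (by omega), hr₂ r (by omega), hr₁ r (by omega)]

/-- In search order, a vertex and its parent have their final colours before its children are
coloured. Once treated, a vertex stays satisfied: its neighbours are its parent and its children,
and later rounds change neither. -/
theorem runs_colour (hT : T.IsTree) (hd : IsDartList T D src dst) {s : Mem}
    (henv : Env D src dst s) (hs : Searched T root ord par s)
    (hok : ∀ e < D, LabelOk T src dst s e) (h6 : s.reg 6 = root) (h7 : s.reg 7 = ttr T root)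
    (hpos : 1 ≤ ttr T root) :
    Runs colour s (n * (17 * n + 35 * D + 32) + 3) fun s' =>
      (∀ v, Satisfied T Set.univ (fun v : Fin n => s'.arr 2 v) v) ∧
      s'.arr 2 root = ttr T root ∧ s'.arr 3 = s.arr 3 ∧ s'.reg 7 = s.reg 7 := by
  have hroot : ∀ j < n, ord j = root → j = 0 := fun j hj h =>
    hs.order.inj j hj 0 hs.order.pos (h.trans hs.order.ord_zero.symm)
  refine Runs.seq_run rfl (t₂ := n * (17 * n + 35 * D + 32) + 1) ?_
    (by simp only [Prog.cost]; omega)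
  refine Runs.count (N := n) (t := 17 * n + 35 * D + 31) (fun i s' => s'.reg 5 = i ∧
      (∀ j < i, j < n → ∀ w, T.Adj (ord j) w → w ≠ par (ord j) →
        Realisable T (s'.arr 2) (ord j) w) ∧
      (∀ j < i, j < n → Satisfied T Set.univ (fun v : Fin n => s'.arr 2 v) (ord j)) ∧
      s'.arr 2 root = ttr T root ∧
      (∀ A < 11, A ≠ 2 → s'.arr A = s.arr A) ∧ ∀ r < 8, r ≠ 5 → s'.reg r = s.reg r)
    (fun _ _ h => h.1)
    (fun _ s' h => by rw [h.2.2.2.2.2 0 (by omega) (by omega), henv.r0]) ?_ ?_ (i := 0) ?_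
    (Nat.zero_le _) le_rfl
  · rintro i s' ⟨h1, h2, h3, h4, h5, h8⟩ hi
    have henv' : Env D src dst s' := henv.congr (fun r hr => h8 r (by omega) (by omega))
      (h5 4 (by omega) (by omega)) (h5 5 (by omega) (by omega))
    have hs' : Searched T root ord par s' := ⟨hs.order,
      fun j hj => by rw [h5 8 (by omega) (by omega), hs.arr8 j hj],
      fun v => by rw [h5 9 (by omega) (by omega), hs.arr9 v]⟩
    have hok' : ∀ e < D, LabelOk T src dst s' e := fun e he => by
      have := hok e he
      rwa [LabelOk, ← h5 6 (by omega) (by omega), ← h5 7 (by omega) (by omega)] at this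
    -- the colour of the current vertex can be realised
    have hreal : Realisable T (s'.arr 2) (par (ord i)) (ord i) := by
      rcases Nat.eq_zero_or_pos i with rfl | hi0
      · rw [hs.order.ord_zero, hs.order.par_root, Realisable, h4]
        have := rttr_le_rmttr hT root root
        rw [rttr_self] at this ⊢
        exact ⟨hpos, this, Or.inl le_rfl⟩
      · obtain ⟨j, hj, hjp, hadj⟩ := hs.order.par i hi hi0
        rw [← hjp]
        refine h2 j hj (by omega) _ hadj fun h => ?_
        rcases Nat.eq_zero_or_pos j with rfl | hj0
        · rw [hs.order.ord_zero, hs.order.par_root] at h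
          have := hroot i hi h
          omega
        · obtain ⟨a, ha, hap, -⟩ := hs.order.par j (by omega) hj0
          have := hs.order.inj a (by omega) i hi (hap.trans h.symm)
          omega
    refine (runs_colourVertex hT hd henv' hs' hok' hi h1 hreal).mono le_rfl ?_
    rintro s'' ⟨k1, k2, k3, k4, k5, k6⟩
    -- colours change only at later vertices
    have hearly : ∀ j ≤ i, s''.arr 2 (ord j) = s'.arr 2 (ord j) := fun j hj =>
      k3 _ fun ⟨hadj, hne⟩ => by
        obtain ⟨a, ha, han, h, -⟩ := hs.order.lt_of_adj hT hi hadj hne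
        have := hs.order.inj a han j (by omega) h
        omega
    have hnbr : ∀ j < i, ∀ w, T.Adj (ord j) w → s''.arr 2 (w : Fin n) = s'.arr 2 w := by
      intro j hj w hw
      refine k3 _ fun ⟨hadj, hne⟩ => ?_
      obtain ⟨a, ha, han, h, hp⟩ := hs.order.lt_of_adj hT hi hadj hne
      by_cases hwp : w = par (ord j)
      · rcases Nat.eq_zero_or_pos j with rfl | hj0
        · rw [hs.order.ord_zero, hs.order.par_root] at hwp
          rw [hs.order.ord_zero, hwp] at hw
          exact hw.ne rfl
        · obtain ⟨b, hb, hbp, -⟩ := hs.order.par j (by omega) hj0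
          have := hs.order.inj b (by omega) a han (hbp.trans (hwp.symm.trans h.symm))
          omega
      · obtain ⟨b, hb, hbn, h', hp'⟩ := hs.order.lt_of_adj hT (by omega : j < n) hw hwp
        have := hs.order.inj j (by omega) i hi (hp'.symm.trans hp)
        omega
    have hi' := hearly i le_rfl
    refine ⟨k5, fun j hj hjn w hw hwp => ?_, fun j hj hjn => ?_, ?_, fun A hA hA2 => by
      rw [k4 A hA hA2, h5 A hA hA2], fun r hr hr5 => by rw [k6 r hr hr5, h8 r hr hr5]⟩
    · rcases Nat.lt_or_ge j i with hji | hji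
      · have := h2 j hji hjn w hw hwp
        rwa [Realisable, ← hearly j hji.le, ← hnbr j hji w hw] at this
      · have : j = i := by omega
        subst this
        exact k1 w hw hwp
    · rcases Nat.lt_or_ge j i with hji | hji
      · obtain ⟨g1, g2⟩ := h3 j hji hjn
        refine ⟨g1.trans_eq (hearly j hji.le).symm, fun p hp hp' => ?_⟩
        obtain ⟨w, -, hw, hwp⟩ := g2 p hp (hp'.trans_eq (hearly j hji.le))
        exact ⟨w, trivial, hw, (hnbr j hji w hw).trans hwp⟩
      · have : j = i := by omega
        subst this
        refine ⟨hreal.1.trans_eq hi'.symm, fun p hp hp' => ?_⟩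
        replace hp' : p ≤ s'.arr 2 (ord j) := hp'.trans_eq hi'
        -- The children fail to supply only the own colour, and only if it exceeds `rttr`; then
        -- realisability says that the parent has this colour. The root never gets there, its colour
        -- being its `rttr`.
        by_cases hc : p ≤ rttr T (par (ord j)) (ord j) ∨ p < s'.arr 2 (ord j)
        · obtain ⟨w, hw, hwp⟩ := k2 p hp hp' hc
          exact ⟨w, trivial, hw, hwp⟩
        · push Not at hc
          have hpe : p = s'.arr 2 (ord j) := by omega
          have hfp : s'.arr 2 (ord j) = s'.arr 2 (par (ord j)) := by
            rcases hreal.2.2 with h | h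
            · omega
            · exact h
          rcases Nat.eq_zero_or_pos j with rfl | hj0
          · rw [hs.order.ord_zero] at hpe hc
            rw [hs.order.par_root, rttr_self, hpe, h4] at hc
            omega
          · obtain ⟨b, hb, hbp, hadj⟩ := hs.order.par j hjn hj0
            refine ⟨ord b, trivial, hadj.symm, (hearly b hb.le).trans ?_⟩
            rw [hbp, ← hfp, hpe]
    · rw [← hs.order.ord_zero, hearly 0 (Nat.zero_le _), hs.order.ord_zero, h4]
  · rintro s' ⟨h1, h2, h3, h4, h5, h8⟩
    refine ⟨fun v => ?_, h4, h5 3 (by omega) (by omega), h8 7 (by omega) (by omega)⟩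
    obtain ⟨j, hj, rfl⟩ := hs.order.exists_ord v
    exact h3 j hj hj
  · refine ⟨by simp [Prog.run], fun j hj => by omega, fun j hj => by omega,
      by simp [Prog.run, h6, h7], fun A hA hA2 => by simp [Prog.run, hA2],
      fun r hr h5 => by simp [Prog.run, h5]⟩

end Colour
end TotTrans

namespace TotTrans
open Prog

/-! ### Doubling the edge list -/

section Setup

variable {n : ℕ} {T : SimpleGraph (Fin n)}

/-- The first end of the dart `e` in the doubled list. -/
def dartSrc (L : List (Fin n × Fin n)) (d : Fin n × Fin n) (e : ℕ) : Fin n :=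
  if e < L.length then (L.getD e d).1 else (L.getD (e - L.length) d).2

/-- The second end of the dart `e` in the doubled list. -/
def dartDst (L : List (Fin n × Fin n)) (d : Fin n × Fin n) (e : ℕ) : Fin n :=
  if e < L.length then (L.getD e d).2 else (L.getD (e - L.length) d).1

theorem IsEdgeList.length_add_one {L : List (Fin n × Fin n)} (hT : T.IsTree)
    (hL : IsEdgeList T L) : L.length + 1 = n := by
  classical
  have h := hT.card_edgeFinset
  rw [Fintype.card_fin] at h
  have he : (L.map fun e => s(e.1, e.2)).toFinset = T.edgeFinset := by
    ext e
    rw [List.mem_toFinset, SimpleGraph.mem_edgeFinset, hL.2]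
  have hc := List.toFinset_card_of_nodup hL.1
  rw [he, List.length_map] at hc
  omega

theorem IsEdgeList.isDartList {L : List (Fin n × Fin n)} (hT : T.IsTree) (hL : IsEdgeList T L)
    (d : Fin n × Fin n) : IsDartList T (2 * L.length) (dartSrc L d) (dartDst L d) := by
  have hadj : ∀ j, j < L.length → T.Adj (L.getD j d).1 (L.getD j d).2 := fun j hj => by
    rw [← SimpleGraph.mem_edgeSet, ← hL.2, List.getD_eq_getElem _ _ hj]
    exact List.mem_map.2 ⟨_, List.getElem_mem hj, rfl⟩
  have hinj : ∀ i j, i < L.length → j < L.length →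
      s((L.getD i d).1, (L.getD i d).2) = s((L.getD j d).1, (L.getD j d).2) → i = j := by
    intro i j hi hj h
    rw [List.getD_eq_getElem _ _ hi, List.getD_eq_getElem _ _ hj] at h
    have := (hL.1.getElem_inj_iff (i := i) (j := j) (hi := by simpa using hi)
      (hj := by simpa using hj)).1 (by simpa using h)
    exact this
  have hsym : ∀ e < 2 * L.length, ∃ j < L.length, (e = j ∨ e = L.length + j) ∧
      s(dartSrc L d e, dartDst L d e) = s((L.getD j d).1, (L.getD j d).2) := by
    intro e he
    rcases Nat.lt_or_ge e L.length with h | h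
    · exact ⟨e, h, Or.inl rfl, by simp [dartSrc, dartDst, h]⟩
    · exact ⟨e - L.length, by omega, Or.inr (by omega), by
        simp [dartSrc, dartDst, Nat.not_lt.2 h, Sym2.eq_swap]⟩
  have hadj' : ∀ e < 2 * L.length, T.Adj (dartSrc L d e) (dartDst L d e) := fun e he => by
    obtain ⟨j, hj, -, h⟩ := hsym e he
    rw [← SimpleGraph.mem_edgeSet, h]
    exact hadj j hj
  refine ⟨hadj', fun u v huv => ?_, fun e he e' he' h h' => ?_, ?_⟩
  · have hm := (hL.2 s(u, v)).2 huv
    obtain ⟨a, ha, hav⟩ := List.mem_map.1 hm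
    obtain ⟨j, hj, rfl⟩ := List.getElem_of_mem ha
    rcases Sym2.eq_iff.1 hav with ⟨h1, h2⟩ | ⟨h1, h2⟩
    · exact ⟨j, by omega, by simp [dartSrc, hj, h1], by simp [dartDst, hj, h2]⟩
    · exact ⟨L.length + j, by omega, by simp [dartSrc, hj, h2], by simp [dartDst, hj, h1]⟩
  · obtain ⟨j, hj, hej, hs⟩ := hsym e he
    obtain ⟨j', hj', hej', hs'⟩ := hsym e' he'
    have : j = j' := hinj j j' hj hj' (by rw [← hs, ← hs', h, h'])
    subst this
    have hne := (hadj j hj).ne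
    -- Positions in different halves hold opposite orientations of one edge, so equal sources would
    -- make it a loop.
    rcases hej with rfl | rfl <;> rcases hej' with rfl | rfl
    · rfl
    · simp [dartSrc, hj] at h
      rw [List.getD_eq_getElem _ _ hj] at hne
      exact absurd h hne
    · simp [dartSrc, hj] at h
      rw [List.getD_eq_getElem _ _ hj] at hne
      exact absurd h.symm hne
    · rfl
  · have := hL.length_add_one hT
    omega

/-- Write the doubled edge list and the constants. -/
def setup : Prog :=
  (succ 4 0 ;; copy 2 1 ;; const 5 0) ;;
  .loop (.lt 5 1)
    (load 21 0 5 ;; load 22 1 5 ;; store 4 5 21 ;; store 5 5 22 ;; store 4 2 22 ;;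
      store 5 2 21 ;; succ 5 5 ;; succ 2 2)

/-- Register 6 is still zero, so vertex 0 can serve as the root of a search. -/
theorem runs_setup (L : List (Fin n × Fin n)) (d : Fin n × Fin n) :
    Runs setup (inputMem L) (9 * L.length + 4) fun s' =>
      Env (2 * L.length) (dartSrc L d) (dartDst L d) s' ∧ s'.reg 6 = 0 := by
  refine Runs.seq_run rfl (t₂ := L.length * 9 + 1) ?_ (by simp only [Prog.cost]; omega)
  refine Runs.count (N := L.length) (t := 8) (fun i s' => s'.reg 5 = i ∧
      s'.reg 2 = L.length + i ∧ s'.reg 0 = n ∧ s'.reg 1 = L.length ∧ s'.reg 3 = 0 ∧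
      s'.reg 4 = n + 1 ∧ s'.reg 6 = 0 ∧
      s'.arr 0 = (inputMem L).arr 0 ∧ s'.arr 1 = (inputMem L).arr 1 ∧
      ∀ j < L.length, j < i → s'.arr 4 j = (L.getD j d).1 ∧ s'.arr 5 j = (L.getD j d).2 ∧
        s'.arr 4 (L.length + j) = (L.getD j d).2 ∧ s'.arr 5 (L.length + j) = (L.getD j d).1)
    (fun _ _ h => h.1) (fun _ s' h => h.2.2.2.1) ?_ ?_ (i := 0) ?_ (Nat.zero_le _) le_rfl
  · rintro i s' ⟨h1, h2, h3, h4, h5, h6, h7, h8, h9, h10⟩ hi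
    refine Runs.of_run rfl le_rfl ?_
    have ha : s'.arr 0 i = ((L.getD i d).1 : ℕ) := by
      rw [h8]; simp [inputMem, hi]
    have hb : s'.arr 1 i = ((L.getD i d).2 : ℕ) := by
      rw [h9]; simp [inputMem, hi]
    have hrun : (load 21 0 5 ;; load 22 1 5 ;; store 4 5 21 ;; store 5 5 22 ;; store 4 2 22 ;;
      store 5 2 21 ;; succ 5 5 ;; succ 2 2).run s' =
      ((((((((s'.setReg 21 (L.getD i d).1).setReg 22 (L.getD i d).2).setArr 4 i
        (L.getD i d).1).setArr 5 i (L.getD i d).2).setArr 4 (L.length + i)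
        (L.getD i d).2).setArr 5 (L.length + i) (L.getD i d).1).setReg 5 (i + 1)).setReg 2
        (L.length + i + 1)) := by
      simp only [Prog.run, Mem.setReg_reg, Mem.setArr_reg, Mem.setReg_arr]
      simp only [Nat.reduceEqDiff, if_true, if_false]
      simp only [h1, h2, ha, hb]
    rw [hrun]
    refine ⟨by simp, by simp; omega, by simpa using h3, by simpa using h4, by simpa using h5,
      by simpa using h6, by simpa using h7, by simpa using h8, by simpa using h9,
      fun j hj hji => ?_⟩
    simp only [Mem.setReg_arr, Mem.setArr_arr]
    simp only [Nat.reduceEqDiff, if_true, if_false, Function.update_apply]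
    rcases Nat.lt_or_ge j i with h | h
    · simp (disch := omega) only [if_neg]
      exact h10 j hj h
    · have : j = i := by omega
      subst this
      simp (disch := omega) only [if_neg, if_true, and_self]
  · rintro s' ⟨h1, h2, h3, h4, h5, h6, h7, h8, h9, h10⟩
    refine ⟨⟨h3, by omega, h5, h6, fun e he => ?_, fun e he => ?_⟩, h7⟩
    · rcases Nat.lt_or_ge e L.length with h | h
      · rw [(h10 e h h).1, dartSrc, if_pos h]
      · have := (h10 (e - L.length) (by omega) (by omega)).2.2.1
        rw [Nat.add_sub_cancel' h] at this
        rw [this, dartSrc, if_neg (by omega)]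
    · rcases Nat.lt_or_ge e L.length with h | h
      · rw [(h10 e h h).2.1, dartDst, if_pos h]
      · have := (h10 (e - L.length) (by omega) (by omega)).2.2.2
        rw [Nat.add_sub_cancel' h] at this
        rw [this, dartDst, if_neg (by omega)]
  · simp [Prog.run, inputMem]

end Setup

/-! ### Computing all labels -/

section Labels

variable {n D : ℕ} {T : SimpleGraph (Fin n)} {src dst : ℕ → Fin n} {root : Fin n}
  {ord : ℕ → Fin n} {par : Fin n → Fin n}

/-- Only registers from 8 on, register 5, and arrays 6, 7 and from 11 on have changed, and
correct labels have remained correct. -/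
structure LabelFrame (T : SimpleGraph (Fin n)) (src dst : ℕ → Fin n) (s s' : Mem) : Prop where
  reg : ∀ r < 8, r ≠ 5 → s'.reg r = s.reg r
  arr : ∀ A < 11, A ≠ 6 → A ≠ 7 → s'.arr A = s.arr A
  ok : ∀ e, LabelOk T src dst s e → LabelOk T src dst s' e

theorem LabelFrame.env {s s' : Mem} (h : LabelFrame T src dst s s') (henv : Env D src dst s) :
    Env D src dst s' :=
  henv.congr (fun r hr => h.reg r (by omega) (by omega)) (h.arr 4 (by omega) (by omega) (by omega))
    (h.arr 5 (by omega) (by omega) (by omega))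

theorem LabelFrame.searched {s s' : Mem} (h : LabelFrame T src dst s s')
    (hs : Searched T root ord par s) : Searched T root ord par s' :=
  ⟨hs.order, fun j hj => by rw [h.arr 8 (by omega) (by omega) (by omega), hs.arr8 j hj],
    fun v => by rw [h.arr 9 (by omega) (by omega) (by omega), hs.arr9 v]⟩

/-- The labels of the darts from vertices after the `i`-th to their parents are correct. -/
def UpOk (T : SimpleGraph (Fin n)) (D : ℕ) (src dst : ℕ → Fin n) (ord : ℕ → Fin n)
    (par : Fin n → Fin n) (i : ℕ) (s : Mem) : Prop :=
  ∀ e < D, ∀ j, i < j → j < n → src e = ord j → dst e = par (ord j) → LabelOk T src dst s e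

def upPass : Prog :=
  pred 5 0 ;; .loop (.lt 3 5) ((load 8 8 5 ;; load 9 9 8) ;; compute ;; pred 5 5)

/-- The dart from `ord i` to its parent depends on the darts from its children, which come later in
the order and are labelled already. -/
theorem runs_upPass (hT : T.IsTree) (hd : IsDartList T D src dst) {s : Mem}
    (henv : Env D src dst s) (hs : Searched T root ord par s) :
    Runs upPass s (n * (34 * n + 40 * D + 65) + 2) fun s' =>
      UpOk T D src dst ord par 0 s' ∧ LabelFrame T src dst s s' := by
  have hn := hs.order.pos
  refine Runs.seq_run rfl (t₂ := n * (34 * n + 40 * D + 65) + 1) ?_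
    (by simp only [Prog.cost]; omega)
  refine Runs.loop (t := 34 * n + 40 * D + 64) (k := n) (fun k s' => s'.reg 5 < n ∧
    s'.reg 5 ≤ k ∧
    UpOk T D src dst ord par (s'.reg 5) s' ∧ LabelFrame T src dst s s') ?_ ?_ ?_ le_rfl
  · rintro k s' ⟨h0, h1, h2, h3⟩ hb
    have henv' := h3.env henv
    have hs' := h3.searched hs
    rw [Test.holds_lt, henv'.r3] at hb
    set i := s'.reg 5 with hi
    obtain ⟨a, ha, hap, hadj⟩ := hs.order.par i h0 hb
    refine Runs.seq_run rfl (t₂ := 34 * n + 40 * D + 62) ?_ (by simp only [Prog.cost]; omega)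
    set s₁ := (load 8 8 5 ;; load 9 9 8).run s' with hs₁
    have h8 : s₁.reg 8 = ord i := by simp [hs₁, Prog.run, ← hi, hs'.arr8 i h0]
    have h9 : s₁.reg 9 = par (ord i) := by simp [hs₁, Prog.run, ← hi, hs'.arr8 i h0, hs'.arr9]
    have hr₁ : ∀ r < 8, s₁.reg r = s'.reg r := fun r hr => by
      simp (disch := omega) [hs₁, Prog.run, if_neg]
    have ha₁ : s₁.arr = s'.arr := rfl
    clear_value s₁
    refine Runs.seq (runs_compute (x := ord i) (y := par (ord i)) hT hd
      (hs.order.par_adj (ord i)) (henv'.congr (fun r hr => hr₁ r (by omega)) (by rw [ha₁])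
      (by rw [ha₁])) h8 h9 ?_) (t₂ := 1) ?_ (by omega)
    · intro e he
      rw [mem_childDarts] at he
      have hea := hd.adj e he.1
      rw [he.2.1] at hea
      obtain ⟨j, hij, hj, hje, hpe⟩ := hs.order.lt_of_adj hT h0 hea.symm he.2.2
      have := h2 e he.1 j hij hj hje.symm (by rw [hje, hpe, he.2.1])
      rwa [LabelOk, ha₁]
    · rintro s₂ ⟨-, k2, k3, k4, k5⟩
      refine Runs.of_run rfl le_rfl ⟨i - 1, by omega, ?_, ?_, ?_, ?_⟩
      · simp [Prog.run, k5 5 (by omega), hr₁ 5 (by omega), ← hi]; omega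
      · simp [Prog.run, k5 5 (by omega), hr₁ 5 (by omega), ← hi]
      · intro e he j hij hj hej hpj
        simp only [Prog.run, Mem.setReg_reg, if_true, k5 5 (by omega), hr₁ 5 (by omega),
          ← hi] at hij
        change LabelOk T src dst s₂ e
        rcases Nat.lt_or_ge i j with h | h
        · refine k3 e ?_
          have := h2 e he j h hj hej hpj
          rwa [LabelOk, ha₁]
        · have : j = i := by omega
          subst this
          exact k2 e he hej hpj
      · refine ⟨fun r hr hr5 => ?_, fun A hA h6 h7 => ?_, fun e he => k3 e ?_⟩
        · simp [Prog.run, hr5, k5 r (by omega), hr₁ r (by omega), h3.reg r hr hr5]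
        · simp [Prog.run, k4 A hA h6 h7, ha₁, h3.arr A hA h6 h7]
        · have := h3.ok e he
          rwa [LabelOk, ha₁]
  · rintro k s' ⟨h0, h1, h2, h3⟩ hb
    rw [Test.holds_lt, (h3.env henv).r3] at hb
    have : s'.reg 5 = 0 := by omega
    rw [this] at h2
    exact ⟨h2, h3⟩
  · refine ⟨?_, ?_, fun e he j hij hj => ?_, fun r hr hr5 => ?_, fun _ _ _ _ => rfl,
      fun e he => he⟩
    · simp [Prog.run, henv.r0, hn]
    · simp [Prog.run, henv.r0]
    · simp [Prog.run, henv.r0] at hij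
      omega
    · simp [Prog.run, hr5]

/-- The labels of the darts to vertices before the `i`-th from their parents are correct. -/
def DownOk (T : SimpleGraph (Fin n)) (D : ℕ) (src dst : ℕ → Fin n) (ord : ℕ → Fin n)
    (par : Fin n → Fin n) (i : ℕ) (s : Mem) : Prop :=
  ∀ e < D, ∀ j < i, j < n → dst e = ord j → src e = par (ord j) → LabelOk T src dst s e

def downPass : Prog :=
  const 5 1 ;; .loop (.lt 5 0) ((load 9 8 5 ;; load 8 9 9) ;; compute ;; succ 5 5)

/-- The dart from the parent `ord a` to `ord i` depends on the other darts into `ord a`: the one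
from the parent of `ord a`, treated before because `a < i`, and those from its other children, known
by `UpOk`. The root has no parent, so the pass begins at 1. -/
theorem runs_downPass (hT : T.IsTree) (hd : IsDartList T D src dst) {s : Mem}
    (henv : Env D src dst s) (hs : Searched T root ord par s)
    (hup : UpOk T D src dst ord par 0 s) :
    Runs downPass s (n * (34 * n + 40 * D + 65) + 2) fun s' =>
      (∀ e < D, LabelOk T src dst s' e) ∧ LabelFrame T src dst s s' := by
  have hn := hs.order.pos
  have hroot : ∀ v, T.Adj root v → v ≠ par root := by
    rintro v hv rfl
    rw [hs.order.par_root] at hv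
    exact hv.ne rfl
  refine Runs.seq_run rfl (t₂ := n * (34 * n + 40 * D + 65) + 1) ?_
    (by simp only [Prog.cost]; omega)
  refine Runs.count (N := n) (t := 34 * n + 40 * D + 64) (fun i s' => s'.reg 5 = i ∧ 0 < i ∧
    DownOk T D src dst ord par i s' ∧ LabelFrame T src dst s s') (fun _ _ h => h.1)
    (fun _ s' h => (h.2.2.2.env henv).r0) ?_ ?_ (i := 1) ?_ hn le_rfl
  · rintro i s' ⟨hi, h0, h2, h3⟩ hin
    have henv' := h3.env henv
    have hs' := h3.searched hs
    obtain ⟨a, ha, hap, hadj⟩ := hs.order.par i hin h0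
    refine Runs.seq_run rfl (t₂ := 34 * n + 40 * D + 62) ?_ (by simp only [Prog.cost]; omega)
    set s₁ := (load 9 8 5 ;; load 8 9 9).run s' with hs₁
    have h9 : s₁.reg 9 = ord i := by simp [hs₁, Prog.run, hi, hs'.arr8 i hin]
    have h8 : s₁.reg 8 = par (ord i) := by simp [hs₁, Prog.run, hi, hs'.arr8 i hin, hs'.arr9]
    have hr₁ : ∀ r < 8, s₁.reg r = s'.reg r := fun r hr => by
      simp (disch := omega) [hs₁, Prog.run, if_neg]
    have ha₁ : s₁.arr = s'.arr := rfl
    clear_value s₁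
    rw [hap] at hadj
    refine Runs.seq (runs_compute (x := par (ord i)) (y := ord i) hT hd
      (Or.inr hadj.symm) (henv'.congr (fun r hr => hr₁ r (by omega)) (by rw [ha₁])
      (by rw [ha₁])) h8 h9 ?_) (t₂ := 1) ?_ (by omega)
    · intro e he
      rw [mem_childDarts, ← hap] at he
      have hea := hd.adj e he.1
      rw [he.2.1] at hea
      have : LabelOk T src dst s' e := by
        by_cases hc : src e = par (ord a)
        · exact h2 e he.1 a ha (by omega) he.2.1 hc
        · obtain ⟨j, hij, hj, hje, hpe⟩ := hs.order.lt_of_adj hT (by omega : a < n) hea.symm hc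
          exact h3.ok e (hup e he.1 j (by omega) hj hje.symm (by rw [hje, hpe, he.2.1]))
      rwa [LabelOk, ha₁]
    · rintro s₂ ⟨-, k2, k3, k4, k5⟩
      refine Runs.of_run rfl le_rfl ⟨?_, by omega, ?_, ?_⟩
      · simp [Prog.run, k5 5 (by omega), hr₁ 5 (by omega), hi]
      · intro e he j hij hj hej hpj
        change LabelOk T src dst s₂ e
        rcases Nat.lt_or_ge j i with h | h
        · refine k3 e ?_
          have := h2 e he j h hj hej hpj
          rwa [LabelOk, ha₁]
        · have : j = i := by omega
          subst this
          exact k2 e he hpj hej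
      · refine ⟨fun r hr hr5 => ?_, fun A hA h6 h7 => ?_, fun e he => k3 e ?_⟩
        · simp [Prog.run, hr5, k5 r (by omega), hr₁ r (by omega), h3.reg r hr hr5]
        · simp [Prog.run, k4 A hA h6 h7, ha₁, h3.arr A hA h6 h7]
        · have := h3.ok e he
          rwa [LabelOk, ha₁]
  · rintro s' ⟨-, -, h2, h3⟩
    refine ⟨fun e he => ?_, h3⟩
    have hadj := hd.adj e he
    rcases hs.order.par_or_par hT hadj with h | h
    · obtain ⟨j, hj, hje⟩ := hs.order.exists_ord (dst e)
      exact h2 e he j hj hj hje.symm (by rw [hje, h])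
    · obtain ⟨j, hj, hje⟩ := hs.order.exists_ord (src e)
      rcases Nat.eq_zero_or_pos j with rfl | hj0
      · rw [hs.order.ord_zero] at hje
        rw [← hje] at hadj h
        exact absurd h.symm (hroot _ hadj)
      · exact h3.ok e (hup e he j hj0 hj hje.symm (by rw [hje, h]))
  · refine ⟨by simp [Prog.run], by omega, fun e he j hj hjn hej hpj => ?_, fun r hr hr5 => ?_,
      fun _ _ _ _ => rfl, fun e he => he⟩
    · have : j = 0 := by omega
      subst this
      rw [hs.order.ord_zero] at hej hpj
      have := hd.adj e he
      rw [hej] at this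
      exact absurd hpj (hroot _ this.symm)
    · simp [Prog.run, hr5]

def rootPass : Prog :=
  (const 5 0 ;; const 7 0) ;;
  .loop (.lt 5 0)
    ((copy 8 5 ;; copy 9 5) ;; compute ;;
      store 3 5 12 ;; cond (.lt 7 12) (copy 7 12 ;; copy 6 5) skip ;; succ 5 5)

/-- With all darts labelled, each vertex is taken as its own root (`y = x`), where `rttr` is `ttr`.
-/
theorem runs_rootPass (hn : 2 ≤ n) (hT : T.IsTree) (hd : IsDartList T D src dst) {s : Mem}
    (henv : Env D src dst s) (hok : ∀ e < D, LabelOk T src dst s e) :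
    Runs rootPass s (n * (34 * n + 40 * D + 69) + 3) fun s' =>
      (∀ v : Fin n, s'.arr 3 v = ttr T v) ∧
      (∃ c : Fin n, s'.reg 6 = c ∧ s'.reg 7 = ttr T c ∧ ∀ v, ttr T v ≤ ttr T c) ∧
      Env D src dst s' ∧ ∀ e < D, LabelOk T src dst s' e := by
  have : Nontrivial (Fin n) := Fin.nontrivial_iff_two_le.2 hn
  refine Runs.seq_run rfl (t₂ := n * (34 * n + 40 * D + 69) + 1) ?_
    (by simp only [Prog.cost]; omega)
  refine Runs.count (N := n) (t := 34 * n + 40 * D + 68) (fun i s' => s'.reg 5 = i ∧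
    (∀ v : Fin n, (v : ℕ) < i → s'.arr 3 v = ttr T v ∧ ttr T v ≤ s'.reg 7) ∧
    (i = 0 ∧ s'.reg 7 = 0 ∨ ∃ c : Fin n, s'.reg 6 = c ∧ s'.reg 7 = ttr T c) ∧
    Env D src dst s' ∧ ∀ e < D, LabelOk T src dst s' e) (fun _ _ h => h.1)
    (fun _ s' h => h.2.2.2.1.r0) ?_ ?_ (i := 0) ?_ (Nat.zero_le _) le_rfl
  · rintro i s' ⟨hi, h1, h2, h3, h4⟩ hin
    refine Runs.seq_run rfl (t₂ := 34 * n + 40 * D + 66) ?_ (by simp only [Prog.cost]; omega)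
    set s₁ := (copy 8 5 ;; copy 9 5).run s' with hs₁
    have h8 : s₁.reg 8 = i := by simp [hs₁, Prog.run, hi]
    have h9 : s₁.reg 9 = i := by simp [hs₁, Prog.run, hi]
    have hr₁ : ∀ r < 8, s₁.reg r = s'.reg r := fun r hr => by
      simp (disch := omega) [hs₁, Prog.run, if_neg]
    have ha₁ : s₁.arr = s'.arr := rfl
    clear_value s₁
    have henv₁ : Env D src dst s₁ := h3.congr (fun r hr => hr₁ r (by omega)) (by rw [ha₁])
      (by rw [ha₁])
    have hok₁ : ∀ e < D, LabelOk T src dst s₁ e := fun e he => by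
      have := h4 e he
      rwa [LabelOk, ha₁]
    refine Runs.seq (runs_compute (x := ⟨i, hin⟩) (y := ⟨i, hin⟩) hT hd (Or.inl rfl) henv₁ h8 h9
      fun e he => hok₁ e (mem_childDarts.1 he).1) (t₂ := 5) ?_ (by omega)
    rintro s₂ ⟨k1, -, k3, k4, k5⟩
    rw [rttr_self] at k1
    refine Runs.of_run rfl le_rfl ?_
    have h5₂ : s₂.reg 5 = i := by rw [k5 5 (by omega), hr₁ 5 (by omega), hi]
    have h7₂ : s₂.reg 7 = s'.reg 7 := by rw [k5 7 (by omega), hr₁ 7 (by omega)]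
    have h6₂ : s₂.reg 6 = s'.reg 6 := by rw [k5 6 (by omega), hr₁ 6 (by omega)]
    set b := ttr T ⟨i, hin⟩ with hbd
    -- Positivity makes the comparison with the initial zero succeed, so register 6 names a vertex
    -- attaining the maximum after the first round.
    have hb1 : 1 ≤ b := ttr_pos hT _
    set s₃ := (store 3 5 12 ;; cond (.lt 7 12) (copy 7 12 ;; copy 6 5) skip ;; succ 5 5).run s₂
      with hs₃
    have ha₃ : ∀ A, A ≠ 3 → s₃.arr A = s₂.arr A := fun A hA => by
      by_cases c : s'.reg 7 < b
      · simp [hs₃, Prog.run, h7₂, k1, c, hA]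
      · simp [hs₃, Prog.run, h7₂, k1, c, hA]
    have ha3 : s₃.arr 3 = Function.update (s₂.arr 3) i b := by
      by_cases c : s'.reg 7 < b
      · simp [hs₃, Prog.run, h7₂, k1, c, h5₂]
      · simp [hs₃, Prog.run, h7₂, k1, c, h5₂]
    have hr₃ : ∀ r < 5, s₃.reg r = s₂.reg r := fun r hr => by
      by_cases c : s'.reg 7 < b
      · simp (disch := omega) [hs₃, Prog.run, h7₂, k1, c, if_neg]
      · simp (disch := omega) [hs₃, Prog.run, h7₂, k1, c, if_neg]
    have h5₃ : s₃.reg 5 = i + 1 := by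
      by_cases c : s'.reg 7 < b
      · simp [hs₃, Prog.run, h7₂, k1, c, h5₂]
      · simp [hs₃, Prog.run, h7₂, k1, c, h5₂]
    have h7₃ : s₃.reg 7 = max (s'.reg 7) b ∧
        s₃.reg 6 = if s'.reg 7 < b then i else s'.reg 6 := by
      by_cases c : s'.reg 7 < b
      · simp [hs₃, Prog.run, h7₂, k1, c, h5₂, c.le]
      · simp [hs₃, Prog.run, h7₂, h6₂, k1, c, Nat.le_of_not_lt c]
    clear_value s₃
    refine ⟨h5₃, fun v hv => ?_, Or.inr ?_, henv₁.congr (fun r hr => ?_) ?_ ?_, fun e he => ?_⟩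
    · rw [ha3, h7₃.1]
      by_cases hvi : (v : ℕ) = i
      · have : v = ⟨i, hin⟩ := Fin.ext hvi
        subst this
        exact ⟨Function.update_self .., le_max_right _ _⟩
      · obtain ⟨g1, g2⟩ := h1 v (by omega)
        rw [Function.update_of_ne hvi, k4 3 (by omega) (by omega) (by omega), ha₁]
        exact ⟨g1, g2.trans (le_max_left _ _)⟩
    · rw [h7₃.1, h7₃.2]
      by_cases c : s'.reg 7 < b
      · exact ⟨⟨i, hin⟩, by rw [if_pos c], by rw [max_eq_right c.le]⟩
      · rw [if_neg c, max_eq_left (Nat.le_of_not_lt c)]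
        rcases h2 with ⟨-, h⟩ | h
        · omega
        · exact h
    · rw [hr₃ r hr, k5 r (by omega)]
    · rw [ha₃ 4 (by omega), k4 4 (by omega) (by omega) (by omega)]
    · rw [ha₃ 5 (by omega), k4 5 (by omega) (by omega) (by omega)]
    · have := k3 e (hok₁ e he)
      rwa [LabelOk, ← ha₃ 6 (by omega), ← ha₃ 7 (by omega)] at this
  · rintro s' ⟨-, h1, h2, h3, h4⟩
    refine ⟨fun v => (h1 v v.2).1, ?_, h3, h4⟩
    rcases h2 with ⟨h, -⟩ | ⟨c, hc, hc'⟩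
    · omega
    · exact ⟨c, hc, hc', fun v => hc' ▸ (h1 v v.2).2⟩
  · refine ⟨by simp [Prog.run], fun v hv => by omega, Or.inl ⟨rfl, by simp [Prog.run]⟩,
      henv.congr (fun r hr => ?_) rfl rfl, hok⟩
    simp (disch := omega) [Prog.run, if_neg]

end Labels

/-! ### The algorithm -/

section Algorithm

/-- The algorithm of the theorem. -/
def algorithm : Prog :=
  setup ;; search ;; upPass ;; downPass ;; rootPass ;; search ;; colour ;; copy 0 7

/-- The labels belong to darts, so those computed along the search from vertex 0 remain valid for
the search from a vertex `c` of largest `ttr`. -/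
theorem runs_algorithm {n : ℕ} (hn : 2 ≤ n) {T : SimpleGraph (Fin n)} (hT : T.IsTree)
    {L : List (Fin n × Fin n)} (hL : IsEdgeList T L) :
    Runs algorithm (inputMem L) (1000 * n ^ 2) fun s =>
      s.reg 0 = totalTransitivity T ∧
      (∃ P : Fin (totalTransitivity T) → Set (Fin n), IsTotalTransitivePartition T P ∧
        ∀ i v, v ∈ P i ↔ s.arr 2 v = (i : ℕ) + 1) ∧
      ∀ v : Fin n, s.arr 3 v = ttr T v := by
  have : Nontrivial (Fin n) := Fin.nontrivial_iff_two_le.2 hn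
  set o : Fin n := ⟨0, by omega⟩ with ho
  have hd := hL.isDartList hT (o, o)
  have hlen := hL.length_add_one hT
  set D := 2 * L.length with hD
  set src := dartSrc L (o, o) with hsrc
  set dst := dartDst L (o, o) with hdst
  have hDn : D ≤ 2 * n := hd.le
  have hnn : n * D ≤ 2 * n ^ 2 := by
    have := Nat.mul_le_mul_left n hDn
    nlinarith
  have hn2 : 2 * n ≤ n ^ 2 := by nlinarith
  -- time bounds of the stages
  have t1 : 9 * L.length + 4 ≤ 9 * n ^ 2 := by omega
  have t2 : n * (12 * D + 5) + 3 * n + 9 ≤ 40 * n ^ 2 := by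
    have : n * (12 * D + 5) = 12 * (n * D) + 5 * n := by ring
    omega
  have t3 : n * (34 * n + 40 * D + 65) + 2 ≤ 150 * n ^ 2 := by
    have : n * (34 * n + 40 * D + 65) = 34 * n ^ 2 + 40 * (n * D) + 65 * n := by ring
    omega
  have t4 : n * (34 * n + 40 * D + 69) + 3 ≤ 160 * n ^ 2 := by
    have : n * (34 * n + 40 * D + 69) = 34 * n ^ 2 + 40 * (n * D) + 69 * n := by ring
    omega
  have t5 : n * (17 * n + 35 * D + 32) + 3 ≤ 120 * n ^ 2 := by
    have : n * (17 * n + 35 * D + 32) = 17 * n ^ 2 + 35 * (n * D) + 32 * n := by ring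
    omega
  refine Runs.seq ((runs_setup L (o, o)).mono t1 fun _ => id) (t₂ := 900 * n ^ 2) ?_ (by omega)
  rintro s₁ ⟨henv₁, h6⟩
  refine Runs.seq ((runs_search (root := o) hT hd henv₁ (by rw [h6])).mono t2 fun _ => id)
    (t₂ := 800 * n ^ 2) ?_ (by omega)
  rintro s₂ ⟨⟨ord, par, hs₂⟩, hf₂⟩
  have henv₂ : Env D src dst s₂ := henv₁.congr (fun r hr => hf₂.2 r (by omega))
    (hf₂.1 4 (by omega)) (hf₂.1 5 (by omega))
  refine Runs.seq ((runs_upPass hT hd henv₂ hs₂).mono t3 fun _ => id)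
    (t₂ := 650 * n ^ 2) ?_ (by omega)
  rintro s₃ ⟨hup, hf₃⟩
  refine Runs.seq ((runs_downPass hT hd (hf₃.env henv₂) (hf₃.searched hs₂) hup).mono t3
    fun _ => id) (t₂ := 500 * n ^ 2) ?_ (by omega)
  rintro s₄ ⟨hok₄, hf₄⟩
  refine Runs.seq ((runs_rootPass hn hT hd (hf₄.env (hf₃.env henv₂)) hok₄).mono t4 fun _ => id)
    (t₂ := 300 * n ^ 2) ?_ (by omega)
  rintro s₅ ⟨h3, ⟨c, h6c, h7c, hmax⟩, henv₅, hok₅⟩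
  refine Runs.seq ((runs_search hT hd henv₅ h6c).mono t2 fun _ => id)
    (t₂ := 200 * n ^ 2) ?_ (by omega)
  rintro s₆ ⟨⟨ord', par', hs₆⟩, hf₆⟩
  have henv₆ : Env D src dst s₆ := henv₅.congr (fun r hr => hf₆.2 r (by omega))
    (hf₆.1 4 (by omega)) (hf₆.1 5 (by omega))
  have hok₆ : ∀ e < D, LabelOk T src dst s₆ e := fun e he => by
    have := hok₅ e he
    rwa [LabelOk, ← hf₆.1 6 (by omega), ← hf₆.1 7 (by omega)] at this
  refine Runs.seq ((runs_colour hT hd henv₆ hs₆ hok₆ (by rw [hf₆.2 6 (by omega), h6c])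
    (by rw [hf₆.2 7 (by omega), h7c]) (ttr_pos hT c)).mono t5 fun _ => id) (t₂ := 1) ?_
    (by omega)
  rintro s₇ ⟨hsat, hc, h3', h7'⟩
  have htt := totalTransitivity_eq hT hmax
  refine Runs.of_run rfl le_rfl ⟨?_, ?_, fun v => ?_⟩
  · simp [Prog.run, h7', hf₆.2 7 (by omega), h7c, htt]
  · change ∃ P : Fin (totalTransitivity T) → Set (Fin n), IsTotalTransitivePartition T P ∧
      ∀ i v, v ∈ P i ↔ s₇.arr 2 v = (i : ℕ) + 1
    refine ⟨fun i => {v | s₇.arr 2 v = (i : ℕ) + 1}, ?_, fun i v => Iff.rfl⟩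
    rw [htt, ← hc]
    refine exists_isTotalTransitivePartition (f := fun v : Fin n => s₇.arr 2 v) hsat fun v => ?_
    -- The colouring itself shows that the colour of `v` is at most `ttr T v`, so `c` has the top
    -- colour and the number of classes is `ttr T c`.
    refine le_trans ?_ ((hmax v).trans_eq hc.symm)
    exact (le_ttr_iff (hsat v).1).2 ⟨_, rfl, fun w _ => hsat w⟩
  · simp [Prog.run, h3', hf₆.1 3 (by omega), h3 v]

end Algorithm
end TotTrans

theorem mainTheorem2 :
    -- one program solves the problem for all trees, in at most `C * n ^ 2` steps
    (∃ (prog : TotTrans.Prog) (C : ℕ), ∀ (n : ℕ) (T : SimpleGraph (Fin n)), 2 ≤ n → T.IsTree →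
      ∀ L : List (Fin n × Fin n), TotTrans.IsEdgeList T L →
        ∃ (t : ℕ) (s : TotTrans.Mem),
          TotTrans.Exec prog (TotTrans.inputMem L) t s ∧
          t ≤ C * n ^ 2 ∧
          -- register 0: the total transitivity
          s.reg 0 = TotTrans.totalTransitivity T ∧
          -- array 2: a total transitive partition of maximum size
          (∃ P : Fin (TotTrans.totalTransitivity T) → Set (Fin n),
            TotTrans.IsTotalTransitivePartition T P ∧
            ∀ i v, v ∈ P i ↔ s.arr 2 v = (i : ℕ) + 1) ∧
          -- array 3: the total transitive numbers of all vertices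
          ∀ v : Fin n, s.arr 3 v = TotTrans.ttr T v) ∧
    -- the total transitivity is the maximum total transitive number, and the latter is the
    -- rooted total transitive number of the root
    (∀ (V : Type u) [Finite V] [Nontrivial V] (T : SimpleGraph V), T.IsTree →
      IsGreatest {k : ℕ | ∃ P : Fin k → Set V, TotTrans.IsTotalTransitivePartition T P}
        (TotTrans.totalTransitivity T) ∧
      IsGreatest (Set.range (TotTrans.ttr T)) (TotTrans.totalTransitivity T) ∧
      ∀ c : V, TotTrans.ttr T c = TotTrans.rttr T c c) ∧
    -- the recursion at a vertex `x` of the tree rooted at `c`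
    (∀ (V : Type u) [Finite V] [Nontrivial V] (T : SimpleGraph V), T.IsTree → ∀ c x : V,
      -- leaves
      (TotTrans.childSet T c x = ∅ → TotTrans.rmttr T c x = 1) ∧
      -- support vertices
      ((∃ w ∈ TotTrans.childSet T c x, TotTrans.childSet T c w = ∅) →
        TotTrans.rttr T c x = 1 ∧ TotTrans.rmttr T c x = 1) ∧
      -- all other vertices
      ((TotTrans.childSet T c x).Nonempty →
        (∀ w ∈ TotTrans.childSet T c x, (TotTrans.childSet T c w).Nonempty) →
        ∀ (k : ℕ) (v : Fin k → V), Function.Injective v →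
          Set.range v = TotTrans.childSet T c x →
          Monotone (fun j => TotTrans.passedLabel T c (v j)) →
          ∀ z : ℕ, IsGreatest {z : ℕ | ∃ i : Fin z → Fin k,
              TotTrans.IsAdmissibleSubsequence (fun j => TotTrans.passedLabel T c (v j)) i} z →
            ((∃ (i : Fin z → Fin k) (q : Fin k),
                TotTrans.IsAdmissibleSubsequence (fun j => TotTrans.passedLabel T c (v j)) i ∧
                q ∉ Set.range i ∧ TotTrans.rttr T c (v q) ≠ TotTrans.rmttr T c (v q) ∧
                z + 1 ≤ TotTrans.rmttr T c (v q)) →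
              TotTrans.rttr T c x = z + 1 ∧ TotTrans.rmttr T c x = z + 1) ∧
            ((¬ ∃ (i : Fin z → Fin k) (q : Fin k),
                TotTrans.IsAdmissibleSubsequence (fun j => TotTrans.passedLabel T c (v j)) i ∧
                q ∉ Set.range i ∧ TotTrans.rttr T c (v q) ≠ TotTrans.rmttr T c (v q) ∧
                z + 1 ≤ TotTrans.rmttr T c (v q)) →
              TotTrans.rttr T c x = z ∧ TotTrans.rmttr T c x = z + 1))) := by
  refine ⟨⟨TotTrans.algorithm, 1000, fun n T hn hT L hL => ?_⟩,
    fun V _ _ T hT => TotTrans.reduction_to_rooted_trees hT,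
    fun V _ _ T hT c x => TotTrans.recursion_at_vertex hT c x⟩
  obtain ⟨t, s, hex, ht, h⟩ := TotTrans.runs_algorithm hn hT hL
  exact ⟨t, s, hex, ht, h⟩
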